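/- Let $-1<q<1$. Let $\mathcal K_{\mathbb R}$ and $\mathcal H_{\mathbb R}$ be real Hilbert spaces, each equipped with a strongly continuous one-parameter group of orthogonal transformations, $(\mathsf U_t)_{t\in\mathbb R}$ and $(\mathsf V_t)_{t\in\mathbb R}$. Extend $\mathsf U_t$ to a unitary group $\mathsf U_t=A^{it}$ on the complexification $\mathcal K_{\mathbb C}$, where $A$ is positive and injective, and let $\mathcal K$ be the completion of $\mathcal K_{\mathbb C}$ in the inner product $\langle x,y\rangle_{\mathsf U}=\langle \tfrac{2A}{1+A}x,y\rangle$; let $\mathcal H$ be obtained from $(\mathcal H_{\mathbb R},\mathsf V)$ in the same way. Let $I$ and $J$ be the conjugations $x+iy\mapsto x-iy$ on $\mathcal K_{\mathbb C}\subset\mathcal K$ and $\mathcal H_{\mathbb C}\subset\mathcal H$. Let $\mathcal F_q(\mathcal K)$ be the $q$-Fock space, i.e. the completion of $\bigoplus_{n\ge 0}\mathcal K^{\otimes n}$ in the inner product for which tensors of different lengths are orthogonal and $$\langle e_1\otimes\dots\otimes e_n,f_1\otimes\dots\otimes f_n\rangle_q=\sum_{\sigma\in S_n}q^{\mathrm{inv}(\sigma)}\prod_{i=1}^n\langle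 e_i,f_{\sigma(i)}\rangle ,$$ with vacuum vector $\Omega$, let $a_q^*(h)$ be the left creation operators, $a_q(h)$ their adjoints, and let $\Gamma_q(\mathcal K)$ be the von Neumann algebra generated by $\{a_q^*(h)+a_q(h):h\in\mathcal K_{\mathbb R}\}$ on $\mathcal F_q(\mathcal K)$; similarly for $\mathcal H$. For $\xi$ in the $q$-Fock space, the Wick word $W(\xi)$ is the unique element $x$ of the algebra with $x\Omega=\xi$, if there is one. Theorem. Let $T:\mathcal K\to\mathcal H$ be a linear contraction with $T=JTI$, in the sense that for every $x\in\mathcal K_{\mathbb C}$ one has $TIx\in\mathcal H_{\mathbb C}$ and $JTIx=Tx$ (equivalently, $T$ is a contraction that maps $\mathcal K_{\mathbb R}$ into $\mathcal H_{\mathbb R}$). Then for all $n\ge 0$ and $e_1,\dots,e_n\in\mathcal K_{\mathbb C}$ the Wick words $W(e_1\otimes\dots\otimes e_n)\in\Gamma_q(\mathcal K)$ and $W(Te_1\otimes\dots\otimes Te_n)\in\Gamma_q(\mathcal H)$ exist, and there is a normal unital completely positive map $\Gamma_q(T):\Gamma_q(\mathcal K)\to\Gamma_q(\mathcal H)$ such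 that $$\Gamma_q(T)\,W(e_1\otimes\dots\otimes e_n)=W(Te_1\otimes\dots\otimes Te_n)\qquad(n\ge 0,\ e_1,\dots,e_n\in\mathcal K_{\mathbb C}),$$ and $\Gamma_q(T)$ preserves the vacuum state: $\langle\Omega,\Gamma_q(T)(x)\Omega\rangle=\langle\Omega,x\Omega\rangle$ for all $x\in\Gamma_q(\mathcal K)$. -/

import Mathlib

set_option linter.unusedSectionVars false

noncomputable section
open scoped ComplexInnerProductSpace
namespace QAW

/-! ### Von Neumann algebras as C*-algebras -/
section VN
variable {F : Type*} [NormedAddCommGroup F] [InnerProductSpace ℂ F] [CompleteSpace F]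

instance isClosed_vonNeumann (M : VonNeumannAlgebra F) :
    IsClosed (M.toStarSubalgebra : Set (F →L[ℂ] F)) := by
  rw [VonNeumannAlgebra.coe_toStarSubalgebra, ← M.centralizer_centralizer]
  exact Set.isClosed_centralizer _


theorem le_iff_coe_le {M : VonNeumannAlgebra F} (x y : M.toStarSubalgebra) :
    x ≤ y ↔ (x : F →L[ℂ] F) ≤ y := Iff.rfl

instance starOrderedRing_vonNeumann (M : VonNeumannAlgebra F) :
    StarOrderedRing M.toStarSubalgebra := by
  refine StarOrderedRing.of_le_iff fun x y => ⟨fun h => ?_, ?_⟩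
  · have h0 : (0 : F →L[ℂ] F) ≤ ((y - x : M.toStarSubalgebra) : F →L[ℂ] F) := by
      simpa using (show (x : F →L[ℂ] F) ≤ y from h)
    have hsa : IsSelfAdjoint (y - x) := by
      have := IsSelfAdjoint.of_nonneg h0
      exact Subtype.ext this
    have hsp : SpectrumRestricts (y - x) ContinuousMap.realToNNReal := by
      rw [SpectrumRestricts.nnreal_iff]
      intro r hr
      refine spectrum_nonneg_of_nonneg h0 ?_
      rw [← spectrum.algebraMap_mem_iff ℂ] at hr ⊢
      exact M.toStarSubalgebra.mem_spectrum_iff.1 hr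
    obtain ⟨p, hp₁, -, hp₃⟩ := CFC.exists_sqrt_of_isSelfAdjoint_of_quasispectrumRestricts
        hsa hsp
    refine ⟨p, ?_⟩
    rw [hp₁.star_eq, hp₃]; abel
  · rintro ⟨s, rfl⟩
    show (x : F →L[ℂ] F) ≤ x + star (s : F →L[ℂ] F) * s
    exact le_add_of_nonneg_right (star_mul_self_nonneg _)

/-- The von Neumann algebra generated by a set of bounded operators: the bicommutant of the
set together with its adjoints. -/
def generatedBy (S : Set (F →L[ℂ] F)) : VonNeumannAlgebra F where
  toStarSubalgebra := StarSubalgebra.centralizer ℂ (StarSubalgebra.centralizer ℂ S : Set (F →L[ℂ] F))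
  centralizer_centralizer' := by
    simp

theorem coe_generatedBy (S : Set (F →L[ℂ] F)) :
    (generatedBy S : Set (F →L[ℂ] F)) = Set.centralizer (Set.centralizer (S ∪ star S)) := by
  exact StarSubalgebra.coe_centralizer_centralizer ℂ S

open scoped CStarAlgebra in
/-- A completely positive map between von Neumann algebras is normal if it preserves the suprema
of bounded increasing nets. -/
def IsNormal {F' : Type*} [NormedAddCommGroup F'] [InnerProductSpace ℂ F'] [CompleteSpace F']
    {M : VonNeumannAlgebra F} {N : VonNeumannAlgebra F'}
    (Φ : M.toStarSubalgebra →CP N.toStarSubalgebra) : Prop :=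
  ∀ S : Set M.toStarSubalgebra, S.Nonempty → DirectedOn (· ≤ ·) S →
    ∀ a, IsLUB S a → IsLUB (Φ '' S) (Φ a)

end VN

/-! ### Complexification -/
/-- The complexification of a real Hilbert space `V`: pairs `(x, y)`, thought of as `x + i y`, with
the norm `(‖x‖² + ‖y‖²)^(1/2)`. -/
def Cplx (V : Type*) : Type _ := WithLp 2 (V × V)

namespace Cplx
section
variable {V : Type*} [NormedAddCommGroup V] [InnerProductSpace ℝ V]

instance : NormedAddCommGroup (Cplx V) := inferInstanceAs (NormedAddCommGroup (WithLp 2 (V × V)))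

instance [CompleteSpace V] : CompleteSpace (Cplx V) :=
  inferInstanceAs (CompleteSpace (WithLp 2 (V × V)))

/-- `mk x y` is the vector `x + i y`. -/
def mk (x y : V) : Cplx V := WithLp.toLp 2 (x, y)
/-- The real part of a vector of the complexification. -/
def re (z : Cplx V) : V := (WithLp.ofLp z).1
/-- The imaginary part of a vector of the complexification. -/
def im (z : Cplx V) : V := (WithLp.ofLp z).2

@[simp] theorem re_mk (x y : V) : (mk x y).re = x := rfl
@[simp] theorem im_mk (x y : V) : (mk x y).im = y := rfl
@[ext] theorem ext {z w : Cplx V} (h1 : z.re = w.re) (h2 : z.im = w.im) : z = w :=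
  WithLp.ofLp_injective 2 (Prod.ext h1 h2)
@[simp] theorem re_add (z w : Cplx V) : (z + w).re = z.re + w.re := rfl
@[simp] theorem im_add (z w : Cplx V) : (z + w).im = z.im + w.im := rfl
@[simp] theorem re_zero : (0 : Cplx V).re = 0 := rfl
@[simp] theorem im_zero : (0 : Cplx V).im = 0 := rfl

instance : SMul ℂ (Cplx V) :=
  ⟨fun c z => mk (c.re • z.re - c.im • z.im) (c.re • z.im + c.im • z.re)⟩

@[simp] theorem re_smul (c : ℂ) (z : Cplx V) : (c • z).re = c.re • z.re - c.im • z.im := rfl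
@[simp] theorem im_smul (c : ℂ) (z : Cplx V) : (c • z).im = c.re • z.im + c.im • z.re := rfl

instance : Module ℂ (Cplx V) where
  one_smul z := by ext <;> simp
  mul_smul c d z := by ext <;> simp <;> module
  smul_zero c := by ext <;> simp
  smul_add c z w := by ext <;> simp <;> abel
  add_smul c d z := by ext <;> simp <;> module
  zero_smul z := by ext <;> simp

theorem norm_sq_eq (z : Cplx V) : ‖z‖ ^ 2 = ‖z.re‖ ^ 2 + ‖z.im‖ ^ 2 :=
  WithLp.prod_norm_sq_eq_of_L2 (α := V) (β := V) z

instance : Inner ℂ (Cplx V) :=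
  ⟨fun z w => ⟨inner ℝ z.re w.re + inner ℝ z.im w.im, inner ℝ z.re w.im - inner ℝ z.im w.re⟩⟩

theorem inner_def (z w : Cplx V) : inner ℂ z w =
    ⟨inner ℝ z.re w.re + inner ℝ z.im w.im, inner ℝ z.re w.im - inner ℝ z.im w.re⟩ := rfl

instance : InnerProductSpace ℂ (Cplx V) where
  norm_smul_le c z := by
    refine le_of_eq ?_
    rw [← sq_eq_sq₀ (norm_nonneg _) (by positivity), mul_pow, norm_sq_eq, norm_sq_eq, ← Complex.normSq_eq_norm_sq,
      Complex.normSq_apply, re_smul, im_smul, norm_sub_sq_real, norm_add_sq_real]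
    simp only [norm_smul, inner_smul_left, inner_smul_right, mul_pow, Real.norm_eq_abs, sq_abs,
      real_inner_comm z.re z.im]
    simp
    ring
  norm_sq_eq_re_inner z := by
    rw [norm_sq_eq, inner_def]; simp
  conj_inner_symm z w := by
    apply Complex.ext <;> simp [inner_def, real_inner_comm]
  add_left z w u := by
    apply Complex.ext <;> simp [inner_def, inner_add_left] <;> ring
  smul_left z w c := by
    apply Complex.ext <;> simp [inner_def, inner_add_left, inner_sub_left, inner_smul_left] <;> ring

/-- The real vector `x`, as a vector of the complexification. -/
def ofReal (x : V) : Cplx V := mk x 0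

/-- The conjugation `x + i y ↦ x - i y`. -/
def conj (z : Cplx V) : Cplx V := mk z.re (-z.im)

/-- The unitary `x + i y ↦ f x + i f y` that extends the orthogonal transformation `f`. -/
def map (f : V ≃ₗᵢ[ℝ] V) : Cplx V ≃ₗᵢ[ℂ] Cplx V where
  toFun z := mk (f z.re) (f z.im)
  invFun z := mk (f.symm z.re) (f.symm z.im)
  map_add' z w := by ext <;> simp
  map_smul' c z := by ext <;> simp
  left_inv z := by ext <;> simp
  right_inv z := by ext <;> simp
  norm_map' z := by
    rw [← sq_eq_sq₀ (norm_nonneg _) (norm_nonneg _), norm_sq_eq, norm_sq_eq]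
    simp

end
end Cplx

/-! ### Functional calculus of one-parameter groups -/
/-- A strongly continuous one-parameter group of surjective linear isometries: of orthogonal
transformations if `𝕜 = ℝ`, of unitaries if `𝕜 = ℂ`. -/
structure OneParamGroup (𝕜 : Type*) [RCLike 𝕜] (E : Type*) [NormedAddCommGroup E]
    [InnerProductSpace 𝕜 E] where
  toFun : ℝ → E ≃ₗᵢ[𝕜] E
  map_zero : ∀ x, toFun 0 x = x
  map_add : ∀ s t x, toFun (s + t) x = toFun s (toFun t x)
  continuous_apply : ∀ x, Continuous fun t => toFun t x

namespace OneParamGroup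
section
variable {E : Type*} [NormedAddCommGroup E] [InnerProductSpace ℂ E]

/-- The reversed group `t ↦ U (-t)`. -/
def reverse (U : OneParamGroup ℂ E) : OneParamGroup ℂ E where
  toFun t := U.toFun (-t)
  map_zero x := by simpa using U.map_zero x
  map_add s t x := by rw [neg_add, U.map_add]
  continuous_apply x := (U.continuous_apply x).comp continuous_neg

theorem toFun_neg_toFun (U : OneParamGroup ℂ E) (t : ℝ) (x : E) :
    U.toFun (-t) (U.toFun t x) = x := by
  rw [← U.map_add]; simpa using U.map_zero x

theorem inner_toFun_left (U : OneParamGroup ℂ E) (t : ℝ) (x y : E) :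
    ⟪U.toFun t x, y⟫ = ⟪x, U.toFun (-t) y⟫ := by
  rw [← (U.toFun (-t)).inner_map_map, toFun_neg_toFun]

open MeasureTheory in
theorem integrableOn_orbit (U : OneParamGroup ℂ E) (x : E) :
    IntegrableOn (fun t : ℝ => (Real.exp (-t) : ℂ) • U.toFun t x) (Set.Ioi 0) := by
  have h : IntegrableOn (fun t : ℝ => Real.exp (-t) * ‖x‖) (Set.Ioi 0) :=
    (integrableOn_exp_neg_Ioi 0).mul_const _
  refine h.mono' ?_ (Filter.Eventually.of_forall fun t => ?_)
  · have := U.continuous_apply x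
    exact (Continuous.aestronglyMeasurable (by fun_prop))
  · rw [norm_smul, LinearIsometryEquiv.norm_map, Complex.norm_real, Real.norm_of_nonneg (Real.exp_pos _).le]

variable [CompleteSpace E]

/-- Writing `U t = exp (i t D)` with `D` self-adjoint, this is the bounded normal operator
`∫ t in (0, ∞), exp (-t) U t = (1 - i D)⁻¹`. -/
def resolvent (U : OneParamGroup ℂ E) : E →L[ℂ] E :=
  LinearMap.mkContinuous
    { toFun := fun x => ∫ t in Set.Ioi (0 : ℝ), (Real.exp (-t) : ℂ) • U.toFun t x
      map_add' := fun x y => by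
        rw [← MeasureTheory.integral_add (U.integrableOn_orbit x) (U.integrableOn_orbit y)]
        simp
      map_smul' := fun c x => by
        rw [RingHom.id_apply, ← MeasureTheory.integral_smul]
        simp [smul_comm c] } 1 (fun x => by
      refine (MeasureTheory.norm_integral_le_of_norm_le
        (g := fun t => Real.exp (-t) * ‖x‖) ((integrableOn_exp_neg_Ioi 0).mul_const _)
        (Filter.Eventually.of_forall fun t => ?_)).trans (le_of_eq ?_)
      · rw [norm_smul, LinearIsometryEquiv.norm_map, Complex.norm_real, Real.norm_of_nonneg (Real.exp_pos _).le]
      · rw [MeasureTheory.integral_mul_const, integral_exp_neg_Ioi_zero])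

theorem resolvent_apply (U : OneParamGroup ℂ E) (x : E) :
    U.resolvent x = ∫ t in Set.Ioi (0 : ℝ), (Real.exp (-t) : ℂ) • U.toFun t x := rfl

theorem adjoint_resolvent (U : OneParamGroup ℂ E) :
    star U.resolvent = U.reverse.resolvent := by
  rw [ContinuousLinearMap.star_eq_adjoint]
  symm
  rw [ContinuousLinearMap.eq_adjoint_iff]
  intro x y
  rw [resolvent_apply, resolvent_apply, ← integral_inner (U.integrableOn_orbit y),
    ← inner_conj_symm, ← integral_inner (U.reverse.integrableOn_orbit x), ← integral_conj]
  congr 1 with t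
  rw [inner_conj_symm, inner_smul_left, inner_smul_right, Complex.conj_ofReal, reverse]
  simp [U.inner_toFun_left]

theorem resolvent_toFun (U : OneParamGroup ℂ E) (s : ℝ) (x : E) :
    U.resolvent (U.toFun s x) = U.toFun s (U.resolvent x) := by
  rw [resolvent_apply, resolvent_apply]
  refine Eq.trans ?_ ((U.toFun s).toLinearIsometry.integral_comp_comm _)
  congr 1 with t
  rw [map_smul]
  show _ = _ • U.toFun s (U.toFun t x)
  rw [← U.map_add, ← U.map_add, add_comm]

instance isStarNormal_resolvent (U : OneParamGroup ℂ E) : IsStarNormal U.resolvent := by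
  constructor
  rw [adjoint_resolvent]
  ext x
  show U.reverse.resolvent (U.resolvent x) = U.resolvent (U.reverse.resolvent x)
  rw [resolvent_apply U.reverse, resolvent_apply U.reverse,
    ← U.resolvent.integral_comp_comm (U.reverse.integrableOn_orbit x)]
  congr 1 with t
  rw [map_smul]
  exact congrArg _ (U.resolvent_toFun (-t) x).symm

theorem eq_zero_of_resolvent_eq_zero (U : OneParamGroup ℂ E) {x : E} (hx : U.resolvent x = 0) :
    x = 0 := by
  set g : ℝ → E := fun t => (Real.exp (-t) : ℂ) • U.toFun t x with hg
  have hgc : Continuous g := by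
    have := U.continuous_apply x
    fun_prop
  have hI : ∀ s : ℝ, ∫ t in Set.Ioi s, g t = 0 := by
    intro s
    have h1 := U.resolvent_toFun s x
    rw [hx, _root_.map_zero, resolvent_apply] at h1
    have h2 := (MeasureTheory.measurePreserving_add_right MeasureTheory.volume s)
      |>.setIntegral_preimage_emb (measurableEmbedding_addRight s) g (Set.Ioi s)
    rw [← h2]
    have h3 : (fun t => t + s) ⁻¹' Set.Ioi s = Set.Ioi 0 := by ext t; simp
    rw [h3]
    have h4 : ∀ t : ℝ, g (t + s) =
        (Real.exp (-s) : ℂ) • ((Real.exp (-t) : ℂ) • U.toFun t (U.toFun s x)) := by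
      intro t
      rw [hg, ← U.map_add, smul_smul, ← Complex.ofReal_mul, ← Real.exp_add]
      ring_nf
    simp_rw [h4]
    rw [MeasureTheory.integral_smul, h1, smul_zero]
  have hz : ∀ s ∈ Set.Ici (0 : ℝ), ∫ t in (0 : ℝ)..s, g t = 0 := by
    intro s hs
    have := intervalIntegral.integral_Ioi_sub_Ioi (U.integrableOn_orbit x) hs
    rw [← this]
    change (∫ t in Set.Ioi (0 : ℝ), g t) - (∫ t in Set.Ioi s, g t) = 0
    rw [hI, hI, sub_zero]
  have hd : HasDerivWithinAt (fun s => ∫ t in (0 : ℝ)..s, g t) (g 0) (Set.Ici 0) 0 :=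
    (intervalIntegral.integral_hasDerivAt_right (hgc.intervalIntegrable _ _)
      (hgc.stronglyMeasurableAtFilter _ _) hgc.continuousAt).hasDerivWithinAt
  have hd0 : HasDerivWithinAt (fun s => ∫ t in (0 : ℝ)..s, g t) 0 (Set.Ici 0) 0 :=
    (hasDerivWithinAt_const (0 : ℝ) (Set.Ici 0) (0 : E)).congr hz (hz 0 (by simp))
  have := (uniqueDiffOn_Ici (0 : ℝ) 0 (by simp)).eq_deriv _ hd hd0
  simpa [hg, U.map_zero] using this

theorem denseRange_resolvent (U : OneParamGroup ℂ E) : DenseRange U.resolvent := by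
  have h : (LinearMap.range (U.resolvent : E →ₗ[ℂ] E)).topologicalClosure = ⊤ := by
    rw [Submodule.topologicalClosure_eq_top_iff, Submodule.eq_bot_iff]
    intro y hy
    refine U.reverse.eq_zero_of_resolvent_eq_zero ?_
    rw [← adjoint_resolvent, ContinuousLinearMap.star_eq_adjoint]
    refine ext_inner_left ℂ fun z => ?_
    rw [ContinuousLinearMap.adjoint_inner_right, inner_zero_right]
    exact hy _ ⟨z, rfl⟩
  have := (Submodule.dense_iff_topologicalClosure_eq_top).2 h
  exact this

/-- The value at `z = (1 - i l)⁻¹` of the function `z * f l`. -/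
def symbol (f : ℝ → ℂ) (z : ℂ) : ℂ := z * f (-(z⁻¹).im)

theorem continuous_symbol {f : ℝ → ℂ} (hf : Continuous f) {C : ℝ} (hC : ∀ l, ‖f l‖ ≤ C) :
    Continuous (symbol f) := by
  rw [continuous_iff_continuousAt]
  intro z
  by_cases hz : z = 0
  · subst hz
    have : Filter.Tendsto (symbol f) (nhds 0) (nhds 0) := by
      refine squeeze_zero_norm (a := fun z => ‖z‖ * C) (fun z => ?_) ?_
      · rw [symbol, norm_mul]
        exact mul_le_mul_of_nonneg_left (hC _) (norm_nonneg _)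
      · exact (Continuous.tendsto' (by fun_prop) _ _ (by simp))
    simpa [ContinuousAt, symbol] using this
  · have h1 : ContinuousAt (fun z : ℂ => z⁻¹) z := continuousAt_inv₀ hz
    have h2 : ContinuousAt (fun z : ℂ => -(z⁻¹).im) z :=
      (Complex.continuous_im.continuousAt.comp h1).neg
    exact continuousAt_id.mul (ContinuousAt.comp hf.continuousAt h2)

/-- The bounded operator `f(D)`, for `f` bounded and continuous, where `U t = exp (i t D)` with `D`
self-adjoint. In a spectral representation in which `U t` is multiplication by `exp (i t l)`, the
operator `U.resolvent` is multiplication by `z = (1 - i l)⁻¹`, so that `-(z⁻¹).im = l`, and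
`f(D)`, multiplication by `f l`, is the only bounded operator with
`f(D) (U.resolvent x) = (symbol f)(U.resolvent) x` for all `x`, where `symbol f` takes the value
`z * f l` at `z`, is continuous, and is applied by the continuous functional calculus. -/
def functionOf (U : OneParamGroup ℂ E) (f : ℝ → ℂ) : E →L[ℂ] E :=
  LinearMap.extendOfNorm (cfc (symbol f) U.resolvent : E →L[ℂ] E).toLinearMap
    U.resolvent.toLinearMap

theorem inner_cfc_apply (N : E →L[ℂ] E) [IsStarNormal N] {g h : ℂ → ℂ} (hg : Continuous g)
    (hh : Continuous h) (x : E) :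
    ⟪cfc g N x, cfc h N x⟫ = ⟪x, cfc (fun z => star (g z) * h z) N x⟫ := by
  rw [cfc_mul (fun z => star (g z)) h N, cfc_star, ContinuousLinearMap.star_eq_adjoint]
  show _ = ⟪x, ContinuousLinearMap.adjoint (cfc g N) (cfc h N x)⟫
  rw [ContinuousLinearMap.adjoint_inner_right]

open scoped ComplexOrder in
theorem inner_cfc_nonneg (N : E →L[ℂ] E) [IsStarNormal N] {g : ℂ → ℂ} {r : ℂ → ℝ}
    (h : ∀ z, 0 ≤ r z) (hg : ∀ z, g z = (r z : ℂ)) (x : E) : 0 ≤ ⟪x, cfc g N x⟫ := by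
  have : 0 ≤ cfc g N := cfc_nonneg fun z _ => by rw [hg]; exact Complex.zero_le_real.2 (h z)
  rw [ContinuousLinearMap.nonneg_iff_isPositive] at this
  exact this.inner_nonneg_right x

open scoped ComplexOrder in
theorem norm_cfc_symbol_le (U : OneParamGroup ℂ E) {f : ℝ → ℂ} (hf : Continuous f) {C : ℝ}
    (hC : ∀ l, ‖f l‖ ≤ C) (x : E) : ‖cfc (symbol f) U.resolvent x‖ ≤ C * ‖U.resolvent x‖ := by
  have hC0 : 0 ≤ C := (norm_nonneg _).trans (hC 0)
  have hs := continuous_symbol hf hC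
  rw [← sq_le_sq₀ (norm_nonneg _) (by positivity), mul_pow, ← sub_nonneg]
  have h1 := inner_cfc_apply U.resolvent hs hs x
  have h2 := inner_cfc_apply U.resolvent continuous_id continuous_id x
  rw [cfc_id ℂ U.resolvent] at h2
  have h3 := inner_cfc_nonneg U.resolvent
    (g := fun z => (C ^ 2 : ℂ) * (star (id z) * id z) - star (symbol f z) * symbol f z)
    (r := fun z => C ^ 2 * ‖z‖ ^ 2 - ‖symbol f z‖ ^ 2) (fun z => by
      rw [symbol, norm_mul, mul_pow, sub_nonneg, mul_comm]
      exact mul_le_mul_of_nonneg_right (pow_le_pow_left₀ (norm_nonneg _) (hC _) 2) (by positivity))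
    (fun z => by
      simp only [id, Complex.star_def, Complex.conj_mul']
      push_cast; ring) x
  rw [cfc_sub (fun z => (C ^ 2 : ℂ) * (star (id z) * id z)) _ _ (by fun_prop) (by fun_prop),
    cfc_const_mul _ (fun z => star (id z) * id z) _ (by fun_prop), sub_apply, inner_sub_right,
    smul_apply, inner_smul_right, ← h1, ← h2, inner_self_eq_norm_sq_to_K, inner_self_eq_norm_sq_to_K] at h3
  exact Complex.zero_le_real.1 (by push_cast; exact h3)

theorem functionOf_resolvent (U : OneParamGroup ℂ E) {f : ℝ → ℂ} (hf : Continuous f) {C : ℝ}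
    (hC : ∀ l, ‖f l‖ ≤ C) (x : E) :
    U.functionOf f (U.resolvent x) = cfc (symbol f) U.resolvent x :=
  LinearMap.extendOfNorm_eq (f := (cfc (symbol f) U.resolvent : E →L[ℂ] E).toLinearMap)
    U.denseRange_resolvent ⟨C, fun x => U.norm_cfc_symbol_le hf hC x⟩ x

open scoped ComplexOrder in
theorem isPositive_functionOf (U : OneParamGroup ℂ E) {f : ℝ → ℝ} (hf : Continuous f) {C : ℝ}
    (hC : ∀ l, f l ≤ C) (h0 : ∀ l, 0 ≤ f l) : (U.functionOf fun l => (f l : ℂ)).IsPositive := by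
  have hf' : Continuous fun l => (f l : ℂ) := by fun_prop
  have hC' : ∀ l, ‖(f l : ℂ)‖ ≤ C := fun l => by
    rw [Complex.norm_real, Real.norm_of_nonneg (h0 l)]; exact hC l
  have key : ∀ x, 0 ≤ ⟪U.functionOf (fun l => (f l : ℂ)) x, x⟫ := by
    intro x
    refine U.denseRange_resolvent.induction_on
      (p := fun x => 0 ≤ ⟪U.functionOf (fun l => (f l : ℂ)) x, x⟫) x ?_ fun y => ?_
    · exact isClosed_le (by fun_prop) (by fun_prop)
    · rw [U.functionOf_resolvent hf' hC']
      have h1 := inner_cfc_apply U.resolvent (continuous_symbol hf' hC') continuous_id y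
      rw [cfc_id ℂ U.resolvent] at h1
      rw [h1]
      refine inner_cfc_nonneg U.resolvent (r := fun z => f (-(z⁻¹).im) * ‖z‖ ^ 2)
        (fun z => mul_nonneg (h0 _) (by positivity)) (fun z => ?_) y
      simp only [id, symbol, Complex.star_def, map_mul, Complex.conj_ofReal]
      rw [mul_right_comm, Complex.conj_mul']
      push_cast; ring
  rw [ContinuousLinearMap.isPositive_iff_complex]
  intro x
  have h := Complex.le_def.1 (key x)
  exact ⟨Complex.ext rfl h.2, h.1⟩

/-- The operator `2 A / (1 + A)`, where `A = exp D` is the positive injective operator with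
`U t = exp (i t D) = A ^ (i t)`. -/
def twoADivOneAddA (U : OneParamGroup ℂ E) : E →L[ℂ] E :=
  U.functionOf fun l => ((2 * Real.exp l / (1 + Real.exp l) : ℝ) : ℂ)

theorem isPositive_twoADivOneAddA (U : OneParamGroup ℂ E) : U.twoADivOneAddA.IsPositive := by
  refine U.isPositive_functionOf (C := 2) ?_ (fun l => ?_) (fun l => by positivity)
  · exact Continuous.div (by fun_prop) (by fun_prop) fun l => by positivity
  · rw [div_le_iff₀ (by positivity)]; linarith [Real.exp_pos l]

end
end OneParamGroup

/-! ### The `q`-Fock space -/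
/-- The number of inversions of a permutation of `{0, …, n - 1}`. -/
def inversions {n : ℕ} (σ : Equiv.Perm (Fin n)) : ℕ :=
  (Finset.univ.filter fun p : Fin n × Fin n => p.1 < p.2 ∧ σ p.2 < σ p.1).card

section
variable {E : Type*} [NormedAddCommGroup E] [InnerProductSpace ℂ E]

/-- The `q`-inner product of two simple tensors of the same length `n`:
`∑ σ, q ^ inv(σ) ∏ i, ⟪e i, f (σ i)⟫`, over the permutations `σ` of `n` letters. -/
def levelKernel (q : ℝ) {n : ℕ} (e f : Fin n → E) : ℂ :=
  ∑ σ : Equiv.Perm (Fin n), (q : ℂ) ^ inversions σ * ∏ i, ⟪e i, f (σ i)⟫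

/-- The `q`-inner product of two simple tensors; tensors of different lengths are orthogonal. -/
def kernel (q : ℝ) (e f : Σ n, Fin n → E) : ℂ :=
  if h : e.1 = f.1 then levelKernel q e.2 (fun i => f.2 (Fin.cast h i)) else 0

theorem kernel_same (q : ℝ) {n : ℕ} (e f : Fin n → E) :
    kernel q ⟨n, e⟩ ⟨n, f⟩ = levelKernel q e f := by simp [kernel]

theorem kernel_ne (q : ℝ) {e f : Σ n, Fin n → E} (h : e.1 ≠ f.1) : kernel q e f = 0 := by
  simp [kernel, h]

theorem two_mul_inversions {n : ℕ} (σ : Equiv.Perm (Fin n)) :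
    2 * inversions σ =
      (Finset.univ.filter fun p : Fin n × Fin n => ¬ (p.1 < p.2 ↔ σ p.1 < σ p.2)).card := by
  have h1 : (Finset.univ.filter fun p : Fin n × Fin n => ¬ (p.1 < p.2 ↔ σ p.1 < σ p.2)) =
      (Finset.univ.filter fun p : Fin n × Fin n => p.1 < p.2 ∧ σ p.2 < σ p.1) ∪
      (Finset.univ.filter fun p : Fin n × Fin n => p.2 < p.1 ∧ σ p.1 < σ p.2) := by
    ext ⟨a, b⟩
    simp only [Finset.mem_filter, Finset.mem_univ, true_and, Finset.mem_union]
    rcases lt_trichotomy a b with h | h | h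
    · have : σ a ≠ σ b := fun h' => h.ne (σ.injective h')
      grind
    · subst h; simp
    · have : σ a ≠ σ b := fun h' => h.ne' (σ.injective h')
      grind
  have h2 : (Finset.univ.filter fun p : Fin n × Fin n => p.2 < p.1 ∧ σ p.1 < σ p.2).card =
      inversions σ := by
    rw [inversions]
    refine Finset.card_bij (fun p _ => (p.2, p.1)) ?_ ?_ ?_
    · simp
    · rintro ⟨a, b⟩ _ ⟨c, d⟩ _ h; simp at h ⊢; tauto
    · rintro ⟨a, b⟩ h; exact ⟨(b, a), by simpa using h, rfl⟩
  rw [h1, Finset.card_union_of_disjoint, h2, ← inversions, two_mul]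
  rw [Finset.disjoint_left]
  rintro ⟨a, b⟩
  simp only [Finset.mem_filter, Finset.mem_univ, true_and]
  intro h h'; exact absurd h.1 (not_lt_of_gt h'.1)

/-- The inversions of `τ σ⁻¹` correspond to the pairs that `σ` and `τ` order differently. -/
theorem inversions_mul_inv {n : ℕ} (σ τ : Equiv.Perm (Fin n)) :
    inversions (τ * σ⁻¹) = ((Finset.univ.filter fun p : Fin n × Fin n => p.1 < p.2).filter
      fun p => ¬ (σ p.1 < σ p.2 ↔ τ p.1 < τ p.2)).card := by
  have h1 := two_mul_inversions (τ * σ⁻¹)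
  have h2 : (Finset.univ.filter fun p : Fin n × Fin n =>
        ¬ (p.1 < p.2 ↔ (τ * σ⁻¹) p.1 < (τ * σ⁻¹) p.2)).card =
      (Finset.univ.filter fun p : Fin n × Fin n => ¬ (σ p.1 < σ p.2 ↔ τ p.1 < τ p.2)).card := by
    refine Finset.card_bij (fun p _ => (σ⁻¹ p.1, σ⁻¹ p.2)) ?_ ?_ ?_
    · rintro ⟨a, b⟩ h
      rw [Finset.mem_filter] at h ⊢
      simpa using h
    · rintro ⟨a, b⟩ _ ⟨c, d⟩ _ h; simpa using h
    · rintro ⟨a, b⟩ h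
      refine ⟨(σ a, σ b), ?_, by simp⟩
      rw [Finset.mem_filter] at h ⊢
      simpa using h
  set S := (Finset.univ.filter fun p : Fin n × Fin n => p.1 < p.2).filter
      fun p => ¬ (σ p.1 < σ p.2 ↔ τ p.1 < τ p.2) with hS
  have h3 : (Finset.univ.filter fun p : Fin n × Fin n => ¬ (σ p.1 < σ p.2 ↔ τ p.1 < τ p.2)) =
      S ∪ S.map (Equiv.prodComm (Fin n) (Fin n)).toEmbedding := by
    ext ⟨a, b⟩
    simp only [hS, Finset.mem_filter, Finset.mem_univ, true_and, Finset.mem_union, Finset.mem_map_equiv]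
    simp
    rcases lt_trichotomy a b with h | h | h
    · grind
    · subst h; simp
    · have : σ a ≠ σ b := fun h' => h.ne' (σ.injective h')
      have : τ a ≠ τ b := fun h' => h.ne' (τ.injective h')
      grind
  have h4 : Disjoint S (S.map (Equiv.prodComm (Fin n) (Fin n)).toEmbedding) := by
    rw [Finset.disjoint_left]
    rintro ⟨a, b⟩
    simp [hS, Finset.mem_map_equiv]
    intro h _ h'; exact absurd h (not_lt_of_gt h')
  rw [h2, h3, Finset.card_union_of_disjoint h4, Finset.card_map] at h1
  omega

open scoped ComplexOrder Matrix

theorem posSemidef_rankOne {ι : Type*} [Fintype ι] (s : ι → ℂ) :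
    (Matrix.of fun i j => star (s i) * s j : Matrix ι ι ℂ).PosSemidef := by
  have := Matrix.posSemidef_vecMulVec_star_self s
  exact this

theorem posSemidef_signs {q : ℝ} (hq : q ∈ Set.Ioo (-1 : ℝ) 1) {n : ℕ} (P : Finset (Fin n × Fin n)) :
    (Matrix.of fun σ τ : Equiv.Perm (Fin n) =>
      (q : ℂ) ^ (P.filter fun p => ¬ (σ p.1 < σ p.2 ↔ τ p.1 < τ p.2)).card).PosSemidef := by
  classical
  induction P using Finset.induction_on with
  | empty => simpa using posSemidef_rankOne (fun _ : Equiv.Perm (Fin n) => (1 : ℂ))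
  | insert p P hp ih =>
    have h1 := posSemidef_rankOne (fun _ : Equiv.Perm (Fin n) => (1 : ℂ))
    have h2 := posSemidef_rankOne (fun σ : Equiv.Perm (Fin n) => if σ p.1 < σ p.2 then (1 : ℂ) else -1)
    have h3 := ((h1.smul (a := ((1 + q) / 2 : ℝ)) (by linarith [hq.1])).add
      (h2.smul (a := ((1 - q) / 2 : ℝ)) (by linarith [hq.2]))).hadamard ih
    refine Eq.subst (motive := fun M : Matrix (Equiv.Perm (Fin n)) (Equiv.Perm (Fin n)) ℂ => M.PosSemidef) ?_ h3
    refine Matrix.ext fun σ τ => ?_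
    simp only [Matrix.of_apply, Matrix.hadamard_apply, Matrix.add_apply, Matrix.smul_apply]
    rw [Finset.filter_insert]
    by_cases ha : σ p.1 < σ p.2 <;> by_cases hb : τ p.1 < τ p.2 <;>
      simp [ha, hb, Finset.card_insert_of_notMem, hp] <;> ring

theorem posSemidef_prod_gram {ι : Type*} [Fintype ι] {n : ℕ} (v : ι → Fin n → E) (P : Finset (Fin n)) :
    (Matrix.of fun a b => ∏ i ∈ P, ⟪v a i, v b i⟫ : Matrix ι ι ℂ).PosSemidef := by
  classical
  induction P using Finset.induction_on with
  | empty => simpa using posSemidef_rankOne (fun _ : ι => (1 : ℂ))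
  | insert p P hp ih =>
    have h3 := (Matrix.posSemidef_gram ℂ fun a => v a p).hadamard ih
    refine Eq.subst (motive := fun M : Matrix ι ι ℂ => M.PosSemidef) ?_ h3
    refine Matrix.ext fun a b => ?_
    simp [Finset.prod_insert hp, Matrix.gram]

theorem levelKernel_symmetrize (q : ℝ) {n : ℕ} (e f : Fin n → E) :
    ∑ σ : Equiv.Perm (Fin n), ∑ τ : Equiv.Perm (Fin n),
      (q : ℂ) ^ inversions (τ * σ⁻¹) * ∏ i, ⟪e (σ i), f (τ i)⟫ =
    (n.factorial : ℂ) * levelKernel q e f := by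
  have : ∀ σ : Equiv.Perm (Fin n), ∑ τ : Equiv.Perm (Fin n),
      (q : ℂ) ^ inversions (τ * σ⁻¹) * ∏ i, ⟪e (σ i), f (τ i)⟫ = levelKernel q e f := by
    intro σ
    rw [levelKernel, ← Equiv.sum_comp (Equiv.mulRight σ)]
    refine Finset.sum_congr rfl fun ρ _ => ?_
    simp only [Equiv.coe_mulRight, mul_inv_cancel_right, Equiv.Perm.mul_apply]
    rw [Equiv.prod_comp σ (fun j => ⟪e j, f (ρ j)⟫)]
  simp [this, Fintype.card_perm]

theorem levelKernel_sum_nonneg {q : ℝ} (hq : q ∈ Set.Ioo (-1 : ℝ) 1) {n : ℕ}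
    (s : Finset (Fin n → E)) (x : (Fin n → E) → ℂ) :
    0 ≤ ∑ e ∈ s, ∑ f ∈ s, star (x e) * x f * levelKernel q e f := by
  have h1 := (posSemidef_signs hq (Finset.univ.filter fun p : Fin n × Fin n => p.1 < p.2)).submatrix
    (fun a : Equiv.Perm (Fin n) × s => a.1)
  have h2 := posSemidef_prod_gram (fun (a : Equiv.Perm (Fin n) × s) i => a.2.1 (a.1 i)) Finset.univ
  have h3 := (h1.hadamard h2).dotProduct_mulVec_nonneg (fun a => x a.2.1)
  have h4 : 0 ≤ (n.factorial : ℂ) * ∑ e ∈ s, ∑ f ∈ s, star (x e) * x f * levelKernel q e f := by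
    refine h3.trans_eq ?_
    simp only [dotProduct, Matrix.mulVec, Fintype.sum_prod_type, Matrix.hadamard_apply,
      Matrix.submatrix_apply, Matrix.of_apply, Pi.star_apply, ← inversions_mul_inv, Finset.mul_sum]
    rw [Finset.sum_comm, ← Finset.sum_coe_sort s]
    refine Finset.sum_congr rfl fun e _ => ?_
    rw [← Finset.sum_coe_sort s]
    simp_rw [Finset.sum_comm (s := (Finset.univ : Finset (Equiv.Perm (Fin n)))) (t := (Finset.univ : Finset s))]
    refine Finset.sum_congr rfl fun f _ => ?_
    rw [mul_left_comm, ← levelKernel_symmetrize, Finset.mul_sum]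
    refine Finset.sum_congr rfl fun σ _ => ?_
    rw [Finset.mul_sum]
    refine Finset.sum_congr rfl fun τ _ => ?_
    ring
  have h5 : (0 : ℂ) ≤ ((n.factorial : ℝ)⁻¹ : ℝ) := Complex.zero_le_real.2 (by positivity)
  have h6 := mul_nonneg h5 h4
  rwa [Complex.ofReal_inv, Complex.ofReal_natCast, inv_mul_cancel_left₀
    (Nat.cast_ne_zero.2 n.factorial_ne_zero)] at h6

theorem inversions_inv {n : ℕ} (σ : Equiv.Perm (Fin n)) : inversions σ⁻¹ = inversions σ := by
  have h1 := inversions_mul_inv σ 1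
  have h2 := inversions_mul_inv 1 σ
  rw [one_mul] at h1
  rw [inv_one, mul_one] at h2
  rw [h1, h2]
  simp only [Equiv.Perm.coe_one, id]
  congr 1
  exact Finset.filter_congr fun p _ => not_congr iff_comm

theorem star_levelKernel (q : ℝ) {n : ℕ} (e f : Fin n → E) :
    star (levelKernel q e f) = levelKernel q f e := by
  rw [levelKernel, levelKernel, star_sum, ← Equiv.sum_comp (Equiv.inv _)]
  refine Finset.sum_congr rfl fun σ _ => ?_
  simp only [Equiv.inv_apply, inversions_inv, star_mul', star_pow, Complex.star_def,
    Complex.conj_ofReal, map_prod, inner_conj_symm]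
  rw [← Equiv.prod_comp σ]
  simp

theorem star_kernel (q : ℝ) (e f : Σ n, Fin n → E) : star (kernel q e f) = kernel q f e := by
  obtain ⟨n, e⟩ := e
  obtain ⟨m, f⟩ := f
  by_cases h : n = m
  · subst h; rw [kernel_same, kernel_same, star_levelKernel]
  · rw [kernel_ne q h, kernel_ne q (Ne.symm h), star_zero]

theorem kernel_sum_nonneg {q : ℝ} (hq : q ∈ Set.Ioo (-1 : ℝ) 1) (x : (Σ n, Fin n → E) →₀ ℂ) :
    0 ≤ x.sum fun e c => x.sum fun f d => star c * d * kernel q e f := by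
  classical
  rw [Finsupp.sigma_sum]
  refine Finset.sum_nonneg fun n _ => ?_
  have : ∀ (e : Fin n → E) (c : ℂ), (x.sum fun f d => star c * d * kernel q ⟨n, e⟩ f) =
      (x.split n).sum fun f d => star c * d * levelKernel q e f := by
    intro e c
    rw [Finsupp.sigma_sum, Finset.sum_eq_single n]
    · simp [kernel_same]
    · intro m _ hm
      refine Finset.sum_eq_zero fun f _ => ?_
      dsimp only
      rw [kernel_ne q (Ne.symm hm), mul_zero]
    · intro hn
      have : x.split n = 0 := by
        by_contra h
        exact hn ((Finsupp.mem_splitSupport_iff_nonzero _ _).2 h)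
      rw [this, Finsupp.sum_zero_index]
  simp_rw [this]
  exact levelKernel_sum_nonneg hq _ _

/-- The permutation of `{0, …, n}` with `0 ↦ p` that is given by `τ` in the other places. -/
def consPerm {n : ℕ} (p : Fin (n + 1)) (τ : Equiv.Perm (Fin n)) : Equiv.Perm (Fin (n + 1)) :=
  (finSuccEquiv n).trans (τ.optionCongr.trans (finSuccEquiv' p).symm)

theorem consPerm_zero {n : ℕ} (p : Fin (n + 1)) (τ : Equiv.Perm (Fin n)) : consPerm p τ 0 = p := by
  simp [consPerm]

theorem consPerm_succ {n : ℕ} (p : Fin (n + 1)) (τ : Equiv.Perm (Fin n)) (i : Fin n) :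
    consPerm p τ i.succ = p.succAbove (τ i) := by
  simp [consPerm]

theorem consPerm_bijective (n : ℕ) :
    Function.Bijective fun a : Fin (n + 1) × Equiv.Perm (Fin n) => consPerm a.1 a.2 := by
  rw [Fintype.bijective_iff_injective_and_card]
  constructor
  · rintro ⟨p, τ⟩ ⟨p', τ'⟩ h
    dsimp only at h
    have h0 : p = p' := by
      have := congrArg (fun σ : Equiv.Perm (Fin (n + 1)) => σ 0) h
      simpa only [consPerm_zero] using this
    subst h0
    refine Prod.ext rfl (Equiv.ext fun i => ?_)
    have := congrArg (fun σ : Equiv.Perm (Fin (n + 1)) => σ i.succ) h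
    simpa only [consPerm_succ, Fin.succAbove_right_inj] using this
  · simp [Fintype.card_perm, Nat.factorial_succ]

theorem inversions_consPerm {n : ℕ} (p : Fin (n + 1)) (τ : Equiv.Perm (Fin n)) :
    inversions (consPerm p τ) = p + inversions τ := by
  have h : ∀ m (σ : Equiv.Perm (Fin m)),
      inversions σ = ∑ i, ∑ j, if i < j ∧ σ j < σ i then 1 else 0 := by
    intro m σ
    rw [inversions, Finset.card_filter, Fintype.sum_prod_type]
  rw [h, h, Fin.sum_univ_succ]
  congr 1
  · rw [Fin.sum_univ_succ]
    simp only [consPerm_zero, consPerm_succ, lt_irrefl, false_and, if_false, zero_add,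
      Fin.succ_pos, true_and, Fin.succAbove_lt_iff_castSucc_lt]
    rw [Equiv.sum_comp τ (fun k : Fin n => if k.castSucc < p then 1 else 0), ← Finset.card_filter]
    have : (Finset.univ.filter fun k : Fin n => k.castSucc < p).map Fin.castSuccEmb = Finset.Iio p := by
      ext k
      simp only [Finset.mem_map, Finset.mem_filter, Finset.mem_univ, true_and, Finset.mem_Iio]
      constructor
      · rintro ⟨a, ha, rfl⟩; exact ha
      · intro hk
        have hl : k ≠ Fin.last n := fun h' => by
          rw [h'] at hk; exact absurd (Fin.le_last p) (not_le_of_gt hk)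
        exact ⟨k.castPred hl, by simpa using hk, by simp⟩
    rw [← Finset.card_map, this, Fin.card_Iio]
  · refine Finset.sum_congr rfl fun i _ => ?_
    rw [Fin.sum_univ_succ]
    simp [consPerm_succ, consPerm_zero]

/-- Expansion of the `q`-inner product along the first tensor factor. -/
theorem levelKernel_cons (q : ℝ) {n : ℕ} (h : E) (e : Fin n → E) (f : Fin (n + 1) → E) :
    levelKernel q (Fin.cons h e : Fin (n + 1) → E) f =
      ∑ p : Fin (n + 1), (q : ℂ) ^ (p : ℕ) * ⟪h, f p⟫ * levelKernel q e (p.removeNth f) := by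
  rw [levelKernel, ← (Equiv.ofBijective _ (consPerm_bijective n)).sum_comp, Fintype.sum_prod_type]
  refine Finset.sum_congr rfl fun p _ => ?_
  rw [levelKernel, Finset.mul_sum]
  refine Finset.sum_congr rfl fun τ _ => ?_
  simp only [Equiv.ofBijective_apply]
  rw [inversions_consPerm, Fin.prod_univ_succ, consPerm_zero, pow_add]
  simp only [Fin.cons_zero, Fin.cons_succ, consPerm_succ, Fin.removeNth]
  ring
end

section
variable (q : Set.Ioo (-1 : ℝ) 1) (E : Type*) [NormedAddCommGroup E] [InnerProductSpace ℂ E]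

/-- The sesquilinear extension of the kernel to formal linear combinations. -/
def sesq (q : ℝ) {E : Type*} [NormedAddCommGroup E] [InnerProductSpace ℂ E]
    (ξ η : (Σ n : ℕ, Fin n → E) →₀ ℂ) : ℂ :=
  ξ.sum fun e c => η.sum fun f d => star c * d * kernel q e f

/-- The finite formal linear combinations of simple tensors (of all lengths), to be equipped with
the `q`-inner product. The relations of multilinearity hold between them up to null vectors, so
that the separated completion is that of the algebraic direct sum of the tensor powers of `E`. -/
def PreFock (_q : Set.Ioo (-1 : ℝ) 1) (E : Type*) : Type _ := (Σ n : ℕ, Fin n → E) →₀ ℂ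

instance : AddCommGroup (PreFock q E) := inferInstanceAs (AddCommGroup ((Σ n : ℕ, Fin n → E) →₀ ℂ))
instance : Module ℂ (PreFock q E) := inferInstanceAs (Module ℂ ((Σ n : ℕ, Fin n → E) →₀ ℂ))

variable {q E}

theorem star_sesq (q : ℝ) (ξ η : (Σ n : ℕ, Fin n → E) →₀ ℂ) : star (sesq q η ξ) = sesq q ξ η := by
  rw [sesq, sesq, Finsupp.sum_comm, Complex.star_def, map_finsuppSum]
  refine Finsupp.sum_congr fun e _ => ?_
  rw [map_finsuppSum]
  refine Finsupp.sum_congr fun f _ => ?_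
  rw [← Complex.star_def, star_mul', star_mul', star_star, star_kernel, mul_comm (star _)]

theorem sesq_add_left (q : ℝ) (ξ η ζ : (Σ n : ℕ, Fin n → E) →₀ ℂ) :
    sesq q (ξ + η) ζ = sesq q ξ ζ + sesq q η ζ := by
  rw [sesq, Finsupp.sum_add_index'] <;> simp [sesq, ← Finsupp.sum_add, add_mul]

theorem sesq_smul_left (q : ℝ) (c : ℂ) (ξ η : (Σ n : ℕ, Fin n → E) →₀ ℂ) :
    sesq q (c • ξ) η = star c * sesq q ξ η := by
  rw [sesq, Finsupp.sum_smul_index] <;> simp [sesq, Finsupp.mul_sum, ← mul_assoc]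

theorem sesq_single (q : ℝ) (e f : Σ n : ℕ, Fin n → E) :
    sesq q (Finsupp.single e 1) (Finsupp.single f 1) = kernel q e f := by
  simp [sesq]

instance preFockCore : PreInnerProductSpace.Core ℂ (PreFock q E) where
  inner ξ η := sesq (q : ℝ) ξ η
  conj_inner_symm ξ η := star_sesq q ξ η
  re_inner_nonneg ξ := (Complex.le_def.1 (kernel_sum_nonneg q.2 ξ)).1
  add_left ξ η ζ := sesq_add_left q ξ η ζ
  smul_left ξ η c := sesq_smul_left q c ξ η

instance : SeminormedAddCommGroup (PreFock q E) :=
  InnerProductSpace.Core.toSeminormedAddCommGroup (𝕜 := ℂ)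

instance : InnerProductSpace ℂ (PreFock q E) := .ofCore _

/-- The formal simple tensor `e 0 ⊗ ⋯ ⊗ e (n - 1)`. -/
def preTensor {n : ℕ} (e : Fin n → E) : PreFock q E :=
  (Finsupp.single ⟨n, e⟩ 1 : (Σ n : ℕ, Fin n → E) →₀ ℂ)

theorem inner_preTensor {n m : ℕ} (e : Fin n → E) (f : Fin m → E) :
    ⟪(preTensor e : PreFock q E), preTensor f⟫ = kernel q ⟨n, e⟩ ⟨m, f⟩ := by
  exact sesq_single (q : ℝ) _ _

@[elab_as_elim]
theorem PreFock.induction {p : PreFock q E → Prop} (ξ : PreFock q E) (zero : p 0)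
    (add : ∀ ξ η, p ξ → p η → p (ξ + η)) (smul : ∀ (c : ℂ) (n : ℕ) (e : Fin n → E), p (c • preTensor e)) : p ξ := by
  refine Finsupp.induction_linear ξ zero add ?_
  rintro ⟨n, e⟩ c
  have h : (Finsupp.single ⟨n, e⟩ c : (Σ n : ℕ, Fin n → E) →₀ ℂ) =
      c • Finsupp.single ⟨n, e⟩ 1 := by simp
  rw [h]
  exact smul c n e

/-- The linear map with prescribed values on the simple tensors. -/
def PreFock.lift {F : Type*} [AddCommGroup F] [Module ℂ F] (φ : (n : ℕ) → (Fin n → E) → F) : PreFock q E →ₗ[ℂ] F :=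
  Finsupp.linearCombination ℂ (fun e : Σ n : ℕ, Fin n → E => φ e.1 e.2)

theorem PreFock.lift_preTensor {F : Type*} [AddCommGroup F] [Module ℂ F] (φ : (n : ℕ) → (Fin n → E) → F)
    {n : ℕ} (e : Fin n → E) : PreFock.lift (q := q) φ (preTensor e) = φ n e := by
  exact (Finsupp.linearCombination_single ℂ _ _).trans (one_smul _ _)

/-- Left creation on formal tensors. -/
def preCreation (h : E) : PreFock q E →ₗ[ℂ] PreFock q E :=
  PreFock.lift fun _ e => preTensor (Fin.cons h e)

/-- `e 0 ⊗ ⋯ ⊗ e n ↦ ∑ p, q ^ p ⟪h, e p⟫ e 0 ⊗ ⋯ ⊗ e n` (without the factor `e p`). -/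
def preAnnihilationAux (q : Set.Ioo (-1 : ℝ) 1) (h : E) : (n : ℕ) → (Fin n → E) → PreFock q E
  | 0, _ => 0
  | n + 1, f => ∑ p : Fin (n + 1), ((q : ℂ) ^ (p : ℕ) * ⟪h, f p⟫) • preTensor (p.removeNth f)

/-- Annihilation on formal tensors. -/
def preAnnihilation (h : E) : PreFock q E →ₗ[ℂ] PreFock q E := PreFock.lift (preAnnihilationAux q h)

theorem inner_preCreation (h : E) (ξ η : PreFock q E) :
    ⟪preCreation h ξ, η⟫ = ⟪ξ, preAnnihilation h η⟫ := by
  induction ξ using PreFock.induction with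
  | zero => simp
  | add ξ ξ' h1 h2 => simp [inner_add_left, h1, h2]
  | smul c n e =>
  induction η using PreFock.induction with
  | zero => simp
  | add ξ ξ' h1 h2 => rw [inner_add_right, h1, h2, map_add, inner_add_right]
  | smul d m f =>
  simp only [map_smul, inner_smul_left, inner_smul_right]
  congr 2
  rw [preCreation, preAnnihilation, PreFock.lift_preTensor, PreFock.lift_preTensor, inner_preTensor]
  cases m with
  | zero => rw [kernel_ne _ (by simp), preAnnihilationAux, inner_zero_right]
  | succ m =>
    rw [preAnnihilationAux, inner_sum]
    simp only [inner_smul_right, inner_preTensor]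
    by_cases hnm : n = m
    · subst hnm
      simp only [kernel_same]
      rw [levelKernel_cons]
    · simp only [kernel_ne (q : ℝ) (e := ⟨n, e⟩) (f := ⟨m, _⟩) hnm]
      rw [kernel_ne]
      · simp
      · simpa using hnm

theorem preAnnihilation_preCreation (h h' : E) (ξ : PreFock q E) :
    preAnnihilation h (preCreation h' ξ) = ⟪h, h'⟫ • ξ + (q : ℂ) • preCreation h' (preAnnihilation h ξ) := by
  induction ξ using PreFock.induction with
  | zero => simp
  | add ξ ξ' h1 h2 => simp only [map_add, h1, h2, smul_add]; abel
  | smul c n e =>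
  simp only [map_smul]
  rw [smul_comm _ c, smul_comm _ c, ← smul_add]
  congr 1
  rw [preCreation, preAnnihilation, PreFock.lift_preTensor, PreFock.lift_preTensor, PreFock.lift_preTensor]
  cases n with
  | zero =>
    simp [preAnnihilationAux]
  | succ n =>
    rw [preAnnihilationAux, preAnnihilationAux, Fin.sum_univ_succ, map_sum, Finset.smul_sum]
    congr 1
    · simp
    · refine Finset.sum_congr rfl fun p _ => ?_
      rw [map_smul, PreFock.lift_preTensor, smul_smul]
      congr 1
      · simp; ring
      · congr 1
        exact Fin.cons_comp_succ_succAbove _ _ _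

theorem norm_preCreation_sq (h : E) (ξ : PreFock q E) :
    ‖preCreation h ξ‖ ^ 2 = ‖h‖ ^ 2 * ‖ξ‖ ^ 2 + (q : ℝ) * ‖preAnnihilation h ξ‖ ^ 2 := by
  have h1 := inner_preCreation h ξ (preCreation h ξ)
  have h2 : ⟪ξ, preCreation h (preAnnihilation h ξ)⟫ = (‖preAnnihilation h ξ‖ : ℂ) ^ 2 := by
    rw [← inner_conj_symm, inner_preCreation, inner_conj_symm, inner_self_eq_norm_sq_to_K]
    rfl
  rw [preAnnihilation_preCreation, inner_add_right, inner_smul_right, inner_smul_right, h2,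
    inner_self_eq_norm_sq_to_K, inner_self_eq_norm_sq_to_K, inner_self_eq_norm_sq_to_K] at h1
  have h3 := congrArg Complex.re h1
  norm_cast at h3

theorem preCreation_preTensor (h : E) {n : ℕ} (e : Fin n → E) :
    preCreation h (preTensor e : PreFock q E) = preTensor (Fin.cons h e : Fin (n + 1) → E) :=
  PreFock.lift_preTensor _ _

/-- Combinations of tensors of length less than `N`. -/
def levelLT (q : Set.Ioo (-1 : ℝ) 1) (E : Type*) [NormedAddCommGroup E] [InnerProductSpace ℂ E]
    (N : ℕ) : Submodule ℂ (PreFock q E) :=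
  Submodule.span ℂ {ξ | ∃ n < N, ∃ e : Fin n → E, ξ = preTensor e}

theorem preAnnihilation_mem_levelLT (h : E) {N : ℕ} {ξ : PreFock q E} (hξ : ξ ∈ levelLT q E (N + 1)) :
    preAnnihilation h ξ ∈ levelLT q E N := by
  have : levelLT q E (N + 1) ≤ (levelLT q E N).comap (preAnnihilation h) := by
    rw [levelLT, Submodule.span_le]
    rintro _ ⟨n, hn, e, rfl⟩
    rw [SetLike.mem_coe, Submodule.mem_comap, preAnnihilation, PreFock.lift_preTensor]
    cases n with
    | zero => exact Submodule.zero_mem _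
    | succ n =>
      exact Submodule.sum_mem _ fun p _ => Submodule.smul_mem _ _
        (Submodule.subset_span ⟨n, by omega, _, rfl⟩)
  exact this hξ

theorem exists_mem_levelLT (ξ : PreFock q E) : ∃ N, ξ ∈ levelLT q E N := by
  have mono : ∀ {N M : ℕ}, N ≤ M → levelLT q E N ≤ levelLT q E M := fun h =>
    Submodule.span_mono fun ξ ⟨n, hn, e, he⟩ => ⟨n, hn.trans_le h, e, he⟩
  induction ξ using PreFock.induction with
  | zero => exact ⟨0, Submodule.zero_mem _⟩
  | add ξ η h1 h2 =>
    obtain ⟨N, hN⟩ := h1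
    obtain ⟨M, hM⟩ := h2
    exact ⟨max N M, Submodule.add_mem _ (mono (le_max_left _ _) hN) (mono (le_max_right _ _) hM)⟩
  | smul c n e =>
    exact ⟨n + 1, Submodule.smul_mem _ _ (Submodule.subset_span ⟨n, by omega, e, rfl⟩)⟩

theorem norm_preCreation_sq_le (h : E) (ξ : PreFock q E) :
    ‖preCreation h ξ‖ ^ 2 ≤ ‖h‖ ^ 2 / (1 - |(q : ℝ)|) * ‖ξ‖ ^ 2 := by
  have hq : |(q : ℝ)| < 1 := abs_lt.2 q.2
  have hq' : 0 < 1 - |(q : ℝ)| := by linarith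
  set C : ℝ := ‖h‖ ^ 2 / (1 - |(q : ℝ)|) with hC
  have hC0 : 0 ≤ C := by positivity
  have hC1 : ‖h‖ ^ 2 + |(q : ℝ)| * C = C := by rw [hC]; field_simp; ring
  have key : ∀ N, ∀ ξ ∈ levelLT q E N, ‖preCreation h ξ‖ ^ 2 ≤ C * ‖ξ‖ ^ 2 := by
    intro N
    induction N with
    | zero =>
      intro ξ hξ
      have : ξ = 0 := by simpa [levelLT] using hξ
      subst this
      simp
    | succ N ih =>
      intro ξ hξ
      have h1 := ih _ (preAnnihilation_mem_levelLT h hξ)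
      have h2 : ‖preAnnihilation h ξ‖ ^ 2 ≤ ‖preCreation h (preAnnihilation h ξ)‖ * ‖ξ‖ := by
        have h3 := inner_preCreation h (preAnnihilation h ξ) ξ
        have h4 := norm_inner_le_norm (𝕜 := ℂ) (preCreation h (preAnnihilation h ξ)) ξ
        rw [h3, inner_self_eq_norm_sq_to_K, norm_pow] at h4
        simpa using h4
      have h5 : ‖preAnnihilation h ξ‖ ^ 2 ≤ C * ‖ξ‖ ^ 2 := by
        set a := ‖preAnnihilation h ξ‖
        set b := ‖preCreation h (preAnnihilation h ξ)‖
        by_cases ha : a = 0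
        · rw [ha, zero_pow two_ne_zero]; positivity
        · have ha' : 0 < a ^ 2 := by positivity
          have h6 : a ^ 2 * a ^ 2 ≤ a ^ 2 * (C * ‖ξ‖ ^ 2) := by
            calc a ^ 2 * a ^ 2 ≤ (b * ‖ξ‖) * (b * ‖ξ‖) := mul_self_le_mul_self (by positivity) h2
              _ = b ^ 2 * ‖ξ‖ ^ 2 := by ring
              _ ≤ (C * a ^ 2) * ‖ξ‖ ^ 2 := mul_le_mul_of_nonneg_right h1 (by positivity)
              _ = _ := by ring
          exact le_of_mul_le_mul_left h6 ha'
      rw [norm_preCreation_sq]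
      calc ‖h‖ ^ 2 * ‖ξ‖ ^ 2 + (q : ℝ) * ‖preAnnihilation h ξ‖ ^ 2
          ≤ ‖h‖ ^ 2 * ‖ξ‖ ^ 2 + |(q : ℝ)| * (C * ‖ξ‖ ^ 2) := by
            gcongr
            exact le_abs_self _
        _ = (‖h‖ ^ 2 + |(q : ℝ)| * C) * ‖ξ‖ ^ 2 := by ring
        _ = C * ‖ξ‖ ^ 2 := by rw [hC1]
  obtain ⟨N, hN⟩ := exists_mem_levelLT ξ
  exact key N ξ hN

theorem norm_preCreation_le (h : E) (ξ : PreFock q E) :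
    ‖preCreation h ξ‖ ≤ √(‖h‖ ^ 2 / (1 - |(q : ℝ)|)) * ‖ξ‖ := by
  have hq : |(q : ℝ)| < 1 := abs_lt.2 q.2
  have hq' : 0 < 1 - |(q : ℝ)| := by linarith
  rw [← sq_le_sq₀ (norm_nonneg _) (by positivity), mul_pow, Real.sq_sqrt (by positivity)]
  exact norm_preCreation_sq_le h ξ

variable (q E) in
/-- The `q`-Fock space over `E`. -/
abbrev Fock : Type _ := UniformSpace.Completion (PreFock q E)

/-- The simple tensor `e 0 ⊗ ⋯ ⊗ e (n - 1)` in the `q`-Fock space. -/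
def tensor (q : Set.Ioo (-1 : ℝ) 1) {n : ℕ} (e : Fin n → E) : Fock q E := ((preTensor e : PreFock q E) : Fock q E)

variable (q E) in
/-- The vacuum vector `Ω`, the tensor of length `0`. -/
def vacuum : Fock q E := tensor q (Fin.elim0 : Fin 0 → E)

/-- The creation operator `a_q^*(h)`, the bounded operator `e ↦ h ⊗ e`. -/
def creation (q : Set.Ioo (-1 : ℝ) 1) (h : E) : Fock q E →L[ℂ] Fock q E :=
  ((preCreation h).mkContinuous _ (norm_preCreation_le h)).completion

theorem creation_tensor (h : E) {n : ℕ} (e : Fin n → E) :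
    creation q h (tensor q e) = tensor q (Fin.cons h e : Fin (n + 1) → E) := by
  rw [creation, tensor, ContinuousLinearMap.completion_apply_coe, tensor]
  congr 1
  exact preCreation_preTensor h e

/-- The annihilation operator `a_q(h)`, the adjoint of `a_q^*(h)`. -/
def annihilation (q : Set.Ioo (-1 : ℝ) 1) (h : E) : Fock q E →L[ℂ] Fock q E :=
  ContinuousLinearMap.adjoint (creation q h)

theorem levelKernel_update (q : ℝ) {n : ℕ} (e f : Fin n → E) (i : Fin n) (x : E) :
    levelKernel q (Function.update e i x) f = ∑ σ : Equiv.Perm (Fin n),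
      (q : ℂ) ^ inversions σ * (⟪x, f (σ i)⟫ * ∏ j ∈ Finset.univ.erase i, ⟪e j, f (σ j)⟫) := by
  rw [levelKernel]
  refine Finset.sum_congr rfl fun σ _ => ?_
  rw [← Finset.mul_prod_erase _ _ (Finset.mem_univ i), Function.update_self]
  congr 2
  refine Finset.prod_congr rfl fun j hj => ?_
  rw [Function.update_of_ne (Finset.ne_of_mem_erase hj)]

theorem fock_ext {ξ η : Fock q E} (h : ∀ (n : ℕ) (f : Fin n → E), ⟪ξ, tensor q f⟫ = ⟪η, tensor q f⟫) :
    ξ = η := by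
  refine (UniformSpace.Completion.denseRange_coe (α := PreFock q E)).eq_of_inner_left ℂ fun ζ => ?_
  induction ζ using PreFock.induction with
  | zero => rw [UniformSpace.Completion.coe_zero, inner_zero_right, inner_zero_right]
  | add ζ ζ' h1 h2 => rw [UniformSpace.Completion.coe_add, inner_add_right, inner_add_right, h1, h2]
  | smul c n e =>
    rw [UniformSpace.Completion.coe_smul, inner_smul_right, inner_smul_right]
    exact congrArg (c * ·) (h n e)

theorem inner_tensor (e f : Σ n, Fin n → E) : ⟪tensor q e.2, tensor q f.2⟫ = kernel (q : ℝ) e f := by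
  rw [tensor, tensor, UniformSpace.Completion.inner_coe, inner_preTensor]

theorem tensor_update_add {n : ℕ} (e : Fin n → E) (i : Fin n) (x y : E) :
    tensor q (Function.update e i (x + y)) =
      tensor q (Function.update e i x) + tensor q (Function.update e i y) := by
  refine fock_ext fun m f => ?_
  rw [inner_add_left, inner_tensor ⟨n, _⟩ ⟨m, f⟩, inner_tensor ⟨n, _⟩ ⟨m, f⟩,
    inner_tensor ⟨n, _⟩ ⟨m, f⟩]
  by_cases h : n = m
  · subst h
    simp only [kernel_same, levelKernel_update, inner_add_left, add_mul, mul_add,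
      Finset.sum_add_distrib]
  · simp only [kernel_ne (q : ℝ) (e := ⟨n, _⟩) (f := ⟨m, f⟩) h, add_zero]

theorem tensor_update_smul {n : ℕ} (e : Fin n → E) (i : Fin n) (c : ℂ) (x : E) :
    tensor q (Function.update e i (c • x)) = c • tensor q (Function.update e i x) := by
  refine fock_ext fun m f => ?_
  rw [inner_smul_left, inner_tensor ⟨n, _⟩ ⟨m, f⟩, inner_tensor ⟨n, _⟩ ⟨m, f⟩]
  by_cases h : n = m
  · subst h
    simp only [kernel_same, levelKernel_update, inner_smul_left, Finset.mul_sum]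
    refine Finset.sum_congr rfl fun σ _ => ?_
    ring
  · simp only [kernel_ne (q : ℝ) (e := ⟨n, _⟩) (f := ⟨m, f⟩) h, mul_zero]

end

/-! ### The deformed Hilbert space -/
section
variable {V : Type*} [NormedAddCommGroup V] [InnerProductSpace ℝ V]

/-- The unitary group on the complexification that extends a group of orthogonal
transformations. -/
def OneParamGroup.complexify (U : OneParamGroup ℝ V) : OneParamGroup ℂ (Cplx V) where
  toFun t := Cplx.map (U.toFun t)
  map_zero _ := Cplx.ext (U.map_zero _) (U.map_zero _)
  map_add _ _ _ := Cplx.ext (U.map_add _ _ _) (U.map_add _ _ _)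
  continuous_apply z := (WithLp.prod_continuous_toLp 2 V V).comp
    ((U.continuous_apply z.re).prodMk (U.continuous_apply z.im))

variable [CompleteSpace V]

variable (U : OneParamGroup ℝ V)

/-- The deformed inner product `⟪(2 A / (1 + A)) x, y⟫` on the complexification, where `A` is
the positive injective operator with `U t = A ^ (i t)`. -/
def deformedInner (x y : Cplx V) : ℂ := inner ℂ (U.complexify.twoADivOneAddA x) y

theorem star_deformedInner (x y : Cplx V) :
    star (deformedInner U y x) = deformedInner U x y := by
  rw [deformedInner, deformedInner, Complex.star_def, inner_conj_symm]
  exact (U.complexify.isPositive_twoADivOneAddA.isSymmetric x y).symm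

theorem deformedInner_self_nonneg (x : Cplx V) : 0 ≤ (deformedInner U x x).re :=
  U.complexify.isPositive_twoADivOneAddA.re_inner_nonneg_left x

theorem deformedInner_add_left (x y z : Cplx V) :
    deformedInner U (x + y) z = deformedInner U x z + deformedInner U y z := by
  simp only [deformedInner, _root_.map_add, inner_add_left]

theorem deformedInner_smul_left (c : ℂ) (x y : Cplx V) :
    deformedInner U (c • x) y = star c * deformedInner U x y := by
  simp only [deformedInner, map_smul, inner_smul_left, Complex.star_def]

/-- The complexification, to be equipped with the deformed inner product. -/
def PreDeformed (_U : OneParamGroup ℝ V) : Type _ := Cplx V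

instance : AddCommGroup (PreDeformed U) := inferInstanceAs (AddCommGroup (Cplx V))
instance : Module ℂ (PreDeformed U) := inferInstanceAs (Module ℂ (Cplx V))

instance preDeformedCore : PreInnerProductSpace.Core ℂ (PreDeformed U) where
  inner x y := deformedInner U x y
  conj_inner_symm x y := star_deformedInner U x y
  re_inner_nonneg x := deformedInner_self_nonneg U x
  add_left x y z := deformedInner_add_left U x y z
  smul_left x y c := deformedInner_smul_left U c x y

instance : SeminormedAddCommGroup (PreDeformed U) :=
  InnerProductSpace.Core.toSeminormedAddCommGroup (𝕜 := ℂ)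

instance : InnerProductSpace ℂ (PreDeformed U) := .ofCore _

/-- The deformed complex Hilbert space of `(V, U)`: the completion of the complexification of
`V` in the deformed inner product. -/
abbrev Deformed : Type _ := UniformSpace.Completion (PreDeformed U)

/-- A vector of the complexification of `V`, as a vector of the deformed Hilbert space. -/
def incl (x : Cplx V) : Deformed U := ((show PreDeformed U from x) : Deformed U)

theorem inner_incl (x y : Cplx V) :
    inner ℂ (incl U x) (incl U y) = deformedInner U x y :=
  UniformSpace.Completion.inner_coe (E := PreDeformed U) (𝕜 := ℂ) x y

variable {U}
variable {W : Type*} [NormedAddCommGroup W] [InnerProductSpace ℝ W] [CompleteSpace W]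
  {U' : OneParamGroup ℝ W}

/-- The condition `T = J T I`, where `I` and `J` are the conjugations, whose domains are the
complexifications of the two real Hilbert spaces: for every `x` in the domain of `I`, the vector
`T I x` lies in the domain of `J`, and `J T I x = T x`. -/
def CommutesWithConj (T : Deformed U →L[ℂ] Deformed U') : Prop :=
  ∀ x : Cplx V, ∃ y : Cplx W, T (incl U x.conj) = incl U' y ∧ T (incl U x) = incl U' y.conj

end

/-! ### The `q`-Araki-Woods algebra -/
section
variable {V : Type*} [NormedAddCommGroup V] [InnerProductSpace ℝ V] [CompleteSpace V]

/-- The field operator `s_q(h) = a_q^*(h) + a_q(h)` of a vector `h` of the real Hilbert space. -/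
def fieldOp (q : Set.Ioo (-1 : ℝ) 1) (U : OneParamGroup ℝ V) (h : V) :
    Fock q (Deformed U) →L[ℂ] Fock q (Deformed U) :=
  creation q (incl U (Cplx.ofReal h)) + annihilation q (incl U (Cplx.ofReal h))

/-- The `q`-Araki-Woods algebra `Γ_q`, the von Neumann algebra generated by the operators
`s_q(h)` for `h` in the real Hilbert space. -/
def arakiWoods (q : Set.Ioo (-1 : ℝ) 1) (U : OneParamGroup ℝ V) :
    VonNeumannAlgebra (Fock q (Deformed U)) :=
  generatedBy (Set.range (fieldOp q U))

/-- The type of elements of the `q`-Araki-Woods algebra. -/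
abbrev Gam (q : Set.Ioo (-1 : ℝ) 1) (U : OneParamGroup ℝ V) : Type _ :=
  (arakiWoods q U).toStarSubalgebra

/-- The vacuum state `x ↦ ⟪Ω, x Ω⟫`. -/
def vacuumState {q : Set.Ioo (-1 : ℝ) 1} {U : OneParamGroup ℝ V} (x : Gam q U) : ℂ :=
  inner ℂ (vacuum q (Deformed U))
    ((x : Fock q (Deformed U) →L[ℂ] Fock q (Deformed U)) (vacuum q (Deformed U)))

/-- `x` is the Wick word `W(ξ)`, that is, the element of the algebra with `x Ω = ξ`. -/
def IsWick {q : Set.Ioo (-1 : ℝ) 1} {U : OneParamGroup ℝ V} (x : Gam q U)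
    (ξ : Fock q (Deformed U)) : Prop :=
  (x : Fock q (Deformed U) →L[ℂ] Fock q (Deformed U)) (vacuum q (Deformed U)) = ξ

end

end QAW
end

/-! Write $\mathcal F(\cdot)$ for the $q$-Fock space. A contraction can be written $T=v^*\iota$ with
isometries $\iota:\mathcal K\to G$ and $v:\mathcal H\to G$ into a common Hilbert space
(`exists_dilation`), and the map is $\Gamma_q(T)(x)=\mathcal F(v)^*(x\otimes 1)\mathcal F(v)$. Here
$x\otimes 1$ acts on $\mathcal F(G)$. By the relation $a(h)a^*(h')=\langle
h,h'\rangle+q\,a^*(h')a(h)$, this space is a Hilbert sum of copies of $\mathcal F(\mathcal K)$, each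
generated by the creators $a^*(\iota k)$ from a unit vector that all $a(\iota k)$ kill
(`exists_isHilbertSum_embed`). The operator $x$ acts in every copy, and $a^*(k)\otimes 1=a^*(\iota
k)$. No conjugation on $G$ is needed.

The form of the map alone makes it unital, completely positive (`nonneg_map_of_inner_eq`) and normal
(`isNormal_of_inner_eq`). It preserves the vacuum state because $\mathcal F(v)\Omega=\Omega$ is the
vacuum of one of the copies.

Wick words go to Wick words because they are normally ordered. From $v^*\iota=T$ one gets $a(\iota
k)\mathcal F(v)=\mathcal F(v)a(Tk)$ and the adjoint relation, so creators on the left and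
annihilators on the right pass through the compression, with $k$ replaced by $Tk$ (`compress_wick`).
The Wick word of $e_1\otimes\dots\otimes e_n$ is the normally ordered product of the operators
$a^*(e_i)+a(\bar e_i)$ (`wick_mem`, `wick_vacuum`), and $T=JTI$ says that $T$ maps a pair $(e,\bar
e)$ to a pair of the same kind.

The span of the Wick words contains $1$ and is stable under left multiplication by fields. A
bicommutant argument for $x\otimes 1$ and two vectors at once (`amplify_mem_closure_pair`) then
shows that the compression maps all of $\Gamma_q(\mathcal K)$ into $\Gamma_q(\mathcal H)$.

Uniqueness of Wick words is the statement that $\Omega$ is separating (`eq_zero_of_vacuum`). The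
right field of $g$ commutes with the algebra whenever $g$ has real inner products with the real
Hilbert space, and an operator that commutes with such right fields is determined by its value at
$\Omega$ if the vectors $g$ span a dense subspace. They do: $\tfrac{2}{1+A}w$ is such a vector for
every real $w$, and $\tfrac{2}{1+A}$ has dense range because the conjugation carries
$\tfrac{2A}{1+A}$ to it (`isConjugate_twoADivOneAddA`, `denseRange_twoADivOneAddA`). -/

set_option linter.unusedSectionVars false

noncomputable section
open scoped ComplexInnerProductSpace
namespace QAW

/-! ### Creation and annihilation operators, and normally ordered products -/

section FockBasics
variable {q : Set.Ioo (-1 : ℝ) 1} {E : Type*} [NormedAddCommGroup E] [InnerProductSpace ℂ E]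

/-- A closed subspace that contains all simple tensors is everything. -/
theorem closedSubmodule_eq_top_of_tensor {P : Submodule ℂ (Fock q E)} (hP : IsClosed (P : Set (Fock q E)))
    (h : ∀ (n : ℕ) (e : Fin n → E), tensor q e ∈ P) : P = ⊤ := by
  rw [eq_top_iff]
  rintro ξ -
  induction ξ using UniformSpace.Completion.induction_on with
  | hp => exact hP
  | ih ξ =>
    induction ξ using PreFock.induction with
    | zero => rw [UniformSpace.Completion.coe_zero]; exact P.zero_mem
    | add ξ η h1 h2 => rw [UniformSpace.Completion.coe_add]; exact P.add_mem h1 h2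
    | smul c n e => rw [UniformSpace.Completion.coe_smul]; exact P.smul_mem _ (h n e)

theorem clm_ext_tensor {F : Type*} [NormedAddCommGroup F] [NormedSpace ℂ F]
    {x y : Fock q E →L[ℂ] F} (h : ∀ (n : ℕ) (e : Fin n → E), x (tensor q e) = y (tensor q e)) : x = y := by
  have : LinearMap.eqLocus (x : Fock q E →ₗ[ℂ] F) (y : Fock q E →ₗ[ℂ] F) = ⊤ :=
    closedSubmodule_eq_top_of_tensor (isClosed_eq x.continuous y.continuous) h
  ext ξ
  exact (this ▸ Submodule.mem_top : ξ ∈ LinearMap.eqLocus (x : Fock q E →ₗ[ℂ] F) (y : Fock q E →ₗ[ℂ] F))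

theorem norm_creation_le (h : E) : ‖creation q h‖ ≤ √(1 - |(q : ℝ)|)⁻¹ * ‖h‖ := by
  have hq : |(q : ℝ)| < 1 := abs_lt.2 q.2
  have hq' : 0 < 1 - |(q : ℝ)| := by linarith
  refine ContinuousLinearMap.opNorm_le_bound _ (by positivity) fun ξ => ?_
  induction ξ using UniformSpace.Completion.induction_on with
  | hp => exact isClosed_le (by fun_prop) (by fun_prop)
  | ih ξ =>
    rw [creation, ContinuousLinearMap.completion_apply_coe, UniformSpace.Completion.norm_coe,
      UniformSpace.Completion.norm_coe]
    refine (norm_preCreation_le h ξ).trans (le_of_eq ?_)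
    rw [div_eq_inv_mul, Real.sqrt_mul (by positivity), Real.sqrt_sq (norm_nonneg _)]

theorem cons_eq_update {n : ℕ} (h h' : E) (e : Fin n → E) :
    (Fin.cons h e : Fin (n + 1) → E) = Function.update (Fin.cons h' e : Fin (n + 1) → E) 0 h := by
  rw [Fin.update_cons_zero]

theorem creation_add (h h' : E) : creation q (h + h') = creation q h + creation q h' := by
  refine clm_ext_tensor fun n e => ?_
  rw [add_apply, creation_tensor, creation_tensor, creation_tensor, cons_eq_update _ 0,
    tensor_update_add, ← cons_eq_update, ← cons_eq_update]

theorem creation_smul (c : ℂ) (h : E) : creation q (c • h) = c • creation q h := by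
  refine clm_ext_tensor fun n e => ?_
  rw [smul_apply, creation_tensor, creation_tensor, cons_eq_update _ 0,
    tensor_update_smul, ← cons_eq_update]

variable (q E) in
/-- The creation operators, as a bounded linear map. -/
def creationL : E →L[ℂ] (Fock q E →L[ℂ] Fock q E) :=
  LinearMap.mkContinuous ⟨⟨creation q, creation_add⟩, creation_smul⟩ _ norm_creation_le

theorem annihilation_add (h h' : E) : annihilation q (h + h') = annihilation q h + annihilation q h' := by
  simp only [annihilation, creation_add, _root_.map_add]

theorem annihilation_smul (c : ℂ) (h : E) :
    annihilation q (c • h) = star c • annihilation q h := by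
  simp only [annihilation, creation_smul, map_smulₛₗ, starRingEnd_apply]

/-- By `inner_preCreation` the explicit formula is adjoint to creation on formal tensors, and these
are dense. This makes the Hilbert space adjoint computable. -/
theorem annihilation_coe (h : E) (ξ : PreFock q E) :
    annihilation q h (ξ : Fock q E) = (preAnnihilation h ξ : PreFock q E) := by
  refine fock_ext fun n f => ?_
  rw [annihilation, ContinuousLinearMap.adjoint_inner_left, creation_tensor, tensor, tensor,
    UniformSpace.Completion.inner_coe, UniformSpace.Completion.inner_coe, ← preCreation_preTensor,
    ← inner_conj_symm, inner_preCreation, inner_conj_symm]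

theorem annihilation_vacuum (h : E) : annihilation q h (vacuum q E) = 0 := by
  rw [vacuum, tensor, annihilation_coe, preAnnihilation, PreFock.lift_preTensor,
    preAnnihilationAux, UniformSpace.Completion.coe_zero]

theorem annihilation_tensor_zero (h : E) (e : Fin 0 → E) : annihilation q h (tensor q e) = 0 := by
  rw [tensor, annihilation_coe, preAnnihilation, PreFock.lift_preTensor,
    preAnnihilationAux, UniformSpace.Completion.coe_zero]

theorem annihilation_tensor (h : E) {n : ℕ} (f : Fin (n + 1) → E) :
    annihilation q h (tensor q f) =
      ∑ p : Fin (n + 1), ((q : ℂ) ^ (p : ℕ) * ⟪h, f p⟫) • tensor q (p.removeNth f) := by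
  rw [tensor, annihilation_coe, preAnnihilation, PreFock.lift_preTensor, preAnnihilationAux]
  change UniformSpace.Completion.toComplL (𝕜 := ℂ) _ = _
  rw [map_sum]
  simp only [map_smul]
  rfl

theorem inner_creation_left (h : E) (ξ η : Fock q E) :
    ⟪creation q h ξ, η⟫ = ⟪ξ, annihilation q h η⟫ := by
  rw [annihilation, ContinuousLinearMap.adjoint_inner_right]

theorem inner_annihilation_left (h : E) (ξ η : Fock q E) :
    ⟪annihilation q h ξ, η⟫ = ⟪ξ, creation q h η⟫ := by
  rw [annihilation, ContinuousLinearMap.adjoint_inner_left]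

theorem annihilation_creation (h h' : E) (ξ : Fock q E) :
    annihilation q h (creation q h' ξ) =
      ⟪h, h'⟫ • ξ + (q : ℂ) • creation q h' (annihilation q h ξ) := by
  induction ξ using UniformSpace.Completion.induction_on with
  | hp =>
    have h1 := (annihilation q h * creation q h').continuous
    have h2 := (⟪h, h'⟫ • (1 : Fock q E →L[ℂ] Fock q E) +
      (q : ℂ) • (creation q h' * annihilation q h)).continuous
    exact isClosed_eq h1 h2
  | ih ξ =>
    have h1 : ∀ ζ : PreFock q E, creation q h' (ζ : Fock q E) = (preCreation h' ζ : PreFock q E) :=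
      fun ζ => ContinuousLinearMap.completion_apply_coe _ _
    rw [h1, annihilation_coe, annihilation_coe, h1, preAnnihilation_preCreation,
      UniformSpace.Completion.coe_add, UniformSpace.Completion.coe_smul, UniformSpace.Completion.coe_smul]

theorem norm_vacuum : ‖vacuum q E‖ = 1 := by
  have h : ⟪vacuum q E, vacuum q E⟫ = 1 := by
    rw [vacuum, inner_tensor ⟨0, _⟩ ⟨0, _⟩, kernel_same, levelKernel]
    simp [inversions]
  rw [inner_self_eq_norm_sq_to_K] at h
  have h' : ‖vacuum q E‖ ^ 2 = 1 := Complex.ofReal_injective (by push_cast; exact h)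
  exact (pow_eq_one_iff_of_nonneg (norm_nonneg _) two_ne_zero).1 h'

theorem creation_mul_annihilation_comm (h h' : E) :
    annihilation q h * creation q h' = ⟪h, h'⟫ • 1 + (q : ℂ) • (creation q h' * annihilation q h) := by
  ext ξ
  exact annihilation_creation h h' ξ

/-- The normally ordered `q`-Wick product of the fields `a_q^*((e i).1) + a_q((e i).2)`, with
`Y` between the creators and the annihilators; moving a creator past `Y` gives the factor
`q ^ m`. -/
def wick : (n : ℕ) → (Fin n → E × E) → ℕ → (Fock q E →L[ℂ] Fock q E) → (Fock q E →L[ℂ] Fock q E)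
  | 0, _, _, Y => Y
  | n + 1, e, m, Y => (q : ℂ) ^ m • (creation q (e 0).1 * wick n (Fin.tail e) m Y) +
      wick n (Fin.tail e) (m + 1) (Y * annihilation q (e 0).2)

/-- Moving $a(h)$ to the right gives a factor $q$ for every creator that it crosses. A creator at
position $p$ already carries $q^m$ and a factor $q$ for every annihilator chosen before it, so its
contraction with $h$ has the weight $q^{m+p}$, whatever was chosen at the $p$ earlier positions. If
nothing is contracted, $a(h)$ reaches $Y$ and every creator has gained one factor $q$, hence $m+1$.
-/
theorem annihilation_mul_wick (h : E) {n : ℕ} (e : Fin (n + 1) → E × E) (m : ℕ)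
    (Y : Fock q E →L[ℂ] Fock q E) :
    annihilation q h * wick (n + 1) e m Y =
      ∑ p : Fin (n + 1), ((q : ℂ) ^ (m + p) * ⟪h, (e p).1⟫) • wick n (p.removeNth e) m Y +
        wick (n + 1) e (m + 1) (annihilation q h * Y) := by
  -- The second summand in the recursion for `wick` changes both $m$ and $Y$.
  induction n generalizing m Y with
  | zero =>
    simp only [wick, mul_add, mul_smul_comm, ← mul_assoc, creation_mul_annihilation_comm]
    simp only [add_mul, smul_mul_assoc, one_mul, smul_add, smul_smul, pow_succ, mul_assoc, add_assoc]
    congr 1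
    exact (Fin.sum_univ_one (fun p : Fin 1 => ((q : ℂ) ^ (m + (p : ℕ)) * ⟪h, (e p).1⟫) • Y)).symm
  | succ n ih =>
    rw [wick, mul_add, ih, mul_smul_comm, ← mul_assoc, creation_mul_annihilation_comm, add_mul,
      smul_mul_assoc, smul_mul_assoc, one_mul, mul_assoc, ih]
    rw [Fin.sum_univ_succ (n := n + 1)]
    have h1 : ∀ p : Fin (n + 1), wick (n + 1) (p.succ.removeNth e) m Y =
        (q : ℂ) ^ m • (creation q (e 0).1 * wick n (p.removeNth (Fin.tail e)) m Y) +
          wick n (p.removeNth (Fin.tail e)) (m + 1) (Y * annihilation q (e 0).2) := by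
      intro p
      rw [wick]
      have h2 : Fin.tail (p.succ.removeNth e) = p.removeNth (Fin.tail e) := by
        ext i <;> simp [Fin.tail, Fin.removeNth]
      have h3 : p.succ.removeNth e 0 = e 0 := by simp [Fin.removeNth]
      rw [h2, h3]
    have h0 : Fin.removeNth 0 e = Fin.tail e := rfl
    have hw : wick (n + 2) e (m + 1) (annihilation q h * Y) =
        (q : ℂ) ^ (m + 1) • (creation q (e 0).1 * wick (n + 1) (Fin.tail e) (m + 1) (annihilation q h * Y)) +
          wick (n + 1) (Fin.tail e) (m + 2) (annihilation q h * Y * annihilation q (e 0).2) := rfl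
    rw [h0, hw]
    simp only [h1, smul_add, Finset.sum_add_distrib, mul_add, Finset.mul_sum, Finset.smul_sum,
      mul_smul_comm, smul_smul, Fin.val_zero, add_zero, Fin.val_succ, Fin.tail, mul_assoc]
    have h4 : ∀ p : Fin (n + 1), (q : ℂ) ^ m * ((q : ℂ) * ((q : ℂ) ^ (m + (p : ℕ)) * ⟪h, (e p.succ).1⟫)) =
        (q : ℂ) ^ (m + ((p : ℕ) + 1)) * (⟪h, (e p.succ).1⟫ * (q : ℂ) ^ m) := fun p => by ring
    have h5 : ∀ p : Fin (n + 1), m + 1 + (p : ℕ) = m + ((p : ℕ) + 1) := fun p => by ring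
    simp only [h4, h5, ← pow_succ]
    abel

/-- The recursion for `q`-Wick products. -/
theorem field_mul_wick (x : E × E) {n : ℕ} (e : Fin (n + 1) → E × E) :
    (creation q x.1 + annihilation q x.2) * wick (n + 1) e 0 1 =
      wick (n + 2) (Fin.cons x e : Fin (n + 2) → E × E) 0 1 +
        ∑ p : Fin (n + 1), ((q : ℂ) ^ (p : ℕ) * ⟪x.2, (e p).1⟫) • wick n (p.removeNth e) 0 1 := by
  rw [add_mul, annihilation_mul_wick]
  conv_rhs => rw [wick]
  simp only [Fin.tail_cons, Fin.cons_zero, pow_zero, one_smul, mul_one, one_mul, zero_add]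
  abel

theorem field_mul_wick_zero (x : E × E) (e : Fin 0 → E × E) :
    (creation q x.1 + annihilation q x.2) * (wick 0 e 0 1 : Fock q E →L[ℂ] Fock q E) =
      wick 1 (Fin.cons x e : Fin 1 → E × E) 0 1 := by
  simp [wick]

theorem wick_vacuum_eq_zero {n : ℕ} (e : Fin n → E × E) (m : ℕ) {Y : Fock q E →L[ℂ] Fock q E}
    (hY : Y (vacuum q E) = 0) : wick n e m Y (vacuum q E) = 0 := by
  induction n generalizing m Y with
  | zero => exact hY
  | succ n ih =>
    rw [wick, add_apply, smul_apply, mul_apply_eq_comp, ih _ _ hY, ih, _root_.map_zero, smul_zero, add_zero]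
    rw [mul_apply_eq_comp, annihilation_vacuum, _root_.map_zero]

/-- Every term with an annihilator kills the vacuum, so only the product of all creators survives.
This is why the operator is the Wick word of the tensor of first components. -/
theorem wick_vacuum {n : ℕ} (e : Fin n → E × E) :
    wick n e 0 1 (vacuum q E) = tensor q fun i => (e i).1 := by
  induction n with
  | zero =>
    rw [wick, vacuum]
    exact congrArg (tensor q) (Subsingleton.elim _ _)
  | succ n ih =>
    rw [wick, add_apply, smul_apply, mul_apply_eq_comp, ih, wick_vacuum_eq_zero, creation_tensor,
      pow_zero, one_smul, add_zero]
    · congr 1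
      exact Fin.cons_self_tail (fun i => (e i).1)
    · rw [one_mul, annihilation_vacuum]

end FockBasics

/-! ### Decomposition of a Fock space into copies of a smaller one -/

section VacuumLike
variable {q : Set.Ioo (-1 : ℝ) 1} {E : Type*} [NormedAddCommGroup E] [InnerProductSpace ℂ E]
  {G : Type*} [NormedAddCommGroup G] [InnerProductSpace ℂ G]

/-- The vector `a_q^*(g 0) ⋯ a_q^*(g (n - 1)) η`. -/
def creations : (n : ℕ) → (Fin n → G) → Fock q G → Fock q G
  | 0, _, η => η
  | n + 1, g, η => creation q (g 0) (creations n (Fin.tail g) η)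

/-- Only the $q$-commutation relation and $a(h)\eta=0$ enter, so the formula is the one for simple
tensors, with $\eta$ in the role of the vacuum. -/
theorem annihilation_creations {h : G} {η : Fock q G} (hη : annihilation q h η = 0) {n : ℕ}
    (g : Fin (n + 1) → G) : annihilation q h (creations (n + 1) g η) =
      ∑ p : Fin (n + 1), ((q : ℂ) ^ (p : ℕ) * ⟪h, g p⟫) • creations n (p.removeNth g) η := by
  induction n with
  | zero =>
    rw [creations, creations, annihilation_creation, hη, _root_.map_zero, smul_zero, add_zero,
      Fin.sum_univ_one]
    simp [creations]
  | succ n ih =>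
    rw [creations, annihilation_creation, ih, Fin.sum_univ_succ (n := n + 1), map_sum, Finset.smul_sum]
    congr 1
    · rw [Fin.val_zero, pow_zero, one_mul]
      rfl
    · refine Finset.sum_congr rfl fun p _ => ?_
      rw [map_smul, smul_smul, creations]
      have h2 : Fin.tail (p.succ.removeNth g) = p.removeNth (Fin.tail g) := by
        ext i; simp [Fin.tail, Fin.removeNth]
      have h3 : p.succ.removeNth g 0 = g 0 := by simp [Fin.removeNth]
      rw [h2, h3, Fin.val_succ, pow_succ, Fin.tail]
      congr 1
      ring

/-- `η` is annihilated by all `a_q(j h)`. -/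
def IsVacuumLike (j : E →ₗᵢ[ℂ] G) (η : Fock q G) : Prop := ∀ h, annihilation q (j h) η = 0

theorem isVacuumLike_vacuum (j : E →ₗᵢ[ℂ] G) : IsVacuumLike j (vacuum q G) :=
  fun _ => annihilation_vacuum _

/-- Creators are moved to the other side one at a time and contracted, which reproduces the
recursion `levelKernel_cons`; what remains is $\langle\eta,\eta'\rangle$. Taking $\eta=\eta'$ gives
isometric copies of the Fock space, and $\eta\perp\eta'$ gives orthogonal ones. -/
theorem inner_creations (j : E →ₗᵢ[ℂ] G) {η η' : Fock q G} (hη : IsVacuumLike j η)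
    (hη' : IsVacuumLike j η') {n m : ℕ} (e : Fin n → E) (f : Fin m → E) :
    ⟪creations n (j ∘ e) η, creations m (j ∘ f) η'⟫ = kernel (q : ℝ) ⟨n, e⟩ ⟨m, f⟩ * ⟪η, η'⟫ := by
  induction n generalizing m with
  | zero =>
    cases m with
    | zero => simp [creations, kernel_same, levelKernel, inversions]
    | succ m =>
      rw [kernel_ne _ (by simp), zero_mul, creations, creations, ← inner_annihilation_left]
      simp only [Function.comp_apply]
      rw [hη, inner_zero_left]
  | succ n ih =>
    have ht : Fin.tail (j ∘ e) = j ∘ Fin.tail e := rfl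
    rw [creations, inner_creation_left, ht]
    cases m with
    | zero =>
      rw [kernel_ne _ (by simp), zero_mul, creations]
      simp only [Function.comp_apply]
      rw [hη', inner_zero_right]
    | succ m =>
      simp only [Function.comp_apply]
      rw [annihilation_creations (hη' (e 0)), inner_sum]
      simp only [inner_smul_right, Function.comp_apply, LinearIsometry.inner_map_map]
      have hr : ∀ p : Fin (m + 1), p.removeNth (j ∘ f) = j ∘ p.removeNth f := fun p => rfl
      simp only [hr, ih]
      by_cases hnm : n = m
      · subst hnm
        simp only [kernel_same]
        conv_rhs => rw [← Fin.cons_self_tail e, levelKernel_cons, Finset.sum_mul]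
        refine Finset.sum_congr rfl fun p _ => ?_
        ring
      · rw [kernel_ne (q : ℝ) (e := ⟨n + 1, e⟩) (f := ⟨m + 1, f⟩) (by simpa using hnm), zero_mul]
        refine Finset.sum_eq_zero fun p _ => ?_
        rw [kernel_ne (q : ℝ) (e := ⟨n, _⟩) (f := ⟨m, _⟩) hnm, zero_mul, mul_zero]

/-- The map `e 0 ⊗ ⋯ ⊗ e (n - 1) ↦ a_q^*(j (e 0)) ⋯ a_q^*(j (e (n - 1))) η` on formal tensors. -/
def preEmbed (j : E →ₗᵢ[ℂ] G) (η : Fock q G) : PreFock q E →ₗ[ℂ] Fock q G :=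
  PreFock.lift fun n e => creations n (j ∘ e) η

theorem inner_preEmbed {j : E →ₗᵢ[ℂ] G} {η η' : Fock q G} (hη : IsVacuumLike j η)
    (hη' : IsVacuumLike j η') (ξ ξ' : PreFock q E) :
    ⟪preEmbed j η ξ, preEmbed j η' ξ'⟫ = ⟪ξ, ξ'⟫ * ⟪η, η'⟫ := by
  induction ξ using PreFock.induction with
  | zero => simp
  | add ξ ζ h1 h2 => simp only [_root_.map_add, inner_add_left, h1, h2, add_mul]
  | smul c n e =>
  induction ξ' using PreFock.induction with
  | zero => simp
  | add ξ ζ h1 h2 => simp only [_root_.map_add, inner_add_right, h1, h2, add_mul]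
  | smul d m f =>
  simp only [map_smul, inner_smul_left, inner_smul_right, preEmbed, PreFock.lift_preTensor,
    inner_creations j hη hη', inner_preTensor]
  ring

theorem norm_preEmbed {j : E →ₗᵢ[ℂ] G} {η : Fock q G} (hη : IsVacuumLike j η) (h1 : ‖η‖ = 1)
    (ξ : PreFock q E) : ‖preEmbed j η ξ‖ = ‖ξ‖ := by
  have h := inner_preEmbed hη hη ξ ξ
  rw [inner_self_eq_norm_sq_to_K, inner_self_eq_norm_sq_to_K, inner_self_eq_norm_sq_to_K, h1] at h
  rw [← sq_eq_sq₀ (norm_nonneg _) (norm_nonneg _)]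
  exact Complex.ofReal_injective (by push_cast; simpa using h)

/-- The isometric embedding `e 0 ⊗ ⋯ ⊗ e (n - 1) ↦ a_q^*(j (e 0)) ⋯ a_q^*(j (e (n - 1))) η` of
`q`-Fock spaces that is given by a unit vector `η`. -/
def embed (j : E →ₗᵢ[ℂ] G) (η : Fock q G) (hη : IsVacuumLike j η) (h1 : ‖η‖ = 1) :
    Fock q E →ₗᵢ[ℂ] Fock q G where
  toLinearMap := (((preEmbed j η).mkContinuous 1 fun ξ => by
    rw [norm_preEmbed hη h1, one_mul]).extend UniformSpace.Completion.toComplL : Fock q E →L[ℂ] Fock q G)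
  norm_map' ξ := by
    induction ξ using UniformSpace.Completion.induction_on with
    | hp => exact isClosed_eq (by fun_prop) (by fun_prop)
    | ih ξ =>
      refine (congrArg norm (ContinuousLinearMap.extend_eq _
        (UniformSpace.Completion.denseRange_coe (α := PreFock q E))
        (UniformSpace.Completion.isUniformInducing_coe _) ξ)).trans ?_
      rw [UniformSpace.Completion.norm_coe]
      exact norm_preEmbed hη h1 ξ

theorem embed_coe (j : E →ₗᵢ[ℂ] G) (η : Fock q G) (hη : IsVacuumLike j η) (h1 : ‖η‖ = 1)
    (ξ : PreFock q E) : embed j η hη h1 ξ = preEmbed j η ξ :=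
  ContinuousLinearMap.extend_eq _ (UniformSpace.Completion.denseRange_coe (α := PreFock q E))
    (UniformSpace.Completion.isUniformInducing_coe _) ξ

theorem embed_tensor (j : E →ₗᵢ[ℂ] G) (η : Fock q G) (hη : IsVacuumLike j η) (h1 : ‖η‖ = 1)
    {n : ℕ} (e : Fin n → E) : embed j η hη h1 (tensor q e) = creations n (j ∘ e) η := by
  rw [tensor, embed_coe, preEmbed, PreFock.lift_preTensor]

theorem embed_vacuum (j : E →ₗᵢ[ℂ] G) (η : Fock q G) (hη : IsVacuumLike j η) (h1 : ‖η‖ = 1) :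
    embed j η hη h1 (vacuum q E) = η :=
  embed_tensor j η hη h1 _

theorem inner_embed {j : E →ₗᵢ[ℂ] G} {η η' : Fock q G} (hη : IsVacuumLike j η)
    (hη' : IsVacuumLike j η') (h1 : ‖η‖ = 1) (h1' : ‖η'‖ = 1) (ξ ξ' : Fock q E) :
    ⟪embed j η hη h1 ξ, embed j η' hη' h1' ξ'⟫ = ⟪ξ, ξ'⟫ * ⟪η, η'⟫ := by
  induction ξ, ξ' using UniformSpace.Completion.induction_on₂ with
  | hp => exact isClosed_eq (by fun_prop) (by fun_prop)
  | ih ξ ξ' =>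
    rw [embed_coe, embed_coe, inner_preEmbed hη hη', UniformSpace.Completion.inner_coe]

theorem embed_creation (j : E →ₗᵢ[ℂ] G) (η : Fock q G) (hη : IsVacuumLike j η) (h1 : ‖η‖ = 1)
    (h : E) (ξ : Fock q E) :
    embed j η hη h1 (creation q h ξ) = creation q (j h) (embed j η hη h1 ξ) := by
  have : (embed j η hη h1).toContinuousLinearMap.comp (creation q h) =
      (creation q (j h)).comp (embed j η hη h1).toContinuousLinearMap := by
    refine clm_ext_tensor fun n e => ?_
    change embed j η hη h1 (creation q h (tensor q e)) = creation q (j h) (embed j η hη h1 (tensor q e))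
    rw [creation_tensor, embed_tensor, embed_tensor, creations]
    rfl
  exact congrArg (fun x => x ξ) this

/-- The formula for $a(g)$ sees $g$ only through its inner products with the range of $j$, so $g$
may lie outside that range and $h$ is $j^*g$. This freedom is what brings in $T=v^*\iota$ later. -/
theorem embed_annihilation (j : E →ₗᵢ[ℂ] G) (η : Fock q G) (hη : IsVacuumLike j η) (h1 : ‖η‖ = 1)
    {g : G} (hg : annihilation q g η = 0) {h : E} (hgh : ∀ e, ⟪g, j e⟫ = ⟪h, e⟫) (ξ : Fock q E) :
    embed j η hη h1 (annihilation q h ξ) = annihilation q g (embed j η hη h1 ξ) := by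
  have : (embed j η hη h1).toContinuousLinearMap.comp (annihilation q h) =
      (annihilation q g).comp (embed j η hη h1).toContinuousLinearMap := by
    refine clm_ext_tensor fun n e => ?_
    change embed j η hη h1 (annihilation q h (tensor q e)) =
      annihilation q g (embed j η hη h1 (tensor q e))
    rw [embed_tensor]
    cases n with
    | zero => rw [annihilation_tensor_zero, _root_.map_zero, creations, hg]
    | succ n =>
      rw [annihilation_tensor, annihilation_creations hg, map_sum]
      refine Finset.sum_congr rfl fun p _ => ?_
      rw [map_smul, embed_tensor, Function.comp_apply, hgh]
      rfl
  exact congrArg (fun x => x ξ) this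

theorem embed_annihilation_self (j : E →ₗᵢ[ℂ] G) (η : Fock q G) (hη : IsVacuumLike j η) (h1 : ‖η‖ = 1)
    (h : E) (ξ : Fock q E) :
    embed j η hη h1 (annihilation q h ξ) = annihilation q (j h) (embed j η hη h1 ξ) :=
  embed_annihilation j η hη h1 (hη h) (fun e => j.inner_map_map h e) ξ

variable (q) in
/-- The closed subspace of the vectors that are annihilated by all `a_q(j h)`. -/
def vacuumLike (j : E →ₗᵢ[ℂ] G) : Submodule ℂ (Fock q G) where
  carrier := {η | IsVacuumLike j η}
  zero_mem' _ := _root_.map_zero _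
  add_mem' h1 h2 h := by rw [_root_.map_add, h1, h2, add_zero]
  smul_mem' c _ h1 h := by rw [map_smul, h1, smul_zero]

theorem isClosed_vacuumLike (j : E →ₗᵢ[ℂ] G) : IsClosed (vacuumLike q j : Set (Fock q G)) := by
  have : (vacuumLike q j : Set (Fock q G)) = ⋂ h, {η | annihilation q (j h) η = 0} := by
    ext η
    simp only [Set.mem_iInter, Set.mem_ofPred_eq]
    rfl
  rw [this]
  exact isClosed_iInter fun h => isClosed_eq (by fun_prop) continuous_const

/-- A closed subspace that is invariant under the operators `a_q(j h)` and `a_q^*(j h)` and contains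
the vectors annihilated by all `a_q(j h)` is everything. -/
theorem eq_top_of_vacuumLike_le (j : E →ₗᵢ[ℂ] G) {P : Submodule ℂ (Fock q G)}
    (hP : IsClosed (P : Set (Fock q G))) (h0 : vacuumLike q j ≤ P)
    (hc : ∀ h, ∀ ξ ∈ P, creation q (j h) ξ ∈ P) (ha : ∀ h, ∀ ξ ∈ P, annihilation q (j h) ξ ∈ P) :
    P = ⊤ := by
  have : CompleteSpace P := hP.completeSpace_coe
  refine closedSubmodule_eq_top_of_tensor hP fun n => ?_
  -- $P$ is invariant under $a(jh)$ and its adjoint, hence so is $P^\perp$. The component of $\zeta$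
  -- in $P^\perp$ is therefore mapped by $a(jh)$ into $P\cap P^\perp=0$, so it is vacuum-like and
  -- lies in $P$. Since annihilation shortens tensors, induction on the length finishes the proof.
  have key : ∀ ζ : Fock q G, (∀ h, annihilation q (j h) ζ ∈ P) → ζ ∈ P := by
    intro ζ hζ
    have h2 : ζ - P.starProjection ζ ∈ vacuumLike q j := by
      intro h
      have h3 : annihilation q (j h) (ζ - P.starProjection ζ) ∈ P := by
        rw [map_sub]
        exact P.sub_mem (hζ h) (ha h _ (P.starProjection_apply_mem ζ))
      have h4 : annihilation q (j h) (ζ - P.starProjection ζ) ∈ Pᗮ := by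
        rw [Submodule.mem_orthogonal']
        intro u hu
        rw [inner_annihilation_left]
        exact Submodule.inner_left_of_mem_orthogonal (hc h u hu) (P.sub_starProjection_mem_orthogonal ζ)
      exact (Submodule.mem_bot ℂ).1 (P.inf_orthogonal_eq_bot ▸ Submodule.mem_inf.2 ⟨h3, h4⟩)
    have h5 := P.add_mem (h0 h2) (P.starProjection_apply_mem ζ)
    rwa [sub_add_cancel] at h5
  induction n with
  | zero =>
    intro e
    exact key _ fun h => by rw [annihilation_tensor_zero]; exact P.zero_mem
  | succ n ih =>
    intro e
    refine key _ fun h => ?_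
    rw [annihilation_tensor]
    exact P.sum_mem fun p _ => P.smul_mem _ (ih _)

/-- The `q`-Fock space over `G` is a Hilbert sum of copies of that over `E`. One of them is spanned
by the tensors of vectors of `E`. -/
theorem exists_isHilbertSum_embed (j : E →ₗᵢ[ℂ] G) :
    ∃ (I : Set (vacuumLike q j)) (η : I → Fock q G) (hη : ∀ i, IsVacuumLike j (η i)) (h1 : ∀ i, ‖η i‖ = 1),
      (∃ i, η i = vacuum q G) ∧
      IsHilbertSum ℂ (fun _ : I => Fock q E) fun i => embed j (η i) (hη i) (h1 i) := by
  have : CompleteSpace (vacuumLike q j) := (isClosed_vacuumLike j).completeSpace_coe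
  set Ω : vacuumLike q j := ⟨vacuum q G, isVacuumLike_vacuum j⟩ with hΩ
  -- The orthonormal basis of the vacuum-like vectors is obtained by extending $\{\Omega\}$, so that
  -- $\Omega$ is one of its members.
  have h0 : Orthonormal ℂ ((↑) : ({Ω} : Set (vacuumLike q j)) → vacuumLike q j) := by
    constructor
    · rintro ⟨_, rfl⟩
      exact norm_vacuum (q := q) (E := G)
    · rintro ⟨_, rfl⟩ ⟨_, rfl⟩ h
      exact absurd rfl h
  obtain ⟨w, b, hw, hb⟩ := h0.exists_hilbertBasis_extension
  have hb' : Orthonormal ℂ ((↑) : w → vacuumLike q j) := hb ▸ b.orthonormal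
  have hv : ∀ i : w, IsVacuumLike j i.1.1 := fun i => i.1.2
  have hn : ∀ i : w, ‖i.1.1‖ = 1 := fun i => hb'.1 i
  refine ⟨w, fun i => i.1.1, hv, hn, ⟨⟨Ω, hw rfl⟩, rfl⟩, ?_⟩
  refine IsHilbertSum.mk ?_ ?_
  · intro i i' hi ξ ξ'
    have h2 : ⟪(i.1.1 : Fock q G), i'.1.1⟫ = 0 := hb'.2 hi
    exact (inner_embed (hv i) (hv i') (hn i) (hn i') ξ ξ').trans (by rw [h2, mul_zero])
  · set R : Submodule ℂ (Fock q G) :=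
      ⨆ i : w, LinearMap.range (embed j i.1.1 (hv i) (hn i)).toLinearMap with hR
    have inv : ∀ x : Fock q G →L[ℂ] Fock q G, (∀ i : w, ∀ ξ, x (embed j i.1.1 (hv i) (hn i) ξ) ∈ R) →
        ∀ ξ ∈ R.topologicalClosure, x ξ ∈ R.topologicalClosure := by
      intro x hx
      have h3 : R ≤ R.comap (x : Fock q G →ₗ[ℂ] Fock q G) := by
        conv_lhs => rw [hR]
        rw [iSup_le_iff]
        rintro i _ ⟨ξ, rfl⟩
        exact hx i ξ
      intro ξ hξ
      exact map_mem_closure x.continuous hξ fun η hη => h3 hη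
    have mem : ∀ (i : w) ξ, embed j i.1.1 (hv i) (hn i) ξ ∈ R := fun i ξ =>
      Submodule.mem_iSup_of_mem i ⟨ξ, rfl⟩
    -- The copies absorb $a(jh)$ and $a^*(jh)$, and each contains its basis vector $\eta$ as the
    -- image of the vacuum; hence the closure of their sum contains all vacuum-like vectors.
    refine ((eq_top_of_vacuumLike_le j R.isClosed_topologicalClosure ?_
      (fun h => inv _ fun i ξ => ?_) fun h => inv _ fun i ξ => ?_) : R.topologicalClosure = ⊤).ge
    · intro η hη
      have h4 := b.dense_span
      have h5 : (⟨η, hη⟩ : vacuumLike q j) ∈ (Submodule.span ℂ (Set.range b)).topologicalClosure :=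
        h4 ▸ Submodule.mem_top
      refine map_mem_closure (f := (Subtype.val : vacuumLike q j → Fock q G)) continuous_subtype_val h5 ?_
      have h6 : Submodule.span ℂ (Set.range b) ≤ R.comap (vacuumLike q j).subtype := by
        rw [Submodule.span_le]
        rintro _ ⟨i, rfl⟩
        rw [hb]
        have := mem i (vacuum q E)
        rw [embed_vacuum] at this
        exact this
      exact fun x hx => h6 hx
    · rw [← embed_creation]; exact mem _ _
    · rw [← embed_annihilation_self]; exact mem _ _

end VacuumLike

/-! ### Diagonal representations and the bicommutant theorem -/

section Amplification
variable {I : Type*} {F : Type*} [NormedAddCommGroup F] [InnerProductSpace ℂ F] [CompleteSpace F]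
  {L : Type*} [NormedAddCommGroup L] [InnerProductSpace ℂ L] [CompleteSpace L]
  {W : I → F →ₗᵢ[ℂ] L}

theorem clm_ext_isHilbertSum (hW : IsHilbertSum ℂ (fun _ : I => F) W) {x y : L →L[ℂ] L}
    (h : ∀ i ξ, x (W i ξ) = y (W i ξ)) : x = y := by
  ext ζ
  obtain ⟨f, rfl⟩ := hW.linearIsometryEquiv.symm.surjective ζ
  have h1 := hW.hasSum_linearIsometryEquiv_symm f
  refine (h1.mapL x).unique ?_
  simp only [h]
  exact h1.mapL y

/-- The diagonal action on a Hilbert sum of copies of `F`, as a linear map. -/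
def amplifyAux (hW : IsHilbertSum ℂ (fun _ : I => F) W) (x : F →L[ℂ] F) : L →L[ℂ] L :=
  (hW.linearIsometryEquiv.symm : lp (fun _ : I => F) 2 →L[ℂ] L).comp
    ((lp.mapCLM 2 (fun _ : I => x) (norm_nonneg x) fun _ => le_rfl).comp
      (hW.linearIsometryEquiv : L →L[ℂ] lp (fun _ : I => F) 2))

theorem linearIsometryEquiv_amplifyAux (hW : IsHilbertSum ℂ (fun _ : I => F) W) (x : F →L[ℂ] F) (ζ : L)
    (i : I) : hW.linearIsometryEquiv (amplifyAux hW x ζ) i = x (hW.linearIsometryEquiv ζ i) := by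
  simp [amplifyAux]

theorem ext_linearIsometryEquiv (hW : IsHilbertSum ℂ (fun _ : I => F) W) {ζ ζ' : L}
    (h : ∀ i, hW.linearIsometryEquiv ζ i = hW.linearIsometryEquiv ζ' i) : ζ = ζ' :=
  hW.linearIsometryEquiv.injective (lp.ext (funext h))

theorem hasSum_inner_linearIsometryEquiv (hW : IsHilbertSum ℂ (fun _ : I => F) W) (ζ ζ' : L) :
    HasSum (fun i => ⟪hW.linearIsometryEquiv ζ i, hW.linearIsometryEquiv ζ' i⟫) ⟪ζ, ζ'⟫ := by
  have := lp.hasSum_inner (𝕜 := ℂ) (hW.linearIsometryEquiv ζ) (hW.linearIsometryEquiv ζ')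
  rwa [LinearIsometryEquiv.inner_map_map] at this

/-- The diagonal representation of the bounded operators on a Hilbert sum of copies of `F`. -/
def amplify (hW : IsHilbertSum ℂ (fun _ : I => F) W) : (F →L[ℂ] F) →⋆ₐ[ℂ] (L →L[ℂ] L) where
  toFun := amplifyAux hW
  map_one' := by
    ext ζ; refine ext_linearIsometryEquiv hW fun i => ?_
    rw [linearIsometryEquiv_amplifyAux]; rfl
  map_mul' x y := by
    ext ζ; refine ext_linearIsometryEquiv hW fun i => ?_
    rw [mul_apply_eq_comp, linearIsometryEquiv_amplifyAux, linearIsometryEquiv_amplifyAux,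
      linearIsometryEquiv_amplifyAux, mul_apply_eq_comp]
  map_zero' := by
    ext ζ; refine ext_linearIsometryEquiv hW fun i => ?_
    rw [linearIsometryEquiv_amplifyAux]; simp
  map_add' x y := by
    ext ζ; refine ext_linearIsometryEquiv hW fun i => ?_
    rw [linearIsometryEquiv_amplifyAux, add_apply, add_apply, _root_.map_add, lp.coeFn_add, Pi.add_apply,
      linearIsometryEquiv_amplifyAux, linearIsometryEquiv_amplifyAux]
  commutes' c := by
    ext ζ; refine ext_linearIsometryEquiv hW fun i => ?_
    rw [linearIsometryEquiv_amplifyAux, Algebra.algebraMap_eq_smul_one, Algebra.algebraMap_eq_smul_one,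
      smul_apply, smul_apply, map_smul]
    rfl
  map_star' x := by
    rw [ContinuousLinearMap.star_eq_adjoint, ContinuousLinearMap.star_eq_adjoint,
      ContinuousLinearMap.eq_adjoint_iff]
    intro ζ ζ'
    refine (hasSum_inner_linearIsometryEquiv hW _ _).unique ?_
    have := hasSum_inner_linearIsometryEquiv hW ζ (amplifyAux hW x ζ')
    simp only [linearIsometryEquiv_amplifyAux] at this ⊢
    simpa only [ContinuousLinearMap.adjoint_inner_left] using this

theorem linearIsometryEquiv_amplify (hW : IsHilbertSum ℂ (fun _ : I => F) W) (x : F →L[ℂ] F) (ζ : L)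
    (i : I) : hW.linearIsometryEquiv (amplify hW x ζ) i = x (hW.linearIsometryEquiv ζ i) :=
  linearIsometryEquiv_amplifyAux hW x ζ i

theorem amplify_apply (hW : IsHilbertSum ℂ (fun _ : I => F) W) (x : F →L[ℂ] F) (i : I) (ξ : F) :
    amplify hW x (W i ξ) = W i (x ξ) := by
  classical
  have h1 : ∀ ξ, hW.linearIsometryEquiv (W i ξ) = lp.single 2 i ξ := fun ξ => by
    rw [← hW.linearIsometryEquiv_symm_apply_single ξ, LinearIsometryEquiv.apply_symm_apply]
  refine ext_linearIsometryEquiv hW fun k => ?_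
  rw [linearIsometryEquiv_amplify, h1, h1]
  by_cases hk : k = i
  · subst hk; rw [lp.single_apply_self, lp.single_apply_self]
  · rw [lp.single_apply_ne _ _ _ hk, lp.single_apply_ne _ _ _ hk, _root_.map_zero]

variable {S : Set (F →L[ℂ] F)}

/-- An operator that commutes with the amplification of `S` commutes with that of the bicommutant. -/
theorem commute_amplification (A : (F →L[ℂ] F) →⋆ₐ[ℂ] (L →L[ℂ] L))
    (hA : ∀ x i ξ, A x (W i ξ) = W i (x ξ))
    (hext : ∀ x y : L →L[ℂ] L, (∀ i ξ, x (W i ξ) = y (W i ξ)) → x = y)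
    {P : L →L[ℂ] L} (hP : ∀ s ∈ S, P * A s = A s * P) {x : F →L[ℂ] F}
    (hx : x ∈ Set.centralizer (Set.centralizer S)) : P * A x = A x * P := by
  have hA' : ∀ x i ξ ζ, ⟪W i ξ, A x ζ⟫ = ⟪W i (star x ξ), ζ⟫ := by
    intro x i ξ ζ
    rw [← hA, map_star, ContinuousLinearMap.star_eq_adjoint, ContinuousLinearMap.adjoint_inner_left]
  have hin : ∀ x : L →L[ℂ] L, (∀ i ξ k η, ⟪W i ξ, x (W k η)⟫ = 0) → x = 0 := by
    intro x hx
    refine hext _ _ fun k η => ?_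
    rw [zero_apply]
    set ζ := x (W k η) with hζ
    have h1 : innerSL ℂ ζ = 0 := by
      -- The hypothesis `hext` speaks of operators on $L$, not of functionals. The functional
      -- $\langle\zeta,\cdot\rangle$ is therefore turned into the operator
      -- $\zeta\langle\zeta,\cdot\rangle$.
      have h2 : (ContinuousLinearMap.toSpanSingleton ℂ ζ).comp (innerSL ℂ ζ) = 0 :=
        hext _ _ fun i ξ => by
          have h3 : ⟪ζ, W i ξ⟫ = 0 := by rw [← inner_conj_symm, hζ, hx, _root_.map_zero]
          simp [h3]
      by_contra h4
      have h5 := congrArg (fun y => ⟪ζ, y ζ⟫) h2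
      simp only [ContinuousLinearMap.comp_apply, innerSL_apply_apply,
        ContinuousLinearMap.toSpanSingleton_apply, inner_smul_right, zero_apply, inner_zero_right,
        mul_self_eq_zero, inner_self_eq_zero] at h5
      exact h4 (by rw [h5, _root_.map_zero])
    simpa using congrArg (fun y => y ζ) h1
  -- The matrix entries $B_{ik}=W_i^*PW_k$ commute with $S$, hence with $x$, and the entries of
  -- $PA(x)$ and $A(x)P$ are $B_{ik}x$ and $xB_{ik}$.
  obtain ⟨B, hB⟩ : ∃ B : I → I → (F →L[ℂ] F), ∀ i k ξ η, ⟪ξ, B i k η⟫ = ⟪W i ξ, P (W k η)⟫ :=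
    ⟨fun i k => (ContinuousLinearMap.adjoint (W i).toContinuousLinearMap).comp
      (P.comp (W k).toContinuousLinearMap), fun i k ξ η =>
        ContinuousLinearMap.adjoint_inner_right (W i).toContinuousLinearMap ξ (P (W k η))⟩
  have hBc : ∀ i k, B i k ∈ Set.centralizer S := by
    intro i k s hs
    refine ContinuousLinearMap.ext fun η => ext_inner_left ℂ fun ξ => ?_
    rw [mul_apply_eq_comp, mul_apply_eq_comp, hB, ← hA, ← mul_apply_eq_comp P, hP s hs, mul_apply_eq_comp,
      hA', ← hB, ContinuousLinearMap.star_eq_adjoint, ContinuousLinearMap.adjoint_inner_left]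
  refine sub_eq_zero.1 (hin _ fun i ξ k η => ?_)
  rw [sub_apply, inner_sub_right, mul_apply_eq_comp, mul_apply_eq_comp, hA, hA', ← hB, ← hB,
    ContinuousLinearMap.star_eq_adjoint, ContinuousLinearMap.adjoint_inner_left, sub_eq_zero]
  have h6 := congrArg (fun y => ⟪ξ, y η⟫) (hx _ (hBc i k))
  exact h6

/-- The bicommutant theorem for amplifications: `A x ζ` is a limit of vectors `A a ζ`. -/
theorem amplification_mem_closure (A : (F →L[ℂ] F) →⋆ₐ[ℂ] (L →L[ℂ] L))
    (hA : ∀ x i ξ, A x (W i ξ) = W i (x ξ))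
    (hext : ∀ x y : L →L[ℂ] L, (∀ i ξ, x (W i ξ) = y (W i ξ)) → x = y)
    (hS : ∀ s ∈ S, IsSelfAdjoint s) {D : Submodule ℂ (F →L[ℂ] F)} (h1 : (1 : F →L[ℂ] F) ∈ D)
    (hD : ∀ s ∈ S, ∀ a ∈ D, s * a ∈ D) {x : F →L[ℂ] F}
    (hx : x ∈ Set.centralizer (Set.centralizer S)) (ζ : L) :
    A x ζ ∈ closure ((fun a => A a ζ) '' (D : Set (F →L[ℂ] F))) := by
  set Q₀ : Submodule ℂ L := D.map ({ toFun := fun a => A a ζ, map_add' := fun a b => by rw [_root_.map_add]; rfl, map_smul' := fun c a => by rw [map_smul]; rfl } : (F →L[ℂ] F) →ₗ[ℂ] L) with hQ₀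
  have hcoe : ((fun a => A a ζ) '' (D : Set (F →L[ℂ] F))) = Q₀ := rfl
  rw [hcoe, ← Submodule.topologicalClosure_coe]
  set Q := Q₀.topologicalClosure with hQ
  have : CompleteSpace Q := Q₀.isClosed_topologicalClosure.completeSpace_coe
  have hQ' : ∀ s ∈ S, ∀ η ∈ Q, A s η ∈ Q := by
    intro s hs η hη
    refine map_mem_closure (A s).continuous hη ?_
    rintro _ ⟨a, ha, rfl⟩
    refine ⟨s * a, hD s hs a ha, ?_⟩
    change A (s * a) ζ = A s (A a ζ)
    rw [map_mul]; rfl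
  -- $Q$ is the closure of $\{A(a)\zeta : a\in D\}$. It is invariant under the self-adjoint
  -- operators $A(s)$, so its projection commutes with them, and then with $A(x)$. Since $1\in D$,
  -- the vector $\zeta$ lies in $Q$, and so does $A(x)\zeta$. Stability of $D$ under left
  -- multiplication by $S$ suffices; $D$ need not be an algebra.
  have hP : ∀ s ∈ S, Q.starProjection * A s = A s * Q.starProjection := by
    intro s hs
    ext η
    rw [mul_apply_eq_comp, mul_apply_eq_comp]
    refine Submodule.eq_starProjection_of_mem_of_inner_eq_zero
      (hQ' s hs _ (Q.starProjection_apply_mem η)) fun w hw => ?_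
    have h2 : star (A s) = A s := by rw [← map_star, (hS s hs).star_eq]
    rw [← map_sub, ← h2, ContinuousLinearMap.star_eq_adjoint, ContinuousLinearMap.adjoint_inner_left]
    exact Submodule.inner_left_of_mem_orthogonal (hQ' s hs w hw) (Q.sub_starProjection_mem_orthogonal η)
  have hc := commute_amplification A hA hext hP hx
  have hζ : ζ ∈ Q := Submodule.le_topologicalClosure _ ⟨1, h1, by change A 1 ζ = ζ; rw [map_one]; rfl⟩
  have h3 := congrArg (fun y => y ζ) hc
  simp only [mul_apply_eq_comp] at h3
  rw [Submodule.starProjection_eq_self_iff.2 hζ] at h3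
  rw [SetLike.mem_coe, ← h3]
  exact Q.starProjection_apply_mem _

variable (L) in
/-- The inclusion of the two summands of the sum of two copies of `L`. -/
def boolSingle (b : Bool) : L →ₗᵢ[ℂ] lp (fun _ : Bool => L) 2 where
  toLinearMap := lp.lsingle (E := fun _ : Bool => L) 2 b
  norm_map' x := lp.norm_single (E := fun _ : Bool => L) (p := 2) (by norm_num) b x

theorem isHilbertSum_boolSingle : IsHilbertSum ℂ (fun _ : Bool => L) (boolSingle L) := by
  refine IsHilbertSum.mk ?_ ?_
  · intro b b' h x y
    change ⟪lp.single (E := fun _ : Bool => L) 2 b x, lp.single (E := fun _ : Bool => L) 2 b' y⟫ = 0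
    rw [lp.inner_single_left, lp.single_apply_ne _ _ _ h, inner_zero_right]
  · rintro f -
    have := lp.hasSum_single (E := fun _ : Bool => L) (p := 2) (by norm_num) f
    rw [← this.tsum_eq, tsum_fintype]
    exact Submodule.le_topologicalClosure _ (Submodule.sum_mem _ fun b _ =>
      Submodule.mem_iSup_of_mem b ⟨f b, rfl⟩)

/-- The bicommutant theorem for amplifications and two vectors. -/
theorem amplify_mem_closure_pair (hW : IsHilbertSum ℂ (fun _ : I => F) W)
    (hS : ∀ s ∈ S, IsSelfAdjoint s) {D : Submodule ℂ (F →L[ℂ] F)} (h1 : (1 : F →L[ℂ] F) ∈ D)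
    (hD : ∀ s ∈ S, ∀ a ∈ D, s * a ∈ D) {x : F →L[ℂ] F}
    (hx : x ∈ Set.centralizer (Set.centralizer S)) (ζ ζ' : L) :
    (amplify hW x ζ, amplify hW x ζ') ∈
      closure ((fun a => (amplify hW a ζ, amplify hW a ζ')) '' (D : Set (F →L[ℂ] F))) := by
  have hB := isHilbertSum_boolSingle (L := L)
  -- The statement for one vector is applied to $(\zeta,\zeta')$ in $L\oplus L$, with the
  -- amplification of the amplification.
  have key := amplification_mem_closure (W := fun a : Bool × I => (boolSingle L a.1).comp (W a.2))
    ((amplify hB).comp (amplify hW))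
    (fun x a ξ => by
      change amplify hB (amplify hW x) (boolSingle L a.1 (W a.2 ξ)) = boolSingle L a.1 (W a.2 (x ξ))
      rw [amplify_apply, amplify_apply])
    (fun x y hxy => clm_ext_isHilbertSum hB fun b ξ => by
      obtain ⟨f, rfl⟩ := hW.linearIsometryEquiv.symm.surjective ξ
      have h2 := (hW.hasSum_linearIsometryEquiv_symm f).mapL (boolSingle L b).toContinuousLinearMap
      refine (h2.mapL x).unique ?_
      have h3 := h2.mapL y
      simp only [LinearIsometry.coe_toContinuousLinearMap] at h3 ⊢
      have h4 : ∀ i, x (boolSingle L b (W i (f i))) = y (boolSingle L b (W i (f i))) :=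
        fun i => hxy (b, i) (f i)
      simpa only [h4] using h3)
    hS h1 hD hx (boolSingle L true ζ + boolSingle L false ζ')
  have hv : ∀ a : F →L[ℂ] F, ((amplify hB).comp (amplify hW)) a
      (boolSingle L true ζ + boolSingle L false ζ') =
        boolSingle L true (amplify hW a ζ) + boolSingle L false (amplify hW a ζ') := by
    intro a
    change amplify hB (amplify hW a) _ = _
    rw [_root_.map_add, amplify_apply, amplify_apply]
  set p : lp (fun _ : Bool => L) 2 → L × L := fun f => (f true, f false) with hp
  have hpc : Continuous p := by
    have h5 : ∀ b, Continuous fun f : lp (fun _ : Bool => L) 2 => f b := fun b =>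
      (continuous_apply b).comp (lp.uniformContinuous_coe (p := 2)).continuous
    exact (h5 true).prodMk (h5 false)
  have hpv : ∀ u v : L, p (boolSingle L true u + boolSingle L false v) = (u, v) := by
    intro u v
    have h6 : ∀ b u, boolSingle L b u = lp.single 2 b u := fun b u => rfl
    rw [hp]
    simp only [h6, lp.coeFn_add, Pi.add_apply, lp.single_apply_self]
    rw [lp.single_apply_ne _ _ _ (by decide), lp.single_apply_ne _ _ _ (by decide), add_zero, zero_add]
  rw [hv] at key
  have := map_mem_closure hpc key (t := ((fun a => (amplify hW a ζ, amplify hW a ζ')) '' (D : Set (F →L[ℂ] F))))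
    (by
      rintro _ ⟨a, ha, rfl⟩
      refine ⟨a, ha, ?_⟩
      dsimp only
      rw [hv, hpv])
  rwa [hpv] at this

end Amplification

/-! ### Compressions of amplifications -/

section Compression
variable {I : Type*} {F : Type*} [NormedAddCommGroup F] [InnerProductSpace ℂ F] [CompleteSpace F]
  {F' : Type*} [NormedAddCommGroup F'] [InnerProductSpace ℂ F'] [CompleteSpace F']
  {L : Type*} [NormedAddCommGroup L] [InnerProductSpace ℂ L] [CompleteSpace L]
  {W : I → F →ₗᵢ[ℂ] L}

/-- The compression `x ↦ V^* (x ⊗ 1) V` of an amplification to a subspace. -/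
def compress (hW : IsHilbertSum ℂ (fun _ : I => F) W) (V : F' →ₗᵢ[ℂ] L) :
    (F →L[ℂ] F) →ₗ[ℂ] (F' →L[ℂ] F') where
  toFun x := (ContinuousLinearMap.adjoint V.toContinuousLinearMap).comp
    ((amplify hW x).comp V.toContinuousLinearMap)
  map_add' x y := by
    rw [_root_.map_add, ContinuousLinearMap.add_comp, ContinuousLinearMap.comp_add]
  map_smul' c x := by
    rw [map_smul, ContinuousLinearMap.smul_comp, ContinuousLinearMap.comp_smul, RingHom.id_apply]

variable (hW : IsHilbertSum ℂ (fun _ : I => F) W) (V : F' →ₗᵢ[ℂ] L)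

theorem inner_compress (x : F →L[ℂ] F) (ξ ξ' : F') :
    ⟪ξ, compress hW V x ξ'⟫ = ⟪V ξ, amplify hW x (V ξ')⟫ :=
  ContinuousLinearMap.adjoint_inner_right V.toContinuousLinearMap _ _

theorem compress_one : compress hW V 1 = 1 := by
  refine ContinuousLinearMap.ext fun ξ => ext_inner_left ℂ fun ξ' => ?_
  rw [inner_compress, map_one]
  exact V.inner_map_map _ _

/-- The compression maps an operator of a bicommutant into a commutant, if it does so on a
dense space of operators. -/
theorem compress_mul_eq_mul_compress {S : Set (F →L[ℂ] F)} (hS : ∀ s ∈ S, IsSelfAdjoint s)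
    {D : Submodule ℂ (F →L[ℂ] F)} (h1 : (1 : F →L[ℂ] F) ∈ D) (hD : ∀ s ∈ S, ∀ a ∈ D, s * a ∈ D)
    {y : F' →L[ℂ] F'} (hy : ∀ a ∈ D, y * compress hW V a = compress hW V a * y)
    {x : F →L[ℂ] F} (hx : x ∈ Set.centralizer (Set.centralizer S)) :
    y * compress hW V x = compress hW V x * y := by
  ext ξ
  -- At the vector $\xi$, the commutation involves $x\otimes 1$ only through its values at $V\xi$
  -- and $Vy\xi$, and it is a closed condition on these two values.
  have h2 := amplify_mem_closure_pair hW hS h1 hD hx (V ξ) (V (y ξ))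
  set V' := ContinuousLinearMap.adjoint V.toContinuousLinearMap with hV'
  have hc : IsClosed {p : L × L | y (V' p.1) = V' p.2} := isClosed_eq
    (y.continuous.comp (V'.continuous.comp continuous_fst)) (V'.continuous.comp continuous_snd)
  have h3 := closure_minimal (t := {p : L × L | y (V' p.1) = V' p.2}) ?_ hc h2
  · exact h3
  · rintro _ ⟨a, ha, rfl⟩
    exact congrArg (fun z => z ξ) (hy a ha)

end Compression

/-! ### Dilation of a contraction -/

section Dilation
variable {E : Type*} [NormedAddCommGroup E] [InnerProductSpace ℂ E] [CompleteSpace E]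
  {E' : Type*} [NormedAddCommGroup E'] [InnerProductSpace ℂ E'] [CompleteSpace E']

/-- A contraction is the compression of the identity to a pair of subspaces of a larger space. -/
theorem exists_dilation (T : E →L[ℂ] E') (hT : ‖T‖ ≤ 1) :
    ∃ (ι : E →ₗᵢ[ℂ] WithLp 2 (E × E')) (v : E' →ₗᵢ[ℂ] WithLp 2 (E × E')),
      ∀ k h, ⟪ι k, v h⟫ = ⟪T k, h⟫ := by
  set T' := ContinuousLinearMap.adjoint T with hT'
  have hT1 : ‖T'‖ ≤ 1 := by rw [hT', LinearIsometryEquiv.norm_map]; exact hT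
  have h0 : (0 : E' →L[ℂ] E') ≤ 1 - T.comp T' := by
    rw [ContinuousLinearMap.nonneg_iff_isPositive, ContinuousLinearMap.isPositive_iff_complex]
    intro x
    have h1 : ⟪(1 - T.comp T') x, x⟫ = ((‖x‖ ^ 2 - ‖T' x‖ ^ 2 : ℝ) : ℂ) := by
      rw [sub_apply, inner_sub_left, one_apply_eq_self, ContinuousLinearMap.comp_apply,
        ← ContinuousLinearMap.adjoint_inner_right, inner_self_eq_norm_sq_to_K, inner_self_eq_norm_sq_to_K]
      push_cast
      rfl
    rw [h1]
    refine ⟨congrArg _ (Complex.ofReal_re _), ?_⟩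
    have h2 : ‖T' x‖ ≤ ‖x‖ := by simpa using T'.le_of_opNorm_le hT1 x
    have h3 : ‖T' x‖ ^ 2 ≤ ‖x‖ ^ 2 := pow_le_pow_left₀ (norm_nonneg _) h2 2
    rw [RCLike.re_to_complex, Complex.ofReal_re]
    linarith
  -- $D$ is a defect operator, $D^*D=1-TT^*$. With $\iota k=(k,0)$ and $vh=(T^*h,Dh)$ the second map
  -- is isometric, because $\|T^*h\|^2+\|Dh\|^2=\|h\|^2$.
  obtain ⟨D, hD⟩ := CStarAlgebra.nonneg_iff_eq_star_mul_self.1 h0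
  refine ⟨⟨{ toFun := fun k => WithLp.toLp 2 (k, 0), map_add' := ?_, map_smul' := ?_ }, ?_⟩,
    ⟨{ toFun := fun h => WithLp.toLp 2 (T' h, D h), map_add' := ?_, map_smul' := ?_ }, ?_⟩, ?_⟩
  · intro x y; rw [← WithLp.toLp_add, Prod.mk_add_mk, add_zero]
  · intro c x; rw [← WithLp.toLp_smul, Prod.smul_mk, smul_zero]; rfl
  · intro x
    rw [← sq_eq_sq₀ (norm_nonneg _) (norm_nonneg _), WithLp.prod_norm_sq_eq_of_L2]
    simp
  · intro x y; rw [← WithLp.toLp_add, Prod.mk_add_mk, _root_.map_add, _root_.map_add]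
  · intro c x; rw [← WithLp.toLp_smul, Prod.smul_mk, map_smul, map_smul]; rfl
  · intro x
    rw [← sq_eq_sq₀ (norm_nonneg _) (norm_nonneg _), WithLp.prod_norm_sq_eq_of_L2]
    have h1 := congrArg (fun y => ⟪y x, x⟫) hD
    simp only [sub_apply, inner_sub_left, one_apply_eq_self, ContinuousLinearMap.comp_apply,
      mul_apply_eq_comp, ContinuousLinearMap.star_eq_adjoint, ContinuousLinearMap.adjoint_inner_left,
      inner_self_eq_norm_sq_to_K] at h1
    rw [← ContinuousLinearMap.adjoint_inner_right, inner_self_eq_norm_sq_to_K] at h1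
    have h2 : ‖x‖ ^ 2 - ‖T' x‖ ^ 2 = ‖D x‖ ^ 2 := Complex.ofReal_injective (by push_cast; exact h1)
    change ‖T' x‖ ^ 2 + ‖D x‖ ^ 2 = ‖x‖ ^ 2
    linarith
  · intro k h
    rw [WithLp.prod_inner_apply]
    change ⟪k, T' h⟫ + ⟪(0 : E'), D h⟫ = _
    rw [inner_zero_left, add_zero, hT', ContinuousLinearMap.adjoint_inner_right]

end Dilation

/-! ### Compression of normally ordered products -/

section FockCompression
variable {q : Set.Ioo (-1 : ℝ) 1} {E : Type*} [NormedAddCommGroup E] [InnerProductSpace ℂ E]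
  {E' : Type*} [NormedAddCommGroup E'] [InnerProductSpace ℂ E']
  {G : Type*} [NormedAddCommGroup G] [InnerProductSpace ℂ G]
  {I : Type*} {ι : E →ₗᵢ[ℂ] G} {η : I → Fock q G} {hη : ∀ i, IsVacuumLike ι (η i)}
  {h1 : ∀ i, ‖η i‖ = 1}

/-- On each copy the embedding intertwines $a^*(h)$ with $a^*(\iota h)$, and the copies span a dense
subspace. -/
theorem amplify_creation
    (hW : IsHilbertSum ℂ (fun _ : I => Fock q E) fun i => embed ι (η i) (hη i) (h1 i)) (h : E) :
    amplify hW (creation q h) = creation q (ι h) :=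
  clm_ext_isHilbertSum hW fun i ξ => (amplify_apply hW _ i ξ).trans (embed_creation _ _ _ _ _ _)

theorem amplify_annihilation
    (hW : IsHilbertSum ℂ (fun _ : I => Fock q E) fun i => embed ι (η i) (hη i) (h1 i)) (h : E) :
    amplify hW (annihilation q h) = annihilation q (ι h) := by
  rw [annihilation, ← ContinuousLinearMap.star_eq_adjoint, map_star, amplify_creation]
  rfl

variable (q) in
/-- The second quantization of an isometry. -/
def secondQuantization (v : E' →ₗᵢ[ℂ] G) : Fock q E' →ₗᵢ[ℂ] Fock q G :=
  embed v (vacuum q G) (isVacuumLike_vacuum v) norm_vacuum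

theorem secondQuantization_vacuum (v : E' →ₗᵢ[ℂ] G) :
    secondQuantization q v (vacuum q E') = vacuum q G := embed_vacuum _ _ _ _

variable (hW : IsHilbertSum ℂ (fun _ : I => Fock q E) fun i => embed ι (η i) (hη i) (h1 i))
  {v : E' →ₗᵢ[ℂ] G} {T : E → E'} (hT : ∀ k h, ⟪ι k, v h⟫ = ⟪T k, h⟫)
include hT

/-- This is `embed_annihilation` with $v^*\iota k=Tk$. It gives $a(\iota k)\mathcal F(v)=\mathcal
F(v)a(Tk)$, although $\iota k$ need not lie in the range of $v$. -/
theorem annihilation_secondQuantization (k : E) (ξ : Fock q E') :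
    annihilation q (ι k) (secondQuantization q v ξ) = secondQuantization q v (annihilation q (T k) ξ) :=
  (embed_annihilation v _ _ _ (annihilation_vacuum _) (hT k) ξ).symm

/-- The adjoint of `annihilation_secondQuantization` moves a creator out of the compression on the
left only; annihilators leave on the right. This asymmetry is the reason to work with normally
ordered products. -/
theorem compress_creation_mul (k : E) (X : Fock q E →L[ℂ] Fock q E) :
    compress hW (secondQuantization q v) (creation q k * X) =
      creation q (T k) * compress hW (secondQuantization q v) X := by
  refine ContinuousLinearMap.ext fun ξ => ext_inner_left ℂ fun ξ' => ?_
  rw [inner_compress, map_mul, amplify_creation, mul_apply_eq_comp, mul_apply_eq_comp,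
    ← inner_annihilation_left, ← inner_annihilation_left, inner_compress, annihilation_secondQuantization hT]

theorem compress_mul_annihilation (k : E) (X : Fock q E →L[ℂ] Fock q E) :
    compress hW (secondQuantization q v) (X * annihilation q k) =
      compress hW (secondQuantization q v) X * annihilation q (T k) := by
  refine ContinuousLinearMap.ext fun ξ => ext_inner_left ℂ fun ξ' => ?_
  rw [inner_compress, map_mul, amplify_annihilation, mul_apply_eq_comp, mul_apply_eq_comp,
    inner_compress, annihilation_secondQuantization hT]

/-- Creators leave on the left and annihilators on the right, term by term, and the powers of $q$
depend only on the positions. The two components of each pair are transformed by $T$ separately, so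
no reality condition enters yet. -/
theorem compress_wick {n : ℕ} (e : Fin n → E × E) (m : ℕ) (Y : Fock q E →L[ℂ] Fock q E) :
    compress hW (secondQuantization q v) (wick n e m Y) =
      wick n (fun i => (T (e i).1, T (e i).2)) m (compress hW (secondQuantization q v) Y) := by
  induction n generalizing m Y with
  | zero => rfl
  | succ n ih =>
    rw [wick, _root_.map_add, map_smul, compress_creation_mul hW hT, ih, ih, compress_mul_annihilation hW hT]
    rfl

end FockCompression

/-! ### Complete positivity -/

section CompletePositivity
variable {F : Type*} [NormedAddCommGroup F] [InnerProductSpace ℂ F] [CompleteSpace F]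
  {F' : Type*} [NormedAddCommGroup F'] [InnerProductSpace ℂ F'] [CompleteSpace F']
  {L : Type*} [NormedAddCommGroup L] [InnerProductSpace ℂ L] [CompleteSpace L]

/-- An injective star homomorphism reflects positivity. -/
theorem nonneg_of_map_nonneg {A B : Type*} [CStarAlgebra A] [PartialOrder A] [StarOrderedRing A]
    [CStarAlgebra B] [PartialOrder B] [StarOrderedRing B] (φ : A →⋆ₐ[ℂ] B)
    (hφ : Function.Injective φ) {a : A} (h : 0 ≤ φ a) : 0 ≤ a := by
  have ha : IsSelfAdjoint a := hφ (by rw [map_star, (IsSelfAdjoint.of_nonneg h).star_eq])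
  -- An injective star homomorphism of C*-algebras preserves the real spectrum of a self-adjoint
  -- element.
  rw [StarOrderedRing.nonneg_iff_spectrum_nonneg (R := ℝ) a, ← ha.map_spectrum_real φ hφ]
  exact fun x hx => spectrum_nonneg_of_nonneg h hx

theorem exists_eq_star_mul_self {A : Type*} [CStarAlgebra A] [PartialOrder A] [StarOrderedRing A] {a : A}
    (h : 0 ≤ a) : ∃ b, a = star b * b := CStarAlgebra.nonneg_iff_eq_star_mul_self.1 h

/-- The action of a matrix of operators on a sum of copies of the space. -/
def matrixAction {n : ℕ} (M : Fin n → Fin n → F →L[ℂ] F) :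
    PiLp 2 (fun _ : Fin n => F) →L[ℂ] PiLp 2 (fun _ : Fin n => F) :=
  ∑ i, ∑ j, (((PiLp.continuousLinearEquiv 2 ℂ (fun _ : Fin n => F)).symm :
    (Fin n → F) →L[ℂ] PiLp 2 (fun _ : Fin n => F)).comp (ContinuousLinearMap.single ℂ (fun _ : Fin n => F) i)).comp
      ((M i j).comp (PiLp.proj 2 (fun _ : Fin n => F) j))

theorem matrixAction_apply {n : ℕ} (M : Fin n → Fin n → F →L[ℂ] F) (ξ : PiLp 2 (fun _ : Fin n => F))
    (i : Fin n) : matrixAction M ξ i = ∑ j, M i j (ξ j) := by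
  classical
  simp [matrixAction, Pi.single_apply]

/-- Matrices over a von Neumann algebra, as operators on a sum of copies of the space. -/
def matrixRep (N : VonNeumannAlgebra F) (n : ℕ) :
    CStarMatrix (Fin n) (Fin n) N.toStarSubalgebra →⋆ₐ[ℂ]
      (PiLp 2 (fun _ : Fin n => F) →L[ℂ] PiLp 2 (fun _ : Fin n => F)) where
  toFun M := matrixAction fun i j => (M i j : F →L[ℂ] F)
  map_one' := by
    ext ξ i
    rw [matrixAction_apply, Finset.sum_eq_single i]
    · simp
    · intro j _ hj
      rw [CStarMatrix.one_apply_ne' hj]; simp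
    · simp
  map_mul' M M' := by
    ext ξ i
    rw [matrixAction_apply, mul_apply_eq_comp, matrixAction_apply]
    simp only [CStarMatrix.mul_apply, matrixAction_apply, map_sum]
    rw [Finset.sum_comm]
    refine Finset.sum_congr rfl fun j _ => ?_
    rw [AddSubmonoidClass.coe_finsetSum, sum_apply]
    rfl
  map_zero' := by
    ext ξ i
    rw [matrixAction_apply]; simp
  map_add' M M' := by
    ext ξ i
    rw [add_apply, PiLp.add_apply, matrixAction_apply, matrixAction_apply, matrixAction_apply,
      ← Finset.sum_add_distrib]
    rfl
  commutes' c := by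
    ext ξ i
    rw [matrixAction_apply, Finset.sum_eq_single i]
    · simp [CStarMatrix.algebraMap_apply]
    · intro j _ hj
      simp [CStarMatrix.algebraMap_apply, hj.symm]
    · simp
  map_star' M := by
    rw [ContinuousLinearMap.star_eq_adjoint, ContinuousLinearMap.eq_adjoint_iff]
    intro ξ ξ'
    rw [PiLp.inner_apply, PiLp.inner_apply]
    simp only [matrixAction_apply, sum_inner, inner_sum]
    rw [Finset.sum_comm]
    refine Finset.sum_congr rfl fun i _ => Finset.sum_congr rfl fun j _ => ?_
    rw [CStarMatrix.star_apply]
    exact ContinuousLinearMap.adjoint_inner_left _ _ _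

theorem matrixRep_apply (N : VonNeumannAlgebra F) {n : ℕ} (M : CStarMatrix (Fin n) (Fin n) N.toStarSubalgebra)
    (ξ : PiLp 2 (fun _ : Fin n => F)) (i : Fin n) :
    matrixRep N n M ξ i = ∑ j, (M i j : F →L[ℂ] F) (ξ j) := matrixAction_apply _ _ _

/-- Faithfulness is what allows positivity of a matrix over the von Neumann algebra to be tested on
vectors of a finite sum of copies of the space. -/
theorem matrixRep_injective (N : VonNeumannAlgebra F) (n : ℕ) : Function.Injective (matrixRep N n) := by
  classical
  intro M M' h
  refine CStarMatrix.ext fun i j => Subtype.ext (ContinuousLinearMap.ext fun ξ => ?_)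
  have h1 := congrArg (fun y => y (WithLp.toLp 2 (Pi.single j ξ)) i) h
  simp only [matrixRep_apply] at h1
  rw [Finset.sum_eq_single j, Finset.sum_eq_single j] at h1
  · simpa using h1
  all_goals simp +contextual

/-- A map between von Neumann algebras of the form `x ↦ V^* A(x) V` with a representation `A` is
completely positive. -/
theorem nonneg_map_of_inner_eq {M : VonNeumannAlgebra F} {N : VonNeumannAlgebra F'}
    (A : (F →L[ℂ] F) →⋆ₐ[ℂ] (L →L[ℂ] L)) (V : F' → L)
    (φ : M.toStarSubalgebra → N.toStarSubalgebra)
    (h : ∀ (x : M.toStarSubalgebra) (ξ ξ' : F'),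
      ⟪ξ, (φ x : F' →L[ℂ] F') ξ'⟫ = ⟪V ξ, A x (V ξ')⟫)
    (n : ℕ) (X : CStarMatrix (Fin n) (Fin n) M.toStarSubalgebra) (hX : 0 ≤ X) : 0 ≤ X.map φ := by
  refine nonneg_of_map_nonneg (matrixRep N n) (matrixRep_injective N n) ?_
  obtain ⟨B, rfl⟩ := exists_eq_star_mul_self hX
  rw [ContinuousLinearMap.nonneg_iff_isPositive, ContinuousLinearMap.isPositive_iff_complex]
  intro ξ
  -- With the positive matrix written as $B^*B$, the quadratic form becomes $\sum_k\|\sum_j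
  -- A(B_{kj})V\xi_j\|^2$. Linearity of $V$ plays no role in this computation.
  have key : ⟪ξ, matrixRep N n ((star B * B).map φ) ξ⟫ =
      ((∑ k, ‖∑ j, A (B k j : F →L[ℂ] F) (V (ξ j))‖ ^ 2 : ℝ) : ℂ) := by
    rw [PiLp.inner_apply]
    simp only [matrixRep_apply, inner_sum, CStarMatrix.map_apply, h, CStarMatrix.mul_apply]
    have h1 : ∀ i j k, ⟪V (ξ i), A ((star B i k * B k j : M.toStarSubalgebra) : F →L[ℂ] F) (V (ξ j))⟫ =
        ⟪A (B k i : F →L[ℂ] F) (V (ξ i)), A (B k j : F →L[ℂ] F) (V (ξ j))⟫ := by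
      intro i j k
      rw [CStarMatrix.star_apply]
      change ⟪V (ξ i), A (star (B k i : F →L[ℂ] F) * (B k j : F →L[ℂ] F)) (V (ξ j))⟫ = _
      rw [map_mul, map_star, ContinuousLinearMap.star_eq_adjoint, mul_apply_eq_comp,
        ContinuousLinearMap.adjoint_inner_right]
    simp only [AddSubmonoidClass.coe_finsetSum, map_sum, sum_apply, inner_sum, h1]
    push_cast
    simp only [← inner_self_eq_norm_sq_to_K (𝕜 := ℂ), ← Complex.coe_algebraMap]
    simp only [inner_sum, sum_inner]
    refine (Finset.sum_congr rfl fun i _ => Finset.sum_comm).trans (Finset.sum_comm.trans ?_)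
    exact Finset.sum_congr rfl fun k _ => Finset.sum_comm
  rw [← inner_conj_symm, key, Complex.conj_ofReal]
  refine ⟨congrArg _ (Complex.ofReal_re _), ?_⟩
  rw [RCLike.re_to_complex, Complex.ofReal_re]
  positivity

end CompletePositivity

/-! ### Normality -/

section Normality
open Filter Topology
open scoped ComplexOrder
variable {F : Type*} [NormedAddCommGroup F] [InnerProductSpace ℂ F] [CompleteSpace F]
  {F' : Type*} [NormedAddCommGroup F'] [InnerProductSpace ℂ F'] [CompleteSpace F']
  {L : Type*} [NormedAddCommGroup L] [InnerProductSpace ℂ L] [CompleteSpace L]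

theorem clm_nonneg_iff {x : F →L[ℂ] F} : 0 ≤ x ↔ ∀ ξ, 0 ≤ ⟪x ξ, ξ⟫ := by
  rw [ContinuousLinearMap.nonneg_iff_isPositive, ContinuousLinearMap.isPositive_iff_complex]
  refine forall_congr' fun ξ => ⟨fun h => ?_, fun h => ?_⟩
  · rw [← h.1]; exact Complex.zero_le_real.2 h.2
  · have := Complex.le_def.1 h
    exact ⟨Complex.ext rfl this.2, this.1⟩

/-- A decreasing net of positive operators converges weakly. -/
theorem exists_tendsto_inner_of_antitone {ι : Type*} [Preorder ι] [Nonempty ι] [IsDirectedOrder ι]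
    {d : ι → F →L[ℂ] F} (hd : Antitone d) (h0 : ∀ i, 0 ≤ d i) :
    ∃ c : F →L[ℂ] F, ∀ ξ η, Tendsto (fun i => ⟪d i ξ, η⟫) atTop (𝓝 ⟪c ξ, η⟫) := by
  have hdiag : ∀ ξ, ∃ l : ℂ, Tendsto (fun i => ⟪d i ξ, ξ⟫) atTop (𝓝 l) := by
    intro ξ
    have hre : ∀ i, ⟪d i ξ, ξ⟫ = ((⟪d i ξ, ξ⟫.re : ℝ) : ℂ) := fun i =>
      Complex.ext rfl (Complex.le_def.1 (clm_nonneg_iff.1 (h0 i) ξ)).2.symm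
    have hanti : Antitone fun i => ⟪d i ξ, ξ⟫.re := by
      intro i j hij
      have := (Complex.le_def.1 (clm_nonneg_iff.1 (sub_nonneg.2 (hd hij)) ξ)).1
      rw [sub_apply, inner_sub_left, Complex.sub_re, Complex.zero_re] at this
      dsimp only
      linarith
    have hb : BddBelow (Set.range fun i => ⟪d i ξ, ξ⟫.re) := by
      refine ⟨0, ?_⟩
      rintro _ ⟨i, rfl⟩
      exact (Complex.le_def.1 (clm_nonneg_iff.1 (h0 i) ξ)).1
    have h1 := (Complex.continuous_ofReal.tendsto _).comp (tendsto_atTop_ciInf hanti hb)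
    exact ⟨_, h1.congr fun i => (hre i).symm⟩
  -- The diagonal coefficients are decreasing and bounded below by $0$, hence convergent;
  -- polarization gives the others.
  have hlim : ∀ ξ η, ∃ l : ℂ, Tendsto (fun i => ⟪d i ξ, η⟫) atTop (𝓝 l) := by
    intro ξ η
    obtain ⟨l1, h1⟩ := hdiag (ξ + η)
    obtain ⟨l2, h2⟩ := hdiag (ξ - η)
    obtain ⟨l3, h3⟩ := hdiag (ξ + Complex.I • η)
    obtain ⟨l4, h4⟩ := hdiag (ξ - Complex.I • η)
    refine ⟨_, ((((h1.sub h2).sub (h3.const_mul Complex.I)).add (h4.const_mul Complex.I)).div_const 4).congr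
      fun i => ?_⟩
    exact (inner_map_polarization' (d i : F →ₗ[ℂ] F) ξ η).symm
  choose l hl using hlim
  obtain ⟨i₀⟩ := ‹Nonempty ι›
  have : Nonempty ι := ⟨i₀⟩
  -- Only indices $i\ge i_0$ matter in the limit, and there $0\le d_i\le d_{i_0}$. This bounds the
  -- limiting form, which is then represented by an operator.
  have hbound : ∀ ξ η, ‖l ξ η‖ ≤ ‖d i₀‖ * ‖ξ‖ * ‖η‖ := by
    intro ξ η
    refine le_of_tendsto (hl ξ η).norm ?_
    filter_upwards [eventually_ge_atTop i₀] with i hi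
    refine (norm_inner_le_norm _ _).trans ?_
    refine mul_le_mul_of_nonneg_right ?_ (norm_nonneg _)
    refine ((d i).le_opNorm ξ).trans (mul_le_mul_of_nonneg_right ?_ (norm_nonneg _))
    exact CStarAlgebra.norm_le_norm_of_nonneg_of_le (h0 i) (hd hi)
  set B : F →L⋆[ℂ] F →L[ℂ] ℂ := LinearMap.mkContinuous₂ (LinearMap.mk₂'ₛₗ (starRingEnd ℂ) (RingHom.id ℂ) l
    (fun ξ ξ' η => tendsto_nhds_unique (hl _ _) (((hl ξ η).add (hl ξ' η)).congr fun i => by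
      rw [_root_.map_add, inner_add_left]))
    (fun c ξ η => tendsto_nhds_unique (hl _ _) (((hl ξ η).const_mul _).congr fun i => by
      rw [map_smul, inner_smul_left]))
    (fun ξ η η' => tendsto_nhds_unique (hl _ _) (((hl ξ η).add (hl ξ η')).congr fun i => by
      rw [inner_add_right]))
    (fun c ξ η => tendsto_nhds_unique (hl _ _) (((hl ξ η).const_mul _).congr fun i => by
      rw [inner_smul_right]; rfl))) ‖d i₀‖ hbound with hB
  refine ⟨InnerProductSpace.continuousLinearMapOfBilin B, fun ξ η => ?_⟩
  rw [InnerProductSpace.continuousLinearMapOfBilin_apply]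
  exact hl ξ η

/-- A directed set in a von Neumann algebra converges weakly to its supremum. -/
theorem tendsto_inner_of_isLUB {M : VonNeumannAlgebra F} {S : Set M.toStarSubalgebra}
    (hne : S.Nonempty) (hS : DirectedOn (· ≤ ·) S) {a : M.toStarSubalgebra} (ha : IsLUB S a) (ξ : F) :
    Tendsto (fun s : S => ⟪((a : F →L[ℂ] F) - (s.1 : F →L[ℂ] F)) ξ, ξ⟫) atTop (𝓝 0) := by
  have : Nonempty S := hne.to_subtype
  have : IsDirectedOrder S := ⟨fun s t => by
    obtain ⟨u, hu, h1, h2⟩ := hS s.1 s.2 t.1 t.2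
    exact ⟨⟨u, hu⟩, h1, h2⟩⟩
  have hd : Antitone fun s : S => (a : F →L[ℂ] F) - (s.1 : F →L[ℂ] F) := by
    intro s t hst
    have h1 : (s.1 : F →L[ℂ] F) ≤ (t.1 : F →L[ℂ] F) := hst
    exact sub_le_sub_left h1 _
  have h0 : ∀ s : S, 0 ≤ (a : F →L[ℂ] F) - (s.1 : F →L[ℂ] F) := fun s =>
    sub_nonneg.2 (show (s.1 : F →L[ℂ] F) ≤ (a : F →L[ℂ] F) from ha.1 s.2)
  obtain ⟨c, hc⟩ := exists_tendsto_inner_of_antitone hd h0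
  -- The supremum is taken inside $M$, so the weak limit $c$ of $a-s$ must be shown to lie in $M$;
  -- it does, since it commutes with the commutant. Then $a-c$ is an upper bound of $S$ in $M$, so
  -- $a\le a-c$, and with $c\ge 0$ this forces $c=0$.
  have hcM : c ∈ M.toStarSubalgebra := by
    rw [VonNeumannAlgebra.mem_carrier, ← M.centralizer_centralizer]
    intro y hy
    refine ContinuousLinearMap.ext fun ξ => ext_inner_right ℂ fun η => ?_
    rw [mul_apply_eq_comp, mul_apply_eq_comp, ← ContinuousLinearMap.adjoint_inner_right]
    refine tendsto_nhds_unique (hc _ _) ((hc (y ξ) η).congr fun s => ?_)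
    rw [ContinuousLinearMap.adjoint_inner_right]
    have h1 : (a - s.1 : F →L[ℂ] F) * y = y * (a - s.1 : F →L[ℂ] F) :=
      hy _ (show (a - s.1 : F →L[ℂ] F) ∈ (M : Set (F →L[ℂ] F)) from (a - s.1).2)
    exact congrArg (fun z => ⟪z ξ, η⟫) h1
  have hc0 : 0 ≤ c := clm_nonneg_iff.2 fun ξ =>
    ge_of_tendsto' (hc ξ ξ) fun s => clm_nonneg_iff.1 (h0 s) ξ
  have hcs : ∀ s : S, c ≤ (a : F →L[ℂ] F) - (s.1 : F →L[ℂ] F) := by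
    intro s
    refine sub_nonneg.1 (clm_nonneg_iff.2 fun ξ => ?_)
    rw [sub_apply, inner_sub_left]
    refine ge_of_tendsto ((tendsto_const_nhds (x := ⟪(a - s.1 : F →L[ℂ] F) ξ, ξ⟫)).sub (hc ξ ξ)) ?_
    filter_upwards [eventually_ge_atTop s] with t ht
    have := clm_nonneg_iff.1 (sub_nonneg.2 (hd ht)) ξ
    rwa [sub_apply, inner_sub_left] at this
  have hle : a ≤ a - ⟨c, hcM⟩ := ha.2 fun s hs => by
    have h1 : (s : F →L[ℂ] F) ≤ (a : F →L[ℂ] F) - c := le_sub_comm.1 (hcs ⟨s, hs⟩)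
    exact h1
  have hle' : (a : F →L[ℂ] F) ≤ (a : F →L[ℂ] F) - c := hle
  have hcz : c = 0 := le_antisymm (by simpa using hle') hc0
  have := hc ξ ξ
  rwa [hcz, zero_apply, inner_zero_left] at this

variable {I : Type*} {W : I → F →ₗᵢ[ℂ] L}

/-- A coefficient of the amplification is the sum over the copies of coefficients of $d_i$. From
$i_0$ on this sum is dominated by $\|d_{i_0}\|\sum_k\|\zeta_k\|^2<\infty$, so the limit may be taken
termwise. -/
theorem tendsto_inner_amplify (hW : IsHilbertSum ℂ (fun _ : I => F) W) {κ : Type*} [Preorder κ]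
    [Nonempty κ] [IsDirectedOrder κ] {d : κ → F →L[ℂ] F} (hd : Antitone d) (h0 : ∀ i, 0 ≤ d i)
    (hlim : ∀ ξ, Tendsto (fun i => ⟪d i ξ, ξ⟫) atTop (𝓝 0)) (ζ : L) :
    Tendsto (fun i => ⟪amplify hW (d i) ζ, ζ⟫) atTop (𝓝 0) := by
  have h1 : ∀ i, ⟪amplify hW (d i) ζ, ζ⟫ =
      ∑' k, ⟪d i (hW.linearIsometryEquiv ζ k), hW.linearIsometryEquiv ζ k⟫ := fun i => by
    rw [← (hasSum_inner_linearIsometryEquiv hW (amplify hW (d i) ζ) ζ).tsum_eq]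
    simp only [linearIsometryEquiv_amplify]
  simp only [h1]
  obtain ⟨i₀⟩ := ‹Nonempty κ›
  have : Nonempty κ := ⟨i₀⟩
  have hs : Summable fun k => ‖d i₀‖ * ‖hW.linearIsometryEquiv ζ k‖ ^ 2 := by
    have := (hasSum_inner_linearIsometryEquiv hW ζ ζ).summable.norm
    simp only [inner_self_eq_norm_sq_to_K, norm_pow, RCLike.norm_ofReal, abs_norm] at this
    exact this.mul_left _
  have h2 := tendsto_tsum_of_dominated_convergence (𝓕 := atTop)
    (f := fun i k => ⟪d i (hW.linearIsometryEquiv ζ k), hW.linearIsometryEquiv ζ k⟫)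
    (g := fun _ => (0 : ℂ)) hs (fun k => hlim _) ?_
  · simpa using h2
  · filter_upwards [eventually_ge_atTop i₀] with i hi k
    refine (norm_inner_le_norm _ _).trans ?_
    rw [sq, ← mul_assoc]
    refine mul_le_mul_of_nonneg_right ?_ (norm_nonneg _)
    refine ((d i).le_opNorm _).trans (mul_le_mul_of_nonneg_right ?_ (norm_nonneg _))
    exact CStarAlgebra.norm_le_norm_of_nonneg_of_le (h0 i) (hd hi)

open scoped CStarAlgebra in
/-- A completely positive map of the form `x ↦ V^* (x ⊗ 1) V` is normal. -/
theorem isNormal_of_inner_eq (hW : IsHilbertSum ℂ (fun _ : I => F) W)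
    {M : VonNeumannAlgebra F} {N : VonNeumannAlgebra F'} (V : F' → L)
    (Φ : M.toStarSubalgebra →CP N.toStarSubalgebra)
    (h : ∀ (x : M.toStarSubalgebra) (ξ ξ' : F'),
      ⟪ξ, (Φ x : F' →L[ℂ] F') ξ'⟫ = ⟪V ξ, amplify hW x (V ξ')⟫) : IsNormal Φ := by
  intro S hne hS a ha
  refine ⟨?_, fun b hb => ?_⟩
  · rintro _ ⟨s, hs, rfl⟩
    exact OrderHomClass.mono Φ (ha.1 hs)
  · have : Nonempty S := hne.to_subtype
    have : IsDirectedOrder S := ⟨fun s t => by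
      obtain ⟨u, hu, h1, h2⟩ := hS s.1 s.2 t.1 t.2
      exact ⟨⟨u, hu⟩, h1, h2⟩⟩
    rw [le_iff_coe_le, ← sub_nonneg, clm_nonneg_iff]
    intro ξ
    have hd : Antitone fun s : S => (a : F →L[ℂ] F) - (s.1 : F →L[ℂ] F) := by
      intro s t hst
      have h1 : (s.1 : F →L[ℂ] F) ≤ (t.1 : F →L[ℂ] F) := hst
      exact sub_le_sub_left h1 _
    have h0 : ∀ s : S, 0 ≤ (a : F →L[ℂ] F) - (s.1 : F →L[ℂ] F) := fun s =>
      sub_nonneg.2 (show (s.1 : F →L[ℂ] F) ≤ (a : F →L[ℂ] F) from ha.1 s.2)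
    -- For an upper bound $b$ of the image, $b-\Phi(a)+\Phi(a-s)=b-\Phi(s)\ge 0$ for each $s$, and
    -- the form of $\Phi(a-s)$ at $\xi$ tends to $0$.
    have h2 := tendsto_inner_amplify hW hd h0 (tendsto_inner_of_isLUB hne hS ha) (V ξ)
    have h3 := (tendsto_const_nhds (x := ⟪((b : F' →L[ℂ] F') - (Φ a : F' →L[ℂ] F')) ξ, ξ⟫)).add h2
    rw [add_zero] at h3
    refine ge_of_tendsto' h3 fun s => ?_
    have h4 : ⟪amplify hW ((a : F →L[ℂ] F) - (s.1 : F →L[ℂ] F)) (V ξ), V ξ⟫ =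
        ⟪((Φ a : F' →L[ℂ] F') - (Φ s.1 : F' →L[ℂ] F')) ξ, ξ⟫ := by
      rw [← inner_conj_symm, ← inner_conj_symm (_ : F')]
      congr 1
      have := h (a - s.1) ξ ξ
      rw [map_sub Φ] at this
      exact this.symm
    rw [h4, ← inner_add_left, ← add_apply, sub_add_sub_cancel]
    have h5 : (Φ s.1 : F' →L[ℂ] F') ≤ (b : F' →L[ℂ] F') := hb ⟨s.1, s.2, rfl⟩
    exact clm_nonneg_iff.1 (sub_nonneg.2 h5) ξ

end Normality

/-! ### Functional calculus and the conjugation -/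

section Conjugation
variable {V : Type*} [NormedAddCommGroup V] [InnerProductSpace ℝ V]

theorem Cplx.inner_conj_conj (z w : Cplx V) : ⟪z.conj, w.conj⟫ = star ⟪z, w⟫ := by
  apply Complex.ext <;> simp [Cplx.inner_def, Cplx.conj]
  ring

theorem Cplx.conj_conj (z : Cplx V) : z.conj.conj = z := by
  ext <;> simp [Cplx.conj]

theorem Cplx.conj_smul (c : ℂ) (z : Cplx V) : (c • z).conj = star c • z.conj := by
  ext <;> simp [Cplx.conj]
  abel

theorem Cplx.conj_add (z w : Cplx V) : (z + w).conj = z.conj + w.conj := by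
  ext <;> simp [Cplx.conj]
  abel

theorem Cplx.norm_conj (z : Cplx V) : ‖z.conj‖ = ‖z‖ := by
  rw [← sq_eq_sq₀ (norm_nonneg _) (norm_nonneg _), Cplx.norm_sq_eq, Cplx.norm_sq_eq]
  simp [Cplx.conj]

variable (V) in
/-- The conjugation, as a real linear map. -/
def Cplx.conjL : Cplx V →L[ℝ] Cplx V :=
  LinearMap.mkContinuous
    { toFun := Cplx.conj
      map_add' := Cplx.conj_add
      map_smul' := fun c z => by
        have := Cplx.conj_smul (c : ℂ) z
        rw [Complex.star_def, Complex.conj_ofReal] at this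
        exact this } 1 fun z => by
    rw [one_mul]; exact (Cplx.norm_conj z).le

theorem Cplx.conjL_apply (z : Cplx V) : Cplx.conjL V z = z.conj := rfl

theorem Cplx.continuous_conj : Continuous (Cplx.conj : Cplx V → Cplx V) := (Cplx.conjL V).continuous

variable [CompleteSpace V]

/-- `y` is the conjugate of the operator `x`. -/
def IsConjugate (x y : Cplx V →L[ℂ] Cplx V) : Prop := ∀ z, (x z).conj = y z.conj

theorem IsConjugate.star {x y : Cplx V →L[ℂ] Cplx V} (h : IsConjugate x y) :
    IsConjugate (star x) (star y) := by
  intro z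
  refine ext_inner_right ℂ fun w => ?_
  rw [ContinuousLinearMap.star_eq_adjoint, ContinuousLinearMap.star_eq_adjoint,
    ContinuousLinearMap.adjoint_inner_left, ← Cplx.conj_conj w, ← h, Cplx.inner_conj_conj,
    Cplx.inner_conj_conj, ContinuousLinearMap.adjoint_inner_left]

/-- The conjugation commutes with the extension of an orthogonal transformation, is real linear and
continuous, and the weight $e^{-t}$ is real; so it passes through the integral. -/
theorem isConjugate_resolvent (U : OneParamGroup ℝ V) :
    IsConjugate U.complexify.resolvent U.complexify.resolvent := by
  intro z
  rw [OneParamGroup.resolvent_apply, OneParamGroup.resolvent_apply, ← Cplx.conjL_apply,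
    ← (Cplx.conjL V).integral_comp_comm (U.complexify.integrableOn_orbit z)]
  refine congrArg (fun f : ℝ → Cplx V => ∫ t in Set.Ioi (0 : ℝ), f t) (funext fun t => ?_)
  rw [Cplx.conjL_apply, Cplx.conj_smul, Complex.star_def, Complex.conj_ofReal]
  refine congrArg _ ?_
  ext <;> simp [OneParamGroup.complexify, Cplx.map, Cplx.conj]

/-- The reflection of the points of a disc at the real axis. -/
def discConj (r : ℝ) : C(Metric.closedBall (0 : ℂ) r, Metric.closedBall (0 : ℂ) r) :=
  ⟨fun z => ⟨star z.1, by
    have := z.2; rw [mem_closedBall_zero_iff] at this ⊢; rwa [norm_star]⟩, by fun_prop⟩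

/-- By Stone–Weierstrass it suffices to treat constants, $z$ and $\bar z$, together with sums,
products and limits. The conjugation is antilinear, so it conjugates coefficients but keeps $x$:
$f(x)$ becomes $f^\#(x)$ with $f^\#(z)=\overline{f(\bar z)}$. A disc is used as the domain because
it is symmetric under $z\mapsto\bar z$, so symmetry of the spectrum need not be known. -/
theorem isConjugate_of_starAlgHom {r : ℝ} {x : Cplx V →L[ℂ] Cplx V} (h : IsConjugate x x)
    (H : C(Metric.closedBall (0 : ℂ) r, ℂ) →⋆ₐ[ℂ] (Cplx V →L[ℂ] Cplx V)) (hHc : Continuous H)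
    (hid : H (ContinuousMap.restrict _ (ContinuousMap.id ℂ)) = x)
    (f : C(Metric.closedBall (0 : ℂ) r, ℂ)) : IsConjugate (H f) (H (star (f.comp (discConj r)))) := by
  have : CompactSpace (Metric.closedBall (0 : ℂ) r) := isCompact_iff_compactSpace.1 (isCompact_closedBall _ _)
  refine ContinuousMap.induction_on_of_compact (𝕜 := ℂ) (s := Metric.closedBall (0 : ℂ) r)
    (p := fun f => IsConjugate (H f) (H (star (f.comp (discConj r))))) ?_ ?_ ?_ ?_ ?_ ?_ f
  · intro c
    have h1 : ∀ c, H (ContinuousMap.const _ c) = c • 1 := fun c => by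
      rw [← map_one H, ← map_smul]
      congr 1
      ext; simp
    have h2 : star ((ContinuousMap.const (Metric.closedBall (0 : ℂ) r) c).comp (discConj r)) =
        ContinuousMap.const _ (star c) := by
      ext; simp
    rw [h2, h1, h1]
    exact fun z => Cplx.conj_smul c z
  · have h2 : star ((ContinuousMap.restrict (Metric.closedBall (0 : ℂ) r) (ContinuousMap.id ℂ)).comp
        (discConj r)) = ContinuousMap.restrict _ (ContinuousMap.id ℂ) := by
      ext; simp [discConj]
    rw [h2, hid]
    exact h
  · have h2 : star ((star (ContinuousMap.restrict (Metric.closedBall (0 : ℂ) r) (ContinuousMap.id ℂ))).comp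
        (discConj r)) = star (ContinuousMap.restrict _ (ContinuousMap.id ℂ)) := by
      ext; simp [discConj]
    rw [h2, map_star, hid]
    exact h.star
  · intro f g hf hg z
    have h2 : star ((f + g).comp (discConj r)) = star (f.comp (discConj r)) + star (g.comp (discConj r)) := by
      ext; simp
    rw [h2, _root_.map_add, _root_.map_add, add_apply, add_apply, Cplx.conj_add, hf, hg]
  · intro f g hf hg z
    have h2 : star ((f * g).comp (discConj r)) = star (f.comp (discConj r)) * star (g.comp (discConj r)) := by
      ext; simp
    rw [h2, map_mul, map_mul, mul_apply_eq_comp, mul_apply_eq_comp, hf, hg]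
  · intro f hf z
    have hc : IsClosed {f | (H f z).conj = H (star (f.comp (discConj r))) z.conj} :=
      isClosed_eq (Cplx.continuous_conj.comp (hHc.clm_apply continuous_const))
        ((hHc.comp (continuous_star.comp (ContinuousMap.continuous_precomp _))).clm_apply continuous_const)
    have : f ∈ closure {f | (H f z).conj = H (star (f.comp (discConj r))) z.conj} :=
      mem_closure_iff_frequently.2 (hf.mono fun g hg => hg z)
    rw [hc.closure_eq] at this
    exact this

/-- The calculus on the spectrum is precomposed with restriction from a disc that contains the
spectrum, to fit `isConjugate_of_starAlgHom`. -/
theorem exists_starAlgHom_cfc {E : Type*} [NormedAddCommGroup E] [InnerProductSpace ℂ E] [CompleteSpace E]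
    (x : E →L[ℂ] E) [hx : IsStarNormal x] :
    ∃ r, ∃ H : C(Metric.closedBall (0 : ℂ) r, ℂ) →⋆ₐ[ℂ] (E →L[ℂ] E), Continuous H ∧
      H (ContinuousMap.restrict _ (ContinuousMap.id ℂ)) = x ∧
      ∀ {g : ℂ → ℂ} (hg : Continuous g), H (ContinuousMap.restrict _ ⟨g, hg⟩) = cfc g x := by
  have hs := spectrum.subset_closedBall_norm_mul (𝕜 := ℂ) x
  refine ⟨_, cfcHomSuperset hx hs, cfcHomSuperset_continuous hx hs, cfcHomSuperset_id hx hs, fun {g} hg => ?_⟩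
  rw [cfc_apply g x hx hg.continuousOn]
  rfl

/-- Conjugation of continuous functions of a normal operator that commutes with the conjugation. -/
theorem isConjugate_cfc {x : Cplx V →L[ℂ] Cplx V} [hx : IsStarNormal x] (h : IsConjugate x x) {g : ℂ → ℂ}
    (hg : Continuous g) : IsConjugate (cfc g x) (cfc (fun z => star (g (star z))) x) := by
  obtain ⟨r, H, hHc, hid, hval⟩ := exists_starAlgHom_cfc x
  have hg' : Continuous fun z => star (g (star z)) := by fun_prop
  have h3 : star ((ContinuousMap.restrict _ ⟨g, hg⟩).comp (discConj r)) = ContinuousMap.restrict _ ⟨_, hg'⟩ := by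
    ext; simp [discConj]
  have := isConjugate_of_starAlgHom h H hHc hid (ContinuousMap.restrict _ ⟨g, hg⟩)
  rwa [h3, hval, hval] at this

end Conjugation

/-! ### The operator $2A/(1+A)$ -/

section DeformedOperator
variable {E : Type*} [NormedAddCommGroup E] [InnerProductSpace ℂ E] [CompleteSpace E]
open OneParamGroup

theorem continuous_twoADivOneAddA_symbol :
    Continuous fun l : ℝ => ((2 * Real.exp l / (1 + Real.exp l) : ℝ) : ℂ) := by
  refine Complex.continuous_ofReal.comp (Continuous.div (by fun_prop) (by fun_prop) fun l => by positivity)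

theorem norm_twoADivOneAddA_symbol_le (l : ℝ) :
    ‖((2 * Real.exp l / (1 + Real.exp l) : ℝ) : ℂ)‖ ≤ 2 := by
  rw [Complex.norm_real, Real.norm_of_nonneg (by positivity), div_le_iff₀ (by positivity)]
  linarith [Real.exp_pos l]

theorem twoADivOneAddA_resolvent (U : OneParamGroup ℂ E) (x : E) :
    U.twoADivOneAddA (U.resolvent x) =
      cfc (symbol fun l => ((2 * Real.exp l / (1 + Real.exp l) : ℝ) : ℂ)) U.resolvent x :=
  U.functionOf_resolvent continuous_twoADivOneAddA_symbol norm_twoADivOneAddA_symbol_le x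

/-- The conjugation exchanges the operators `2 A / (1 + A)` and `2 / (1 + A)`. -/
theorem isConjugate_twoADivOneAddA {V : Type*} [NormedAddCommGroup V] [InnerProductSpace ℝ V]
    [CompleteSpace V] (U : OneParamGroup ℝ V) :
    IsConjugate U.complexify.twoADivOneAddA
      ((2 : ℂ) • (1 : Cplx V →L[ℂ] Cplx V) - U.complexify.twoADivOneAddA) := by
  set R := U.complexify.resolvent with hR
  set B := U.complexify.twoADivOneAddA with hB
  have hs := continuous_symbol continuous_twoADivOneAddA_symbol norm_twoADivOneAddA_symbol_le
  intro z
  refine U.complexify.denseRange_resolvent.induction_on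
    (p := fun z => (B z).conj = ((2 : ℂ) • (1 : Cplx V →L[ℂ] Cplx V) - B) z.conj) z ?_ fun y => ?_
  · exact isClosed_eq (Cplx.continuous_conj.comp B.continuous)
      ((ContinuousLinearMap.continuous _).comp Cplx.continuous_conj)
  · rw [twoADivOneAddA_resolvent, isConjugate_cfc (isConjugate_resolvent U) hs y,
      isConjugate_resolvent U y, sub_apply, twoADivOneAddA_resolvent, smul_apply, one_apply_eq_self,
      ← hR]
    -- For $z=(1-il)^{-1}$, passing to $\bar z$ replaces $l$ by $-l$, and
    -- $\frac{2e^{l}}{1+e^{l}}=2-\frac{2e^{-l}}{1+e^{-l}}$.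
    have h1 : (fun z => star (symbol (fun l => ((2 * Real.exp l / (1 + Real.exp l) : ℝ) : ℂ)) (star z))) =
        fun z => 2 * id z - symbol (fun l => ((2 * Real.exp l / (1 + Real.exp l) : ℝ) : ℂ)) z := by
      funext z
      have h2 : ((starRingEnd ℂ z)⁻¹).im = -(z⁻¹).im := by rw [← map_inv₀, Complex.conj_im]
      simp only [symbol, Complex.star_def, map_mul, Complex.conj_conj, Complex.conj_ofReal, h2, neg_neg, id]
      have h3 : ∀ l : ℝ, 2 * Real.exp l / (1 + Real.exp l) = 2 - 2 * Real.exp (-l) / (1 + Real.exp (-l)) := by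
        intro l
        rw [Real.exp_neg]
        have := Real.exp_pos l
        field_simp
        ring
      rw [h3]
      push_cast
      ring
    rw [h1, cfc_sub (fun z => 2 * id z) _ _ (by fun_prop) (by fun_prop), cfc_const_mul 2 id _ (by fun_prop),
      cfc_id ℂ R]
    rfl

/-- With $l=-\operatorname{Im} z^{-1}$ this bounds $|zl|$: a factor $z$, that is, one resolvent,
absorbs linear growth in $l$. The case $z=0$ is harmless because of the default value $0^{-1}=0$. -/
theorem norm_mul_abs_symbol_arg_le (z : ℂ) : ‖z‖ * |(-(z⁻¹).im)| ≤ 1 := by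
  rw [abs_neg]
  by_cases hz : z = 0
  · simp [hz]
  · calc ‖z‖ * |(z⁻¹).im| ≤ ‖z‖ * ‖z⁻¹‖ := by gcongr; exact Complex.abs_im_le_norm _
      _ = 1 := by rw [norm_inv, mul_inv_cancel₀ (norm_ne_zero_iff.2 hz)]

/-- The operator `2 A / (1 + A)` has dense range. -/
theorem denseRange_twoADivOneAddA (U : OneParamGroup ℂ E) : DenseRange U.twoADivOneAddA := by
  set R := U.resolvent with hR
  set B := U.twoADivOneAddA with hB
  set f : ℝ → ℝ := fun l => 2 * Real.exp l / (1 + Real.exp l) with hf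
  have hfpos : ∀ l, 0 < f l := fun l => by positivity
  have hfc : Continuous f := Continuous.div (by fun_prop) (by fun_prop) fun l => by positivity
  have hsf : Continuous (symbol fun l => (f l : ℂ)) :=
    continuous_symbol continuous_twoADivOneAddA_symbol norm_twoADivOneAddA_symbol_le
  -- A bounded truncation of $1/f$. It is needed because $f(l)\to 0$ as $l\to-\infty$, so that $B$
  -- need not have a bounded inverse.
  set g : ℕ → ℝ → ℝ := fun n l => min (f l)⁻¹ (Real.exp n) with hg
  have hgpos : ∀ n l, 0 ≤ g n l := fun n l => le_min (by have := hfpos l; positivity) (by positivity)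
  have hgc : ∀ n, Continuous (g n) := fun n =>
    (hfc.inv₀ fun l => (hfpos l).ne').min continuous_const
  have hsg : ∀ n, Continuous (symbol fun l => (g n l : ℂ)) := fun n =>
    continuous_symbol (Complex.continuous_ofReal.comp (hgc n)) (C := Real.exp n) fun l => by
      rw [Complex.norm_real, Real.norm_of_nonneg (hgpos n l)]
      exact min_le_right _ _
  -- The difference $1-fg_n$ lies in $[0,1]$ and vanishes unless $f(l)e^n<1$, which forces $l\le
  -- -n$. So $n$ times it is at most $|l|$.
  have hfg : ∀ (n : ℕ) l, n * |1 - f l * g n l| ≤ |l| := by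
    intro n l
    have h1 : f l * g n l = min 1 (f l * Real.exp n) := by
      rw [hg, mul_min_of_nonneg _ _ (hfpos l).le, mul_inv_cancel₀ (hfpos l).ne']
    rw [h1, abs_of_nonneg (by linarith [min_le_left 1 (f l * Real.exp n)])]
    rcases le_or_gt 1 (f l * Real.exp n) with h2 | h2
    · rw [min_eq_left h2]; simp
    · have h3 : Real.exp (l + n) < 1 + Real.exp l := by
        have : 2 * Real.exp l / (1 + Real.exp l) * Real.exp n < 1 := h2
        rw [div_mul_eq_mul_div, div_lt_one (by positivity), mul_assoc, ← Real.exp_add] at this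
        linarith [Real.exp_pos (l + n)]
      have h4 : (n : ℝ) ≤ -l := by
        by_contra h5
        push Not at h5
        have h8 : 2 * Real.exp l < 1 + Real.exp l := by
          have h9 : 2 * Real.exp l / (1 + Real.exp l) * 1 ≤ f l * Real.exp n :=
            mul_le_mul_of_nonneg_left (Real.one_le_exp (by positivity)) (hfpos l).le
          have h10 := h9.trans_lt h2
          rwa [mul_one, div_lt_one (by positivity)] at h10
        have h11 : Real.exp l < 1 := by linarith
        have h12 : 2 * Real.exp (l + n) < 1 + Real.exp l := by
          have : 2 * Real.exp l / (1 + Real.exp l) * Real.exp n < 1 := h2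
          rwa [div_mul_eq_mul_div, div_lt_one (by positivity), mul_assoc, ← Real.exp_add] at this
        have h13 : 1 < Real.exp (l + n) := Real.one_lt_exp_iff.2 (by linarith)
        linarith
      have h5 : (0 : ℝ) ≤ n := by positivity
      have h6 : 0 ≤ min 1 (f l * Real.exp n) := le_min zero_le_one (mul_nonneg (hfpos l).le (Real.exp_pos _).le)
      calc (n : ℝ) * (1 - min 1 (f l * Real.exp n)) ≤ n * 1 := by gcongr; linarith
        _ ≤ -l := by linarith
        _ ≤ |l| := neg_le_abs l
  have hmem : ∀ y, R (R y) ∈ closure (Set.range B) := by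
    intro y
    -- Each of the symbols of $f$ and $g_{n+1}$ carries one factor $z$, so two resolvents are needed
    -- and the error is the function $z^2(1-fg_{n+1})$ of $R$. One factor $z$ is bounded on the
    -- spectrum, the other absorbs $|l|$, and $O(1/(n+1))$ remains. The index $n+1$ avoids a
    -- division by zero.
    have h1 : ∀ n : ℕ, R (R y) - B (R (cfc (symbol fun l => (g (n + 1) l : ℂ)) R y)) =
        cfc (fun z => id z * id z - symbol (fun l => (f l : ℂ)) z * symbol (fun l => (g (n + 1) l : ℂ)) z) R y := by
      intro n
      have hg' := hsg (n + 1)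
      rw [cfc_sub (fun z => id z * id z) _ _ (by fun_prop) (by fun_prop), cfc_mul id id R (by fun_prop) (by fun_prop),
        cfc_mul _ _ R (by fun_prop) (by fun_prop), cfc_id ℂ R, twoADivOneAddA_resolvent]
      rfl
    have h2 : ∀ n : ℕ, ‖R (R y) - B (R (cfc (symbol fun l => (g (n + 1) l : ℂ)) R y))‖ ≤
        (‖R‖ * ‖(1 : E →L[ℂ] E)‖ * ‖y‖) * (1 / ((n : ℝ) + 1)) := by
      intro n
      rw [h1]
      refine (ContinuousLinearMap.le_of_opNorm_le _ (norm_cfc_le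
        (c := ‖R‖ * ‖(1 : E →L[ℂ] E)‖ * (1 / ((n : ℝ) + 1))) (by positivity) fun z hz => ?_) y).trans
        (le_of_eq (by ring))
      set l := -(z⁻¹).im with hl
      have h3 : id z * id z - symbol (fun l => (f l : ℂ)) z * symbol (fun l => (g (n + 1) l : ℂ)) z =
          z * (z * ((1 - f l * g (n + 1) l : ℝ) : ℂ)) := by
        simp only [symbol, id, ← hl]
        push_cast
        ring
      rw [h3, norm_mul, norm_mul, Complex.norm_real, Real.norm_eq_abs]
      -- The factor $\|1\|$ keeps the bound valid without assuming that the space is nontrivial.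
      have h4 : ‖z‖ ≤ ‖R‖ * ‖(1 : E →L[ℂ] E)‖ := by
        simpa using spectrum.subset_closedBall_norm_mul R hz
      have h5 := norm_mul_abs_symbol_arg_le z
      have h6 := hfg (n + 1) l
      rw [← hl] at h5
      refine mul_le_mul h4 ?_ (by positivity) (by positivity)
      rw [le_div_iff₀ (by positivity)]
      push_cast at h6
      calc ‖z‖ * |1 - f l * g (n + 1) l| * ((n : ℝ) + 1) =
            ‖z‖ * (((n : ℝ) + 1) * |1 - f l * g (n + 1) l|) := by ring
        _ ≤ ‖z‖ * |l| := by gcongr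
        _ ≤ 1 := h5
    have h3 := (tendsto_one_div_add_atTop_nhds_zero_nat (𝕜 := ℝ)).const_mul (‖R‖ * ‖(1 : E →L[ℂ] E)‖ * ‖y‖)
    rw [mul_zero] at h3
    have h4 := tendsto_iff_norm_sub_tendsto_zero.2 (squeeze_zero (fun n => norm_nonneg
      (B (R (cfc (symbol fun l => (g (n + 1) l : ℂ)) R y)) - R (R y))) (fun n => by
        rw [norm_sub_rev]; exact h2 n) h3)
    exact mem_closure_of_tendsto h4 (Filter.Eventually.of_forall fun n => ⟨_, rfl⟩)
  have hRR : DenseRange fun y => R (R y) :=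
    U.denseRange_resolvent.comp U.denseRange_resolvent R.continuous
  refine fun x => closure_minimal ?_ isClosed_closure (hRR x)
  rintro _ ⟨y, rfl⟩
  exact hmem y

end DeformedOperator

/-! ### Right fields and the flip of tensor factors -/

section Flip
variable {q : Set.Ioo (-1 : ℝ) 1} {E : Type*} [NormedAddCommGroup E] [InnerProductSpace ℂ E]

theorem inversions_revPerm_conj {n : ℕ} (σ : Equiv.Perm (Fin n)) :
    inversions (Fin.revPerm * σ * Fin.revPerm) = inversions σ := by
  rw [inversions, inversions]
  refine Finset.card_bij (fun p _ => (p.2.rev, p.1.rev)) ?_ ?_ ?_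
  · rintro ⟨a, b⟩ h
    simpa using h
  · rintro ⟨a, b⟩ _ ⟨c, d⟩ _ h
    simp at h ⊢
    tauto
  · rintro ⟨a, b⟩ h
    exact ⟨(b.rev, a.rev), by simpa using h, by simp⟩

theorem levelKernel_rev (q : ℝ) {n : ℕ} (e f : Fin n → E) :
    levelKernel q (e ∘ Fin.rev) (f ∘ Fin.rev) = levelKernel q e f := by
  rw [levelKernel, levelKernel,
    ← Equiv.sum_comp ((Equiv.mulLeft Fin.revPerm).trans (Equiv.mulRight Fin.revPerm))]
  refine Finset.sum_congr rfl fun σ _ => ?_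
  have h1 : ((Equiv.mulLeft Fin.revPerm).trans (Equiv.mulRight Fin.revPerm)) σ =
    (Fin.revPerm * σ * Fin.revPerm : Equiv.Perm (Fin n)) := rfl
  rw [h1, inversions_revPerm_conj, ← Equiv.prod_comp Fin.revPerm]
  simp

/-- The reversal of the tensor factors, on formal tensors. -/
def preFlip : PreFock q E →ₗ[ℂ] PreFock q E := PreFock.lift fun _ e => preTensor (e ∘ Fin.rev)

theorem inner_preFlip (ξ η : PreFock q E) : ⟪preFlip ξ, preFlip η⟫ = ⟪ξ, η⟫ := by
  induction ξ using PreFock.induction with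
  | zero => simp
  | add ξ ζ h1 h2 => simp only [_root_.map_add, inner_add_left, h1, h2]
  | smul c n e =>
  induction η using PreFock.induction with
  | zero => simp
  | add ξ ζ h1 h2 => simp only [_root_.map_add, inner_add_right, h1, h2]
  | smul d m f =>
  simp only [map_smul, inner_smul_left, inner_smul_right, preFlip, PreFock.lift_preTensor,
    inner_preTensor]
  congr 2
  by_cases h : n = m
  · subst h
    rw [kernel_same, kernel_same, levelKernel_rev]
  · rw [kernel_ne _ h, kernel_ne _ h]

theorem norm_preFlip_le (ξ : PreFock q E) : ‖preFlip ξ‖ ≤ 1 * ‖ξ‖ := by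
  have h := inner_preFlip ξ ξ
  rw [inner_self_eq_norm_sq_to_K, inner_self_eq_norm_sq_to_K] at h
  rw [one_mul, ← sq_le_sq₀ (norm_nonneg _) (norm_nonneg _)]
  exact le_of_eq (Complex.ofReal_injective (by push_cast; simpa using h))

variable (q E) in
/-- The unitary that reverses the tensor factors. -/
def flip : Fock q E →L[ℂ] Fock q E := ((preFlip : PreFock q E →ₗ[ℂ] PreFock q E).mkContinuous 1 norm_preFlip_le).completion

theorem preFlip_preTensor {n : ℕ} (e : Fin n → E) :
    preFlip (preTensor e : PreFock q E) = preTensor (e ∘ Fin.rev) :=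
  PreFock.lift_preTensor _ _

theorem flip_tensor {n : ℕ} (e : Fin n → E) : flip q E (tensor q e) = tensor q (e ∘ Fin.rev) := by
  rw [flip, tensor, ContinuousLinearMap.completion_apply_coe, tensor]
  congr 1
  exact preFlip_preTensor e

theorem flip_mul_flip : flip q E * flip q E = 1 := by
  refine clm_ext_tensor fun n e => ?_
  rw [mul_apply_eq_comp, flip_tensor, flip_tensor, one_apply_eq_self]
  congr 1
  funext i
  simp

theorem star_flip : star (flip q E) = flip q E := by
  have h : star (flip q E) * flip q E = 1 := by
    refine clm_ext_tensor fun n e => fock_ext fun m f => ?_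
    rw [ContinuousLinearMap.star_eq_adjoint, mul_apply_eq_comp, ContinuousLinearMap.adjoint_inner_left,
      one_apply_eq_self, flip_tensor, flip_tensor, inner_tensor ⟨n, _⟩ ⟨m, _⟩, inner_tensor ⟨n, _⟩ ⟨m, _⟩]
    by_cases h : n = m
    · subst h
      rw [kernel_same, kernel_same, levelKernel_rev]
    · rw [kernel_ne _ h, kernel_ne _ h]
  calc star (flip q E) = star (flip q E) * (flip q E * flip q E) := by rw [flip_mul_flip, mul_one]
    _ = flip q E := by rw [← mul_assoc, h, one_mul]

theorem star_creation (h : E) : star (creation q h) = annihilation q h := rfl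

theorem star_annihilation (h : E) : star (annihilation q h) = creation q h := by
  rw [← star_creation, star_star]

/-- The right creation operator `e ↦ e ⊗ h`. -/
def rightCreation (q : Set.Ioo (-1 : ℝ) 1) (h : E) : Fock q E →L[ℂ] Fock q E :=
  flip q E * creation q h * flip q E

theorem rightCreation_tensor (h : E) {n : ℕ} (e : Fin n → E) :
    rightCreation q h (tensor q e) = tensor q (Fin.snoc e h : Fin (n + 1) → E) := by
  rw [rightCreation, mul_apply_eq_comp, mul_apply_eq_comp, flip_tensor, creation_tensor, flip_tensor]
  congr 1
  funext i
  refine Fin.lastCases ?_ (fun j => ?_) i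
  · simp
  · simp [Fin.rev_castSucc]

theorem star_rightCreation (h : E) :
    star (rightCreation q h) = flip q E * annihilation q h * flip q E := by
  rw [rightCreation, star_mul, star_mul, star_flip, star_creation, mul_assoc]

theorem commute_creation_rightCreation (h g : E) :
    Commute (creation q h) (rightCreation q g) := by
  refine clm_ext_tensor fun n e => ?_
  rw [mul_apply_eq_comp, mul_apply_eq_comp, rightCreation_tensor, creation_tensor, creation_tensor,
    rightCreation_tensor, Fin.cons_snoc_eq_snoc_cons]

/-- Of the summands of $a(h)(e\otimes g)$, only the one that contracts the last factor $g$ is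
missing from $(a(h)e)\otimes g$; it removes the factor at position $n$, which gives $q^n$. -/
theorem annihilation_rightCreation_tensor (h g : E) {n : ℕ} (e : Fin n → E) :
    (annihilation q h * rightCreation q g - rightCreation q g * annihilation q h) (tensor q e) =
      ((q : ℂ) ^ n * ⟪h, g⟫) • tensor q e := by
  rw [sub_apply, mul_apply_eq_comp, mul_apply_eq_comp, rightCreation_tensor, annihilation_tensor,
    Fin.sum_univ_castSucc]
  have hl : (Fin.last n).removeNth (Fin.snoc e g : Fin (n + 1) → E) = e := by
    funext i
    simp [Fin.removeNth]
  rw [hl, Fin.snoc_last, Fin.val_last, add_sub_right_comm]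
  convert zero_add _
  cases n with
  | zero => simp [annihilation_tensor_zero]
  | succ n =>
    rw [annihilation_tensor, map_sum, sub_eq_zero]
    refine Finset.sum_congr rfl fun p _ => ?_
    rw [map_smul, rightCreation_tensor, Fin.snoc_castSucc, Fin.val_castSucc]
    congr 2
    funext i
    refine Fin.lastCases ?_ (fun j => ?_) i
    · rw [Fin.snoc_last, Fin.removeNth, Fin.succAbove_castSucc_of_le _ _ (Fin.le_last p), Fin.succ_last,
        Fin.snoc_last]
    · rw [Fin.snoc_castSucc, Fin.removeNth, Fin.castSucc_succAbove_castSucc, Fin.snoc_castSucc, Fin.removeNth]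

/-- The commutator is the scalar $q^n\langle h,g\rangle$ on tensors of length $n$, and this is real.
-/
theorem isSelfAdjoint_annihilation_rightCreation {h g : E} (hg : star ⟪h, g⟫ = ⟪h, g⟫) :
    IsSelfAdjoint (annihilation q h * rightCreation q g - rightCreation q g * annihilation q h) := by
  refine clm_ext_tensor fun n e => fock_ext fun m f => ?_
  rw [ContinuousLinearMap.star_eq_adjoint, ContinuousLinearMap.adjoint_inner_left,
    annihilation_rightCreation_tensor, annihilation_rightCreation_tensor, inner_smul_left, inner_smul_right,
    inner_tensor ⟨n, _⟩ ⟨m, _⟩]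
  by_cases h : n = m
  · subst h
    rw [map_mul, map_pow, Complex.conj_ofReal, ← Complex.star_def, hg]
  · rw [kernel_ne _ h, mul_zero, mul_zero]

/-- The left and right fields of two vectors with a real inner product commute. -/
theorem commute_field_rightField {h g : E} (hg : star ⟪h, g⟫ = ⟪h, g⟫) :
    Commute (creation q h + annihilation q h)
      (flip q E * (creation q g + annihilation q g) * flip q E) := by
  -- Let $l$ and $r$ be the left and right creators. Since $l$ commutes with $r$, and $l^*$ with
  -- $r^*$, one has $[l+l^*,r+r^*]=[l^*,r]+[l,r^*]=C-C^*$ with $C=[l^*,r]$, and $C$ is self-adjoint.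
  have h1 := (isSelfAdjoint_annihilation_rightCreation (q := q) hg).star_eq
  have h2 := (commute_creation_rightCreation (q := q) h g).eq
  have h3 := congrArg star h2
  rw [star_sub, star_mul, star_mul, star_annihilation, star_rightCreation] at h1
  rw [star_mul, star_mul, star_creation, star_rightCreation] at h3
  have h4 : flip q E * (creation q g + annihilation q g) * flip q E =
      rightCreation q g + flip q E * annihilation q g * flip q E := by
    rw [mul_add, add_mul, rightCreation]
  rw [h4, Commute, SemiconjBy, add_mul, mul_add, mul_add, add_mul, mul_add, mul_add, h2, ← h3]
  rw [sub_eq_sub_iff_add_eq_add] at h1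
  generalize flip q E * annihilation q g * flip q E = r at *
  have h5 : annihilation q h * rightCreation q g + creation q h * r =
      r * creation q h + rightCreation q g * annihilation q h := by rw [← h1]
  calc _ = rightCreation q g * creation q h + r * annihilation q h +
        (annihilation q h * rightCreation q g + creation q h * r) := by abel
    _ = _ := by rw [h5]; abel

/-- An operator that commutes with sufficiently many right fields is determined by its value at
the vacuum. -/
theorem eq_zero_of_commute_rightField {S : Set E} (hS : Dense (Submodule.span ℂ S : Set E))
    {x : Fock q E →L[ℂ] Fock q E}
    (hx : ∀ g ∈ S, Commute x (flip q E * (creation q g + annihilation q g) * flip q E))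
    (h0 : x (vacuum q E) = 0) : x = 0 := by
  -- The flip turns right fields into left ones, so the kernel of $x$ composed with the flip is
  -- invariant under the left fields of vectors in $S$.
  have h1 : ∀ g ∈ S, ∀ ζ, (x * flip q E) ζ = 0 →
      (x * flip q E) ((creation q g + annihilation q g) ζ) = 0 := by
    intro g hg ζ hζ
    have h2 : x * flip q E * (creation q g + annihilation q g) =
        flip q E * (creation q g + annihilation q g) * flip q E * (x * flip q E) := by
      calc x * flip q E * (creation q g + annihilation q g)
          = x * (flip q E * (creation q g + annihilation q g) * flip q E) * flip q E := by
            simp only [mul_assoc, flip_mul_flip, mul_one]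
        _ = _ := by rw [(hx g hg).eq, mul_assoc]
    rw [← mul_apply_eq_comp, h2, mul_apply_eq_comp, hζ, _root_.map_zero]
  have h2 : ∀ n, ∀ m ≤ n, ∀ e : Fin m → E, (x * flip q E) (tensor q e) = 0 := by
    intro n
    have h3 : ∀ e : Fin 0 → E, (x * flip q E) (tensor q e) = 0 := by
      intro e
      rw [mul_apply_eq_comp, flip_tensor, ← h0, vacuum]
      exact congrArg (fun e => x (tensor q e)) (Subsingleton.elim _ _)
    induction n with
    | zero =>
      intro m hm e
      obtain rfl : m = 0 := by omega
      exact h3 e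
    | succ n ih =>
      intro m hm e
      cases m with
      | zero => exact h3 e
      | succ m =>
        rw [← Fin.cons_self_tail e, ← creation_tensor]
        -- For $g\in S$, the tensor $g\otimes t$ is the field of $g$ applied to $t$, minus $a(g)t$,
        -- which is shorter and covered by induction. The field is not complex linear in $g$, but
        -- $g\mapsto g\otimes t$ is linear and continuous, so vanishing on $S$ extends to all
        -- vectors.
        have h4 : (x * flip q E) ∘L (creationL q E).flip (tensor q (Fin.tail e)) = 0 := by
          refine ContinuousLinearMap.ext_on hS fun g hg => ?_
          have h5 := h1 g hg _ (ih m (by omega) (Fin.tail e))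
          rw [add_apply, _root_.map_add] at h5
          have h6 : (x * flip q E) (annihilation q g (tensor q (Fin.tail e))) = 0 := by
            cases m with
            | zero => rw [annihilation_tensor_zero, _root_.map_zero]
            | succ m =>
              rw [annihilation_tensor, map_sum]
              refine Finset.sum_eq_zero fun p _ => ?_
              rw [map_smul, ih m (by omega), smul_zero]
          rw [h6, add_zero] at h5
          exact h5
        exact congrArg (fun y => y (e 0)) h4
  have h3 : x * flip q E = 0 := clm_ext_tensor fun n e => h2 n n le_rfl e
  calc x = x * flip q E * flip q E := by rw [mul_assoc, flip_mul_flip, mul_one]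
    _ = 0 := by rw [h3, zero_mul]

end Flip

/-! ### The vacuum is separating -/

section Separating
variable {V : Type*} [NormedAddCommGroup V] [InnerProductSpace ℝ V] [CompleteSpace V]

theorem incl_add (U : OneParamGroup ℝ V) (x y : Cplx V) : incl U (x + y) = incl U x + incl U y :=
  UniformSpace.Completion.coe_add _ _

theorem incl_smul (U : OneParamGroup ℝ V) (c : ℂ) (x : Cplx V) : incl U (c • x) = c • incl U x :=
  (UniformSpace.Completion.toComplₗᵢ (𝕜 := ℂ) (E := PreDeformed U)).map_smul c x

theorem norm_incl_le (U : OneParamGroup ℝ V) (x : Cplx V) :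
    ‖incl U x‖ ≤ √‖U.complexify.twoADivOneAddA‖ * ‖x‖ := by
  rw [← sq_le_sq₀ (norm_nonneg _) (by positivity), mul_pow, Real.sq_sqrt (norm_nonneg _),
    ← inner_self_eq_norm_sq (𝕜 := ℂ), inner_incl, deformedInner]
  calc _ ≤ ‖⟪U.complexify.twoADivOneAddA x, x⟫‖ := Complex.re_le_norm _
    _ ≤ ‖U.complexify.twoADivOneAddA x‖ * ‖x‖ := norm_inner_le_norm _ _
    _ ≤ ‖U.complexify.twoADivOneAddA‖ * ‖x‖ * ‖x‖ := by
      gcongr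
      exact ContinuousLinearMap.le_opNorm _ _
    _ = _ := by ring

/-- The inclusion of the complexification in the deformed Hilbert space, as a bounded linear map. -/
def inclL (U : OneParamGroup ℝ V) : Cplx V →L[ℂ] Deformed U :=
  LinearMap.mkContinuous ⟨⟨incl U, incl_add U⟩, incl_smul U⟩ _ (norm_incl_le U)

theorem denseRange_incl (U : OneParamGroup ℝ V) : DenseRange (incl U) :=
  UniformSpace.Completion.denseRange_coe (α := PreDeformed U)

theorem Cplx.conj_ofReal (v : V) : (Cplx.ofReal v).conj = Cplx.ofReal v := by
  ext <;> simp [Cplx.conj, Cplx.ofReal]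

theorem Cplx.eq_ofReal_add (z : Cplx V) :
    z = Cplx.ofReal z.re + Complex.I • Cplx.ofReal z.im := by
  ext <;> simp [Cplx.ofReal]

theorem Cplx.conj_eq_ofReal_add (z : Cplx V) :
    z.conj = Cplx.ofReal z.re + (-Complex.I) • Cplx.ofReal z.im := by
  ext <;> simp [Cplx.ofReal, Cplx.conj, -neg_smul, neg_one_smul]

/-- The vectors whose inner products with the real Hilbert space are real. -/
def realDual (U : OneParamGroup ℝ V) : Set (Deformed U) :=
  {g | ∀ v : V, star ⟪incl U (Cplx.ofReal v), g⟫ = ⟪incl U (Cplx.ofReal v), g⟫}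

/-- Put $B=\frac{2A}{1+A}$ and $C=2-B$. The deformed inner product of $v$ and $Cw$ is $\langle
v,BCw\rangle$. The conjugation exchanges the commuting operators $B$ and $C$, so $BC$ commutes with
it, and the inner product is real for real $v$ and $w$. -/
theorem incl_mem_realDual (U : OneParamGroup ℝ V) (w : V) :
    incl U (((2 : ℂ) • (1 : Cplx V →L[ℂ] Cplx V) - U.complexify.twoADivOneAddA) (Cplx.ofReal w)) ∈
      realDual U := by
  intro v
  have hB := isConjugate_twoADivOneAddA U
  have hsa := U.complexify.isPositive_twoADivOneAddA.isSymmetric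
  set B := U.complexify.twoADivOneAddA with hBdef
  set C : Cplx V →L[ℂ] Cplx V := (2 : ℂ) • (1 : Cplx V →L[ℂ] Cplx V) - B with hC
  have h1 : B (C (Cplx.ofReal w)) = C (B (Cplx.ofReal w)) := by
    rw [hC]
    simp only [sub_apply, smul_apply, one_apply_eq_self, _root_.map_sub, map_smul]
  have h2 : ∀ z, (C z).conj = B z.conj := by
    intro z
    rw [← Cplx.conj_conj z, ← hB, Cplx.conj_conj, Cplx.conj_conj]
  have h3 : ⟪B (Cplx.ofReal v), C (Cplx.ofReal w)⟫ = ⟪Cplx.ofReal v, B (C (Cplx.ofReal w))⟫ := hsa _ _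
  rw [inner_incl, deformedInner, h3, ← Cplx.inner_conj_conj, hB, h2, Cplx.conj_ofReal, Cplx.conj_ofReal, h1]

/-- The conjugation maps the range of $B$ onto that of $C$, and the range of $B$ is dense. By
complex linearity the span contains $Cz$ for every $z$ in the complexification, not only for real
$z$. -/
theorem dense_span_realDual (U : OneParamGroup ℝ V) :
    Dense (Submodule.span ℂ (realDual U) : Set (Deformed U)) := by
  have hB := isConjugate_twoADivOneAddA U
  have hd := denseRange_twoADivOneAddA U.complexify
  have hmem := incl_mem_realDual U
  set B := U.complexify.twoADivOneAddA with hBdef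
  set C : Cplx V →L[ℂ] Cplx V := (2 : ℂ) • (1 : Cplx V →L[ℂ] Cplx V) - B with hC
  have hC' : ∀ z, incl U (C z) ∈ Submodule.span ℂ (realDual U) := by
    intro z
    rw [Cplx.eq_ofReal_add z, _root_.map_add, map_smul, incl_add, incl_smul]
    exact add_mem (Submodule.subset_span (hmem _)) (Submodule.smul_mem _ _ (Submodule.subset_span (hmem _)))
  have hBC : ∀ z, (B z).conj = C z.conj := hB
  have h1 : ∀ z, incl U z ∈ closure (Submodule.span ℂ (realDual U) : Set (Deformed U)) := by
    intro z
    rw [← Cplx.conj_conj z]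
    refine hd.induction_on (p := fun z => incl U z.conj ∈ closure (Submodule.span ℂ (realDual U) : Set (Deformed U)))
      z.conj ?_ fun y => ?_
    · exact isClosed_closure.preimage ((inclL U).continuous.comp Cplx.continuous_conj)
    · rw [hBC]
      exact subset_closure (hC' _)
  rw [dense_iff_closure_eq, Set.eq_univ_iff_forall]
  intro ξ
  exact (denseRange_incl U).induction_on (p := fun ξ => ξ ∈ closure (Submodule.span ℂ (realDual U) : Set (Deformed U)))
    ξ isClosed_closure h1

theorem star_fieldOp (q : Set.Ioo (-1 : ℝ) 1) (U : OneParamGroup ℝ V) (v : V) :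
    star (fieldOp q U v) = fieldOp q U v := by
  rw [fieldOp, star_add, star_creation, star_annihilation, add_comm]

theorem coe_arakiWoods (q : Set.Ioo (-1 : ℝ) 1) (U : OneParamGroup ℝ V) :
    (arakiWoods q U : Set (Fock q (Deformed U) →L[ℂ] Fock q (Deformed U))) =
      Set.centralizer (Set.centralizer (Set.range (fieldOp q U))) := by
  rw [arakiWoods, coe_generatedBy, Set.union_eq_self_of_subset_right]
  intro x hx
  obtain ⟨v, hv⟩ := hx
  exact ⟨v, by rw [← star_star x, ← hv, star_fieldOp]⟩

/-- The vacuum vector is separating for the `q`-Araki-Woods algebra. -/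
theorem eq_zero_of_vacuum {q : Set.Ioo (-1 : ℝ) 1} {U : OneParamGroup ℝ V}
    {x : Fock q (Deformed U) →L[ℂ] Fock q (Deformed U)} (hx : x ∈ arakiWoods q U)
    (h0 : x (vacuum q (Deformed U)) = 0) : x = 0 := by
  refine eq_zero_of_commute_rightField (dense_span_realDual U) (fun g hg => ?_) h0
  rw [← SetLike.mem_coe, coe_arakiWoods] at hx
  refine (hx _ ?_).symm
  rintro _ ⟨v, rfl⟩
  exact commute_field_rightField (hg v)

theorem IsWick.unique {q : Set.Ioo (-1 : ℝ) 1} {U : OneParamGroup ℝ V} {x y : Gam q U}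
    {ξ : Fock q (Deformed U)} (hx : IsWick x ξ) (hy : IsWick y ξ) : x = y := by
  refine Subtype.ext (sub_eq_zero.1 (eq_zero_of_vacuum (sub_mem x.2 y.2) ?_))
  rw [sub_apply, hx, hy, sub_self]

end Separating

/-! ### Wick words in the algebra -/

section WickAlgebra
variable {V : Type*} [NormedAddCommGroup V] [InnerProductSpace ℝ V] [CompleteSpace V]
  {q : Set.Ioo (-1 : ℝ) 1} {U : OneParamGroup ℝ V}

variable (U) in
/-- A vector and its conjugate, in the deformed Hilbert space. -/
def conjPair (x : Cplx V) : Deformed U × Deformed U := (incl U x, incl U x.conj)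

/-- Annihilation is antilinear, so placing the conjugate vector in it makes $a^*(x)+a(\bar x)$
complex linear in $x$: this is the complex linear extension of the real fields, hence an element of
the algebra. -/
theorem field_conjPair (x : Cplx V) :
    creation q (conjPair U x).1 + annihilation q (conjPair U x).2 =
      fieldOp q U x.re + Complex.I • fieldOp q U x.im := by
  rw [conjPair, Cplx.conj_eq_ofReal_add]
  conv_lhs => rw [Cplx.eq_ofReal_add x]
  rw [incl_add, incl_add, incl_smul, incl_smul, creation_add, creation_smul, annihilation_add,
    annihilation_smul, fieldOp, fieldOp, smul_add, star_neg, Complex.star_def, Complex.conj_I, neg_neg]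
  simp only [Cplx.ofReal, Cplx.re_add, Cplx.im_add, Cplx.re_smul, Cplx.im_smul, Cplx.re_mk, Cplx.im_mk]
  simp
  abel

theorem fieldOp_eq (v : V) : fieldOp q U v =
    creation q (conjPair U (Cplx.ofReal v)).1 + annihilation q (conjPair U (Cplx.ofReal v)).2 := by
  rw [conjPair, Cplx.conj_ofReal, fieldOp]

theorem fieldOp_mem (v : V) : fieldOp q U v ∈ arakiWoods q U := by
  rw [← SetLike.mem_coe, coe_arakiWoods]
  exact Set.subset_centralizer_centralizer ⟨v, rfl⟩

/-- The `q`-Wick products of fields belong to the algebra. -/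
theorem wick_mem {n : ℕ} (e : Fin n → Cplx V) :
    wick n (fun i => conjPair U (e i)) 0 1 ∈ arakiWoods q U := by
  have hf : ∀ x : Cplx V, creation q (conjPair U x).1 + annihilation q (conjPair U x).2 ∈ arakiWoods q U := by
    intro x
    rw [field_conjPair]
    exact add_mem (fieldOp_mem _) ((arakiWoods q U).toStarSubalgebra.smul_mem (fieldOp_mem _) _)
  -- Solving `field_mul_wick` for the longest product expresses it by products that are shorter by
  -- one and by two factors.
  induction n using Nat.strong_induction_on with
  | _ n ih =>
    match n, e, ih with
    | 0, e, _ => exact one_mem _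
    | 1, e, _ =>
      have h := field_mul_wick_zero (q := q) (conjPair U (e 0)) (fun i : Fin 0 => conjPair U (Fin.tail e i))
      have h' : (Fin.cons (conjPair U (e 0)) (fun i : Fin 0 => conjPair U (Fin.tail e i)) :
          Fin 1 → Deformed U × Deformed U) = fun i => conjPair U (e i) := by
        funext i
        refine Fin.cases ?_ (fun j => ?_) i
        · rfl
        · exact j.elim0
      rw [h'] at h
      rw [← h]
      exact mul_mem (hf _) (one_mem _)
    | n + 2, e, ih =>
      have h := field_mul_wick (q := q) (conjPair U (e 0)) (fun i => conjPair U (Fin.tail e i))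
      have h' : (Fin.cons (conjPair U (e 0)) (fun i => conjPair U (Fin.tail e i)) :
          Fin (n + 2) → Deformed U × Deformed U) = fun i => conjPair U (e i) := by
        funext i
        refine Fin.cases ?_ (fun j => ?_) i <;> rfl
      rw [h', ← sub_eq_iff_eq_add] at h
      rw [← h]
      refine sub_mem (mul_mem (hf _) (ih (n + 1) (by omega) (Fin.tail e))) (sum_mem fun p _ => ?_)
      exact (arakiWoods q U).toStarSubalgebra.smul_mem (ih n (by omega) (p.removeNth (Fin.tail e))) _

variable (q U) in
/-- The linear span of the `q`-Wick products of fields. -/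
def wickSpan : Submodule ℂ (Fock q (Deformed U) →L[ℂ] Fock q (Deformed U)) :=
  Submodule.span ℂ {x | ∃ (n : ℕ) (e : Fin n → Cplx V), x = wick n (fun i => conjPair U (e i)) 0 1}

theorem one_mem_wickSpan : (1 : Fock q (Deformed U) →L[ℂ] Fock q (Deformed U)) ∈ wickSpan q U :=
  Submodule.subset_span ⟨0, Fin.elim0, rfl⟩

/-- The recursion for Wick products is read here as stability of their span under left
multiplication by fields, which the bicommutant argument requires. -/
theorem fieldOp_mul_mem_wickSpan (v : V) {a : Fock q (Deformed U) →L[ℂ] Fock q (Deformed U)}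
    (ha : a ∈ wickSpan q U) : fieldOp q U v * a ∈ wickSpan q U := by
  induction ha using Submodule.span_induction with
  | zero => rw [mul_zero]; exact zero_mem _
  | add x y _ _ hx hy => rw [mul_add]; exact add_mem hx hy
  | smul c x _ hx => rw [mul_smul_comm]; exact Submodule.smul_mem _ _ hx
  | mem x hx =>
    obtain ⟨n, e, rfl⟩ := hx
    have h' : ∀ n (e : Fin n → Cplx V), (Fin.cons (conjPair U (Cplx.ofReal v)) (fun i => conjPair U (e i)) :
        Fin (n + 1) → Deformed U × Deformed U) =
        fun i => conjPair U ((Fin.cons (Cplx.ofReal v) e : Fin (n + 1) → Cplx V) i) := by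
      intro n e
      funext i
      refine Fin.cases ?_ (fun j => ?_) i <;> rfl
    rw [fieldOp_eq]
    cases n with
    | zero =>
      rw [field_mul_wick_zero, h']
      exact Submodule.subset_span ⟨_, _, rfl⟩
    | succ n =>
      rw [field_mul_wick, h']
      refine add_mem (Submodule.subset_span ⟨_, _, rfl⟩) (sum_mem fun p _ => Submodule.smul_mem _ _ ?_)
      exact Submodule.subset_span ⟨_, p.removeNth e, rfl⟩

theorem isWick_wick {n : ℕ} (e : Fin n → Cplx V) :
    IsWick (⟨_, wick_mem e⟩ : Gam q U) (tensor q fun i => incl U (e i)) :=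
  wick_vacuum fun i => conjPair U (e i)

theorem existsUnique_isWick {n : ℕ} (e : Fin n → Cplx V) :
    ∃! x : Gam q U, IsWick x (tensor q fun i => incl U (e i)) :=
  ⟨_, isWick_wick e, fun _ hy => hy.unique (isWick_wick e)⟩

/-- In this form $T=JTI$ says that $T$ respects the pairs from which fields are built. Linearity of
the resulting map $t$ is not needed, since it is only evaluated at the entries of Wick products. -/
theorem CommutesWithConj.exists_conjPair {W : Type*} [NormedAddCommGroup W] [InnerProductSpace ℝ W] [CompleteSpace W]
    {U' : OneParamGroup ℝ W} {T : Deformed U →L[ℂ] Deformed U'} (hT : CommutesWithConj T) :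
    ∃ t : Cplx V → Cplx W, ∀ x, (T (conjPair U x).1, T (conjPair U x).2) = conjPair U' (t x) := by
  choose y h1 h2 using hT
  exact ⟨fun x => (y x).conj, fun x => Prod.ext (h2 x) ((h1 x).trans (by rw [conjPair, Cplx.conj_conj]))⟩

end WickAlgebra

/-! ### The second quantization of a contraction -/

open scoped CStarAlgebra in
/-- The compressions of amplifications that map the algebra `M` to the algebra `N`, as completely
positive maps. -/
def compressCP {I : Type*} {F F' L : Type*} [NormedAddCommGroup F] [InnerProductSpace ℂ F] [CompleteSpace F]
    [NormedAddCommGroup F'] [InnerProductSpace ℂ F'] [CompleteSpace F']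
    [NormedAddCommGroup L] [InnerProductSpace ℂ L] [CompleteSpace L] {R : I → F →ₗᵢ[ℂ] L}
    (hR : IsHilbertSum ℂ (fun _ : I => F) R) (v : F' →ₗᵢ[ℂ] L)
    {M : VonNeumannAlgebra F} {N : VonNeumannAlgebra F'} (h : ∀ x ∈ M, compress hR v x ∈ N) :
    M.toStarSubalgebra →CP N.toStarSubalgebra where
  toFun x := ⟨compress hR v x, h _ x.2⟩
  map_add' x y := Subtype.ext (_root_.map_add (compress hR v) (x : F →L[ℂ] F) y)
  map_smul' c x := Subtype.ext (map_smul (compress hR v) c (x : F →L[ℂ] F))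
  map_cstarMatrix_nonneg' n X hX :=
    nonneg_map_of_inner_eq (amplify hR) v _ (fun x ξ ξ' => inner_compress hR v x ξ ξ') n X hX

end QAW
end

open QAW in
open scoped CStarAlgebra in
theorem mainTheorem2 {V : Type*} [NormedAddCommGroup V] [InnerProductSpace ℝ V] [CompleteSpace V]
    {W : Type*} [NormedAddCommGroup W] [InnerProductSpace ℝ W] [CompleteSpace W]
    (q : Set.Ioo (-1 : ℝ) 1) (U : OneParamGroup ℝ V) (U' : OneParamGroup ℝ W)
    (T : Deformed U →L[ℂ] Deformed U') (hT : ‖T‖ ≤ 1) (hJTI : CommutesWithConj T) :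
    ∃ Φ : Gam q U →CP Gam q U',
      Φ 1 = 1 ∧ IsNormal Φ ∧ (∀ x, vacuumState (Φ x) = vacuumState x) ∧
      ∀ (n : ℕ) (e : Fin n → Cplx V),
        (∃! x : Gam q U, IsWick x (tensor q fun i => incl U (e i))) ∧
        (∃! y : Gam q U', IsWick y (tensor q fun i => T (incl U (e i)))) ∧
        ∀ x : Gam q U, IsWick x (tensor q fun i => incl U (e i)) →
          IsWick (Φ x) (tensor q fun i => T (incl U (e i))) := by
  obtain ⟨ι, v, hιv⟩ := exists_dilation T hT
  obtain ⟨I, η, hη, h1, ⟨i₀, hi₀⟩, hR⟩ := exists_isHilbertSum_embed (q := q) ι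
  obtain ⟨t, ht⟩ := hJTI.exists_conjPair
  set v' := secondQuantization q v with hv'
  have hwick : ∀ (n : ℕ) (e : Fin n → Cplx V),
      compress hR v' (wick n (fun i => conjPair U (e i)) 0 1) =
        wick n (fun i => conjPair U' (t (e i))) 0 1 := by
    intro n e
    rw [hv', compress_wick hR hιv, compress_one]
    simp only [ht]
  have hmem : ∀ x ∈ arakiWoods q U, compress hR v' x ∈ arakiWoods q U' := by
    intro x hx
    rw [← SetLike.mem_coe, coe_arakiWoods] at hx ⊢
    -- An operator $y$ that commutes with the fields of the target commutes with its Wick products,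
    -- that is, with the compressions of the Wick products of the source. The bicommutant argument
    -- extends this to the compression of the whole algebra.
    refine fun y hy => compress_mul_eq_mul_compress hR v' (S := Set.range (fieldOp q U))
      ?_ one_mem_wickSpan ?_ (fun a ha => ?_) hx
    · rintro _ ⟨w, rfl⟩
      exact star_fieldOp q U w
    · rintro _ ⟨w, rfl⟩ a ha
      exact fieldOp_mul_mem_wickSpan w ha
    · induction ha using Submodule.span_induction with
      | zero => rw [_root_.map_zero, mul_zero, zero_mul]
      | add a b _ _ ha hb => rw [_root_.map_add, mul_add, add_mul, ha, hb]
      | smul c a _ ha => rw [map_smul, mul_smul_comm, smul_mul_assoc, ha]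
      | mem a ha =>
        obtain ⟨n, e, rfl⟩ := ha
        rw [hwick]
        have h2 := wick_mem (q := q) (U := U') fun i => t (e i)
        rw [← SetLike.mem_coe, coe_arakiWoods] at h2
        exact h2 y hy
  have hT' : ∀ (n : ℕ) (e : Fin n → Cplx V),
      (fun i => T (incl U (e i))) = fun i => incl U' (t (e i)) := fun n e =>
    funext fun i => congrArg Prod.fst (ht (e i))
  refine ⟨compressCP hR v' hmem, Subtype.ext (compress_one hR v'), ?_, fun x => ?_, fun n e => ⟨?_, ?_, ?_⟩⟩
  · exact isNormal_of_inner_eq hR v' _ fun x ξ ξ' => inner_compress hR v' x ξ ξ'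
  · refine (inner_compress hR v' x _ _).trans ?_
    -- The vacuum of the large Fock space is also the vacuum of the copy $i_0$, in which the
    -- amplification acts as $x$ itself.
    have hΩ : v' (vacuum q (Deformed U')) = embed ι (η i₀) (hη i₀) (h1 i₀) (vacuum q (Deformed U)) := by
      rw [hv', secondQuantization_vacuum, embed_vacuum, hi₀]
    rw [hΩ, amplify_apply hR, LinearIsometry.inner_map_map]
    rfl
  · exact existsUnique_isWick e
  · rw [hT']
    exact existsUnique_isWick _
  · intro x hx
    -- The separating vacuum identifies an arbitrary Wick word with the explicit normally ordered
    -- product, whose compression is known.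
    obtain rfl := hx.unique (isWick_wick e)
    rw [hT', IsWick]
    refine (congrArg (fun y => y (vacuum q (Deformed U'))) (hwick n e)).trans ?_
    exact isWick_wick fun i => t (e i)
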